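/- Let $G=(V,E)$ be an undirected simple graph with $V=\{0,\dots,n-1\}$, with integer edge weights in the range $[1,M]$, $M\ge 1$, and let $s\in V$ be the source. For $t\in V$ and $e\in E$ let $d(s,t,e)$ be the minimum weight of a path from $s$ to $t$ in $G$ that does not use $e$, and for $v\in V$ let $d(s,t,v)$ be the minimum weight of a path from $s$ to $t$ that does not visit $v$ (each is $\infty$ if there is no such path). The model of computation is a deterministic word RAM with unit-cost elementary operations on words of $w$ bits, where $w\ge\kappa\log_2(n+M)$ for an absolute constant $\kappa$ (hence words of $O(\log n)$ bits suffice if $M=\mathrm{poly}(n)$); sizes are numbers of words. The graph $G$ need not be connected; a shortest-path tree $T_s$ of $G$ rooted in $s$ spans the vertices reachable from $s$. (1) Edge failures. There are a preprocessing program and a query program (both fixed, independent of the input) with the following property. The preprocessing program is given $n$, $s$, a shortest-path tree $T_s$ (the parent of each vertex and the weight of each tree edge), and a table of all the values $d(s,t,e)$ for $t\in V$ and $e\in E(T_s)$; it does not have access to $G$. In time $O(n^2)$ it builds a data structure (a Single-Source Distance Sensitivity Oracle) of size $O(M^{1/2}n^{3/2})$. Given only this data structure and a query consisting of $t\in V$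 and (the two endpoints of) any edge $e\in E$, the query program returns $d(s,t,e)$ in time $\widetilde O(1)$, that is, in time $O((1+\log n)^k)$ for an absolute constant $k$. (2) Vertex failures. The same holds if instead a table of the values $d(s,t,v)$ for all $t,v\in V$ is given, together with $T_s$: in time $O(n^2)$ one builds a data structure of size $O(M^{1/2}n^{3/2})$ from which, for every query $(t,v)\in V\times V$, the value $d(s,t,v)$ is returned in time $\widetilde O(1)$. All constants hidden in the $O$-notation are absolute. -/

import Mathlib

namespace SSDSO

/-! ### Weighted distances and replacement distances -/

/-- The weight of a walk: the sum of the weights of its edges. -/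
def walkWeight {V : Type*} {G : SimpleGraph V} (wt : Sym2 V → ℕ) {u v : V} (p : G.Walk u v) : ℕ :=
  (p.edges.map wt).sum

/-- The distance `d(s,t)` in the weighted graph; it is `⊤` if there is no path from `s` to `t`. -/
noncomputable def wdist {V : Type*} (G : SimpleGraph V) (wt : Sym2 V → ℕ) (s t : V) : ℕ∞ :=
  ⨅ p : G.Walk s t, (walkWeight wt p : ℕ∞)

/-- The replacement distance `d(s,t,e)`: the least weight of a path from `s` to `t` that does not
use the edge `e`; it is `⊤` if there is none. -/
noncomputable def edgeReplDist {V : Type*} (G : SimpleGraph V) (wt : Sym2 V → ℕ) (s t : V)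
    (e : Sym2 V) : ℕ∞ :=
  ⨅ (p : G.Walk s t) (_ : e ∉ p.edges), (walkWeight wt p : ℕ∞)

/-- The replacement distance `d(s,t,x)`: the least weight of a path from `s` to `t` that does not
visit the vertex `x`; it is `⊤` if there is none, in particular if `x = s` or `x = t`. -/
noncomputable def vertexReplDist {V : Type*} (G : SimpleGraph V) (wt : Sym2 V → ℕ) (s t : V)
    (x : V) : ℕ∞ :=
  ⨅ (p : G.Walk s t) (_ : x ∉ p.support), (walkWeight wt p : ℕ∞)

/-- `par` is the parent map of a shortest-path tree of the weighted graph rooted in `s`: the root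
and the vertices that cannot be reached from `s` have no parent, and every vertex `t` that can be
reached is joined to the root by a path along parent pointers which is a shortest `s`-`t`-path.
The edges of the tree are the edges `{par v, v}`. -/
structure IsShortestPathTree {V : Type*} (G : SimpleGraph V) (wt : Sym2 V → ℕ) (s : V)
    (par : V → Option V) : Prop where
  root : par s = none
  unreachable : ∀ t, ¬ G.Reachable s t → par t = none
  path : ∀ t, G.Reachable s t → ∃ p : G.Walk s t,
    (∀ d ∈ p.darts, par d.snd = some d.fst) ∧ (walkWeight wt p : ℕ∞) = wdist G wt s t

/-! ### The word RAM

Words of `w` bits are the natural numbers below `2 ^ w`. A program uses finitely many registers and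
finitely many arrays of words; an array cell is addressed by a word that is computed at run time. -/

/-- Memory contents: `reg x` is register `x`, and `arr a i` is cell `i` of array `a`. -/
structure State where
  reg : ℕ → ℕ
  arr : ℕ → ℕ → ℕ

/-- The elementary operations on words. -/
inductive BinOp
  | add | sub | mul | div | mod | lt | eq

/-- Arithmetic is modulo `2 ^ w`; comparisons return `1` for true and `0` for false. -/
def BinOp.eval (w : ℕ) : BinOp → ℕ → ℕ → ℕ
  | .add, a, b => (a + b) % 2 ^ w
  | .sub, a, b => (2 ^ w + a - b) % 2 ^ w
  | .mul, a, b => (a * b) % 2 ^ w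
  | .div, a, b => (a / b) % 2 ^ w
  | .mod, a, b => (a % b) % 2 ^ w
  | .lt, a, b => (if a < b then 1 else 0) % 2 ^ w
  | .eq, a, b => (if a = b then 1 else 0) % 2 ^ w

/-- Expressions: constants, registers, array cells, and elementary operations. -/
inductive Expr
  | const (c : ℕ)
  | reg (x : ℕ)
  | cell (a : ℕ) (i : Expr)
  | op (o : BinOp) (e f : Expr)

/-- The value of an expression. -/
def Expr.eval (w : ℕ) (σ : State) : Expr → ℕ
  | .const c => c % 2 ^ w
  | .reg x => σ.reg x
  | .cell a i => σ.arr a (i.eval w σ)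
  | .op o e f => o.eval w (e.eval w σ) (f.eval w σ)

/-- The time to evaluate an expression: one step for each constant, register access, array access
and elementary operation in it. -/
def Expr.cost : Expr → ℕ
  | .const _ => 1
  | .reg _ => 1
  | .cell _ i => i.cost + 1
  | .op _ e f => e.cost + f.cost + 1

/-- Deterministic programs. -/
inductive Prog
  | skip
  | assign (x : ℕ) (e : Expr)
  | store (a : ℕ) (i e : Expr)
  | seq (p q : Prog)
  | ite (e : Expr) (p q : Prog)
  | loop (e : Expr) (p : Prog)

/-- Write `v` into register `x`. -/
def State.setReg (σ : State) (x v : ℕ) : State :=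
  { σ with reg := Function.update σ.reg x v }

/-- Write `v` into cell `i` of array `a`. -/
def State.setArr (σ : State) (a i v : ℕ) : State :=
  { σ with arr := Function.update σ.arr a (Function.update (σ.arr a) i v) }

/-- `Run w p σ σ' c`: with words of `w` bits, the program `p` started in `σ` halts in `σ'` after
exactly `c` steps. `ite e p q` runs `p` if `e ≠ 0` and `q` otherwise; `loop e p` repeats `p` as long
as `e ≠ 0`. -/
inductive Run (w : ℕ) : Prog → State → State → ℕ → Prop
  | skip (σ : State) : Run w .skip σ σ 1
  | assign (σ : State) (x : ℕ) (e : Expr) :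
      Run w (.assign x e) σ (σ.setReg x (e.eval w σ)) (e.cost + 1)
  | store (σ : State) (a : ℕ) (i e : Expr) :
      Run w (.store a i e) σ (σ.setArr a (i.eval w σ) (e.eval w σ)) (i.cost + e.cost + 1)
  | seq {p q : Prog} {σ σ₁ σ₂ : State} {c₁ c₂ : ℕ} :
      Run w p σ σ₁ c₁ → Run w q σ₁ σ₂ c₂ → Run w (.seq p q) σ σ₂ (c₁ + c₂)
  | ite_true {e : Expr} {p q : Prog} {σ σ₁ : State} {c : ℕ} :
      e.eval w σ ≠ 0 → Run w p σ σ₁ c → Run w (.ite e p q) σ σ₁ (e.cost + c + 1)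
  | ite_false {e : Expr} {p q : Prog} {σ σ₁ : State} {c : ℕ} :
      e.eval w σ = 0 → Run w q σ σ₁ c → Run w (.ite e p q) σ σ₁ (e.cost + c + 1)
  | loop_done {e : Expr} {p : Prog} {σ : State} :
      e.eval w σ = 0 → Run w (.loop e p) σ σ (e.cost + 1)
  | loop_step {e : Expr} {p : Prog} {σ σ₁ σ₂ : State} {c₁ c₂ : ℕ} :
      e.eval w σ ≠ 0 → Run w p σ σ₁ c₁ → Run w (.loop e p) σ₁ σ₂ c₂ →
      Run w (.loop e p) σ σ₂ (e.cost + c₁ + c₂ + 1)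

/-- The model is deterministic: final state and number of steps are determined by the start. -/
theorem Run.deterministic {w : ℕ} {p : Prog} {σ σ₁ σ₂ : State} {c₁ c₂ : ℕ}
    (h₁ : Run w p σ σ₁ c₁) (h₂ : Run w p σ σ₂ c₂) : σ₁ = σ₂ ∧ c₁ = c₂ := by
  induction h₁ generalizing σ₂ c₂ with
  | skip => cases h₂; exact ⟨rfl, rfl⟩
  | assign => cases h₂; exact ⟨rfl, rfl⟩
  | store => cases h₂; exact ⟨rfl, rfl⟩
  | seq _ _ ih₁ ih₂ =>
    cases h₂ with
    | seq a b =>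
      obtain ⟨rfl, rfl⟩ := ih₁ a
      obtain ⟨rfl, rfl⟩ := ih₂ b
      exact ⟨rfl, rfl⟩
  | ite_true h _ ih =>
    cases h₂ with
    | ite_true _ a => obtain ⟨rfl, rfl⟩ := ih a; exact ⟨rfl, rfl⟩
    | ite_false h' _ => exact absurd h' h
  | ite_false h _ ih =>
    cases h₂ with
    | ite_true h' _ => exact absurd h h'
    | ite_false _ a => obtain ⟨rfl, rfl⟩ := ih a; exact ⟨rfl, rfl⟩
  | loop_done h =>
    cases h₂ with
    | loop_done _ => exact ⟨rfl, rfl⟩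
    | loop_step h' _ _ => exact absurd h h'
  | loop_step h _ _ ih₁ ih₂ =>
    cases h₂ with
    | loop_done h' => exact absurd h' h
    | loop_step _ a b =>
      obtain ⟨rfl, rfl⟩ := ih₁ a
      obtain ⟨rfl, rfl⟩ := ih₂ b
      exact ⟨rfl, rfl⟩

/-! ### Input, output and queries -/

/-- A distance as a word: a finite distance is stored as it is, and `⊤` as the all-ones word. -/
noncomputable def encDist (w : ℕ) (d : ℕ∞) : ℕ :=
  if d = ⊤ then 2 ^ w - 1 else d.toNat

/-- Cells holding the words of a list, and `0` behind its end. -/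
def cells (l : List ℕ) : ℕ → ℕ := fun i => l.getD i 0

/-- The input of the preprocessing. Registers `0` and `1` hold `n` and `s`, array `0` the parents in
the shortest-path tree (with `n` for "no parent"), array `1` the weights of the tree edges
`{par v, v}`, indexed by `v`, and cell `t * n + v` of array `2` holds `table t v`. All other
registers and cells are `0`. -/
def buildInput {n : ℕ} (wt : Sym2 (Fin n) → ℕ) (s : Fin n) (par : Fin n → Option (Fin n))
    (table : Fin n → Fin n → ℕ) : State where
  reg := cells [n, s]
  arr
    | 0 => cells (List.ofFn fun v => (par v).elim n fun u => (u : ℕ))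
    | 1 => cells (List.ofFn fun v => (par v).elim 0 fun u => wt s(u, v))
    | 2 => cells (List.ofFn fun j : Fin (n * n) => table j.divNat j.modNat)
    | _ => fun _ => 0

/-- The table of the values `d(s,t,e)` for the edges `e = {par v, v}` of the tree. Entries for a
vertex `v` without a parent are not used and are set to `0`. -/
noncomputable def edgeTable {n : ℕ} (w : ℕ) (G : SimpleGraph (Fin n)) (wt : Sym2 (Fin n) → ℕ)
    (s : Fin n) (par : Fin n → Option (Fin n)) (t v : Fin n) : ℕ :=
  (par v).elim 0 fun u => encDist w (edgeReplDist G wt s t s(u, v))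

/-- The table of the values `d(s,t,v)` for the vertices `v`. -/
noncomputable def vertexTable {n : ℕ} (w : ℕ) (G : SimpleGraph (Fin n)) (wt : Sym2 (Fin n) → ℕ)
    (s : Fin n) (t v : Fin n) : ℕ :=
  encDist w (vertexReplDist G wt s t v)

/-- The data structure built by the preprocessing: the words in the first `reg 0` cells of
array `3`. -/
def State.output (σ : State) : List ℕ := (List.range (σ.reg 0)).map (σ.arr 3)

/-- The program `p`, started in `σ`, halts within `T` steps and outputs the data structure `D`. -/
def BuildsWithin (w : ℕ) (p : Prog) (σ : State) (T : ℕ) (D : List ℕ) : Prop :=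
  ∃ (σ' : State) (c : ℕ), Run w p σ σ' c ∧ c ≤ T ∧ σ'.output = D

/-- The start of a query: array `0` holds the data structure and the first registers hold the
arguments of the query. All other registers and cells are `0`. -/
def queryInput (D : List ℕ) (args : List ℕ) : State where
  reg := cells args
  arr
    | 0 => cells D
    | _ => fun _ => 0

/-- The program `p`, run on the data structure `D` and the arguments `args`, halts within `T` steps
with the answer in register `0`. -/
def AnswersWithin (w : ℕ) (p : Prog) (D args : List ℕ) (T : ℕ) (answer : ℕ) : Prop :=
  ∃ (σ' : State) (c : ℕ), Run w p (queryInput D args) σ' c ∧ c ≤ T ∧ σ'.reg 0 = answer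

end SSDSO

open SSDSO

namespace SSDSO

/-! ### A program logic with time bounds -/

/-! Both kinds of failure are indexed by a tree vertex `v` with a parent: `v` removes either the
edge to its parent or all edges at `v`. `IsFailure` keeps only what the argument needs from these
two cases. If `v` is not an ancestor of `t`, the tree path to `t` survives and the answer is
`d(s,t)`; only ancestors matter.

Let `L` be the square root of `n`, rounded up. Some residue `r` modulo `L` is the residue of the
depth of at most `n / L` vertices (`exists_residueCount_le`), and the full table row is kept for
each of these. Every `t` also keeps its first `L` iterated parents, itself included, with their
table entries; this settles failures fewer than `L` levels above `t`. For a higher failure, let the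
pivot `x` be the closest ancestor of `t` (possibly `t`) with depth residue `r`, or the root if there
is none. It is fewer than `L` levels above `t`, so `v` lies above `x`, and `d(s,t,v) ≤ d(s,x,v) +
d(x,t)`, where the right side is read off the row of `x`. The failure is bad for `t` and `x` if this
inequality is strict.

For a bad `v`, a shortest replacement path to `t` misses the whole tree path from `v` to `x`
(`exists_path_of_bad`), since from a common vertex one could continue to `x` in the tree. The same
path therefore serves every failure between `v` and `x` (`replDist_le_of_bad`): on the bad failures
the distance does not increase with depth. It suffices to store each value once, with the least
depth where it occurs. Binary search for the depth of `v`, followed by a minimum with the value via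
`x`, gives the answer, also when `v` is not bad or not an ancestor (`far_correct`).

The size rests on `sq_le_of_bad_chain`: `m` distinct bad values force `m ^ 2 ≤ 16 * M * n`. The
replacement path for a bad failure leaves the tree path to `x` for the last time at some `a` and
then follows a detour to `t`. If the values strictly decrease downwards, the detour of each failure
starts at or below the previous failure (`anc_detour_start`). For every second failure the starts
are then strictly below all earlier failures, and a vertex common to two detours lies far along the
lower one (`lt_of_mem_detours`): with `D` the lower value and `d = d(s,t)`, its distance along that
detour exceeds `(D - d) / 2`. So initial pieces with about `(D - d) / (2 * M)` edges are disjoint.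
The excesses `D - d` are distinct naturals, so with `k` detours these pieces have order `k ^ 2 / M`
vertices in total, while only `n` are available (`sq_le_of_detours`).

The remainder runs this on the word RAM. `Model` states the combinatorial facts for words,
`IsShortestPathTree.model` derives them from the graph, and the programs are verified against
`Model` alone, in a Hoare logic with time bounds. -/

/-- Started in `σ`, the program halts within `T` steps in a state with property `Q`. -/
def Wp (w : ℕ) (p : Prog) (σ : State) (T : ℕ) (Q : State → Prop) : Prop :=
  ∃ (σ' : State) (c : ℕ), Run w p σ σ' c ∧ c ≤ T ∧ Q σ'

/-- The registers a program may write. -/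
def Prog.regs : Prog → List ℕ
  | .skip => []
  | .assign x _ => [x]
  | .store _ _ _ => []
  | .seq p q => p.regs ++ q.regs
  | .ite _ p q => p.regs ++ q.regs
  | .loop _ p => p.regs

/-- The arrays a program may write. -/
def Prog.arrs : Prog → List ℕ
  | .skip => []
  | .assign _ _ => []
  | .store a _ _ => [a]
  | .seq p q => p.arrs ++ q.arrs
  | .ite _ p q => p.arrs ++ q.arrs
  | .loop _ p => p.arrs

/-- `σ'` agrees with `σ` on everything that `p` cannot write. -/
structure Frame (p : Prog) (σ σ' : State) : Prop where
  reg : ∀ x, x ∉ p.regs → σ'.reg x = σ.reg x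
  arr : ∀ a, a ∉ p.arrs → σ'.arr a = σ.arr a

theorem Frame.refl (p : Prog) (σ : State) : Frame p σ σ := ⟨fun _ _ => rfl, fun _ _ => rfl⟩

theorem Frame.trans {p : Prog} {σ σ₁ σ₂ : State} (h : Frame p σ σ₁) (h' : Frame p σ₁ σ₂) :
    Frame p σ σ₂ :=
  ⟨fun x hx => (h'.reg x hx).trans (h.reg x hx), fun a ha => (h'.arr a ha).trans (h.arr a ha)⟩

theorem Frame.mono {p q : Prog} {σ σ' : State} (h : Frame p σ σ') (h₁ : p.regs ⊆ q.regs)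
    (h₂ : p.arrs ⊆ q.arrs) : Frame q σ σ' :=
  ⟨fun x hx => h.reg x fun h' => hx (h₁ h'), fun a ha => h.arr a fun h' => ha (h₂ h')⟩

/-- Spares loop invariants from mentioning anything that the body does not write; membership of a
fixed register or array is then settled by `decide`. -/
theorem Run.frame {w : ℕ} {p : Prog} {σ σ' : State} {c : ℕ} (h : Run w p σ σ' c) :
    Frame p σ σ' := by
  induction h with
  | skip σ => exact .refl _ _
  | assign σ x e =>
    refine ⟨fun y hy => ?_, fun _ _ => rfl⟩
    simp only [Prog.regs, List.mem_singleton] at hy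
    simp [State.setReg, hy]
  | store σ a i e =>
    refine ⟨fun _ _ => rfl, fun b hb => ?_⟩
    simp only [Prog.arrs, List.mem_singleton] at hb
    simp [State.setArr, hb]
  | seq _ _ h₁ h₂ =>
    exact (h₁.mono (by simp [Prog.regs]) (by simp [Prog.arrs])).trans
      (h₂.mono (by simp [Prog.regs]) (by simp [Prog.arrs]))
  | ite_true _ _ h => exact h.mono (by simp [Prog.regs]) (by simp [Prog.arrs])
  | ite_false _ _ h => exact h.mono (by simp [Prog.regs]) (by simp [Prog.arrs])
  | loop_done => exact .refl _ _
  | loop_step _ _ _ h₁ h₂ => exact (h₁.mono (by simp [Prog.regs]) (by simp [Prog.arrs])).trans h₂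

/-- The effect of a program without loops. -/
def exec (w : ℕ) : Prog → State → State
  | .skip, σ => σ
  | .assign x e, σ => σ.setReg x (e.eval w σ)
  | .store a i e, σ => σ.setArr a (i.eval w σ) (e.eval w σ)
  | .seq p q, σ => exec w q (exec w p σ)
  | .ite e p q, σ => if e.eval w σ = 0 then exec w q σ else exec w p σ
  | .loop _ _, σ => σ

/-- The program has no loops. -/
def Prog.straight : Prog → Bool
  | .seq p q => p.straight && q.straight
  | .ite _ p q => p.straight && q.straight
  | .loop _ _ => false
  | _ => true

/-- An upper bound for the time of a program without loops. -/
def Prog.time : Prog → ℕ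
  | .skip => 1
  | .assign _ e => e.cost + 1
  | .store _ i e => i.cost + e.cost + 1
  | .seq p q => p.time + q.time
  | .ite e p q => e.cost + (p.time + q.time) + 1
  | .loop _ _ => 0

theorem exists_run_of_straight (w : ℕ) (p : Prog) (σ : State) (h : p.straight = true) :
    ∃ c, Run w p σ (exec w p σ) c ∧ c ≤ p.time := by
  induction p generalizing σ with
  | skip => exact ⟨_, .skip σ, le_rfl⟩
  | assign x e => exact ⟨_, .assign σ x e, le_rfl⟩
  | store a i e => exact ⟨_, .store σ a i e, le_rfl⟩
  | seq p q hp hq =>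
    simp only [Prog.straight, Bool.and_eq_true] at h
    obtain ⟨c, h₁, h₂⟩ := hp σ h.1
    obtain ⟨c', h₃, h₄⟩ := hq (exec w p σ) h.2
    exact ⟨_, .seq h₁ h₃, Nat.add_le_add h₂ h₄⟩
  | ite e p q hp hq =>
    simp only [Prog.straight, Bool.and_eq_true] at h
    by_cases he : e.eval w σ = 0
    · obtain ⟨c, h₁, h₂⟩ := hq σ h.2
      rw [exec, if_pos he]
      exact ⟨_, .ite_false he h₁, by simp only [Prog.time]; omega⟩
    · obtain ⟨c, h₁, h₂⟩ := hp σ h.1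
      rw [exec, if_neg he]
      exact ⟨_, .ite_true he h₁, by simp only [Prog.time]; omega⟩
  | loop e p => simp [Prog.straight] at h

theorem Wp.straight {w : ℕ} {p : Prog} {σ : State} {T : ℕ} {Q : State → Prop}
    (h : p.straight = true) (hT : p.time ≤ T) (hQ : Q (exec w p σ)) : Wp w p σ T Q := by
  obtain ⟨c, h₁, h₂⟩ := exists_run_of_straight w p σ h
  exact ⟨_, c, h₁, h₂.trans hT, hQ⟩

theorem Wp.mono {w : ℕ} {p : Prog} {σ : State} {T T' : ℕ} {Q Q' : State → Prop}
    (h : Wp w p σ T Q) (hT : T ≤ T') (hQ : ∀ σ', Q σ' → Q' σ') : Wp w p σ T' Q' := by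
  obtain ⟨σ', c, h₁, h₂, h₃⟩ := h
  exact ⟨σ', c, h₁, h₂.trans hT, hQ _ h₃⟩

theorem Wp.frame {w : ℕ} {p : Prog} {σ : State} {T : ℕ} {Q : State → Prop}
    (h : Wp w p σ T Q) : Wp w p σ T (fun σ' => Q σ' ∧ Frame p σ σ') := by
  obtain ⟨σ', c, h₁, h₂, h₃⟩ := h
  exact ⟨σ', c, h₁, h₂, h₃, h₁.frame⟩

theorem Wp.seq {w : ℕ} {p q : Prog} {σ : State} {T T₁ T₂ : ℕ} {Q R : State → Prop}
    (h₁ : Wp w p σ T₁ R) (h₂ : ∀ σ', Frame p σ σ' → R σ' → Wp w q σ' T₂ Q) (hT : T₁ + T₂ ≤ T) :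
    Wp w (.seq p q) σ T Q := by
  obtain ⟨σ₁, c, h, h', h''⟩ := h₁
  obtain ⟨σ₂, d, g, g', g''⟩ := h₂ σ₁ h.frame h''
  exact ⟨σ₂, _, .seq h g, by omega, g''⟩

/-- Sequencing after a program without loops. -/
theorem Wp.seq_straight {w : ℕ} {p q : Prog} {σ : State} {T T₁ : ℕ} {Q : State → Prop}
    (h : p.straight = true) (h₁ : Wp w q (exec w p σ) T₁ Q) (hT : p.time + T₁ ≤ T) :
    Wp w (.seq p q) σ T Q := by
  obtain ⟨c, g, g'⟩ := exists_run_of_straight w p σ h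
  obtain ⟨σ₂, d, k, k', k''⟩ := h₁
  exact ⟨σ₂, _, .seq g k, by omega, k''⟩

theorem Wp.ite {w : ℕ} {e : Expr} {p q : Prog} {σ : State} {T T' : ℕ} {Q : State → Prop}
    (h₁ : e.eval w σ ≠ 0 → Wp w p σ T' Q) (h₂ : e.eval w σ = 0 → Wp w q σ T' Q)
    (hT : e.cost + T' + 1 ≤ T) : Wp w (.ite e p q) σ T Q := by
  by_cases he : e.eval w σ = 0
  · obtain ⟨σ', c, h, h', h''⟩ := h₂ he
    exact ⟨σ', _, .ite_false he h, by omega, h''⟩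
  · obtain ⟨σ', c, h, h', h''⟩ := h₁ he
    exact ⟨σ', _, .ite_true he h, by omega, h''⟩

/-- Loops with an invariant `I` and a variant `μ`. -/
theorem Wp.loop {w : ℕ} {e : Expr} {p : Prog} {σ₀ : State} {T c : ℕ} (I : State → Prop)
    (μ : State → ℕ) (h₀ : I σ₀)
    (h : ∀ σ, Frame p σ₀ σ → I σ → e.eval w σ ≠ 0 → Wp w p σ c (fun σ' => I σ' ∧ μ σ' < μ σ))
    (hT : μ σ₀ * (e.cost + c + 1) + e.cost + 1 ≤ T) :
    Wp w (.loop e p) σ₀ T (fun σ' => I σ' ∧ e.eval w σ' = 0) := by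
  -- Induction on a bound for the variant with the start state generalised. The frame stays relative
  -- to `σ₀`, so the body may use every value that the whole loop leaves fixed.
  suffices H : ∀ m σ, Frame p σ₀ σ → I σ → μ σ ≤ m →
      Wp w (.loop e p) σ (m * (e.cost + c + 1) + e.cost + 1)
        (fun σ' => I σ' ∧ e.eval w σ' = 0) from
    (H _ σ₀ (.refl _ _) h₀ le_rfl).mono hT fun _ h => h
  intro m
  induction m with
  | zero =>
    intro σ hf hI hm
    by_cases he : e.eval w σ = 0
    · exact ⟨σ, _, .loop_done he, by omega, hI, he⟩
    · obtain ⟨_, _, _, _, _, h'⟩ := h σ hf hI he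
      omega
  | succ m ih =>
    intro σ hf hI hm
    by_cases he : e.eval w σ = 0
    · exact ⟨σ, _, .loop_done he, by omega, hI, he⟩
    · obtain ⟨σ₁, c₁, r₁, h₁, hI₁, hμ⟩ := h σ hf hI he
      obtain ⟨σ₂, c₂, r₂, h₂, hQ⟩ := ih σ₁ (hf.trans r₁.frame) hI₁ (by omega)
      exact ⟨σ₂, _, .loop_step he r₁ r₂, by rw [Nat.succ_mul]; omega, hQ⟩

/-- `for i < lim do body`, where `i` and `lim` are registers. -/
def Prog.forLoop (i lim : ℕ) (body : Prog) : Prog :=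
  .seq (.assign i (.const 0)) (.loop (.op .lt (.reg i) (.reg lim))
    (.seq body (.assign i (.op .add (.reg i) (.const 1)))))

/-- The invariant at `k` speaks of the state whose counter already holds `k`, hence `setReg` in the
step. A round costs `c` plus 3 for the test, 4 for the increment and 1 for the loop; the final 6
pays for the initial assignment and the last test. -/
theorem Wp.forLoop {w : ℕ} {i lim : ℕ} {body : Prog} {σ₀ : State} {T c : ℕ} (N : ℕ)
    (I : ℕ → State → Prop) (hi : i ∉ body.regs) (hl : lim ∉ body.regs) (hil : lim ≠ i)
    (hw : 1 < 2 ^ w) (hN : N < 2 ^ w) (hlim : σ₀.reg lim = N) (h₀ : I 0 (σ₀.setReg i 0))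
    (h : ∀ k σ, k < N → Frame (.forLoop i lim body) σ₀ σ → σ.reg i = k → I k σ →
      Wp w body σ c (fun σ' => I (k + 1) (σ'.setReg i (k + 1))))
    (hT : N * (c + 8) + 6 ≤ T) :
    Wp w (.forLoop i lim body) σ₀ T (fun σ' => I N σ') := by
  have hc0 : (Expr.const 0).eval w σ₀ = 0 := by simp [Expr.eval]
  refine Wp.seq_straight (T₁ := N * (c + 8) + 4) (by rfl) ?_
    (by simp only [Prog.time, Expr.cost]; omega)
  rw [exec, hc0]
  have key := Wp.loop (w := w) (e := .op .lt (.reg i) (.reg lim))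
    (p := .seq body (.assign i (.op .add (.reg i) (.const 1)))) (σ₀ := σ₀.setReg i 0)
    (c := c + 4) (T := N * (c + 8) + 4) (fun σ => σ.reg i ≤ N ∧ I (σ.reg i) σ)
    (fun σ => N - σ.reg i) ⟨by simp [State.setReg], by simpa [State.setReg] using h₀⟩ ?_ ?_
  · obtain ⟨σ', c', hr, hc', ⟨hle, hI⟩, he⟩ := key
    refine ⟨σ', c', hr, hc', ?_⟩
    have hfr : σ'.reg lim = N := by
      rw [hr.frame.reg lim (by simp [Prog.regs, hl, hil]), ← hlim]; simp [State.setReg, hil]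
    have : ¬ σ'.reg i < N := by
      intro hlt
      simp [Expr.eval, BinOp.eval, hfr, hlt, Nat.mod_eq_of_lt hw] at he
    rwa [show σ'.reg i = N by omega] at hI
  · rintro σ hf ⟨hle, hI⟩ he
    have hfr : σ.reg lim = N := by
      rw [hf.reg lim (by simp [Prog.regs, hl, hil]), ← hlim]; simp [State.setReg, hil]
    have hlt : σ.reg i < N := by
      by_contra hlt
      simp [Expr.eval, BinOp.eval, hfr, hlt] at he
    have hf' : Frame (.forLoop i lim body) σ₀ σ := by
      refine ⟨fun x hx => ?_, fun a ha => ?_⟩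
      · simp only [Prog.forLoop, Prog.regs, List.mem_append, List.mem_singleton, not_or] at hx
        rw [hf.reg x (by simp [Prog.regs, hx])]; simp [State.setReg, hx]
      · rw [hf.arr a (by simpa [Prog.forLoop, Prog.arrs] using ha)]; rfl
    obtain ⟨σ', d, hr, hd, hQ⟩ := h (σ.reg i) σ hlt hf' rfl hI
    have hi' : σ'.reg i = σ.reg i := hr.frame.reg i hi
    have hev : (Expr.op .add (.reg i) (.const 1)).eval w σ' = σ.reg i + 1 := by
      simp only [Expr.eval, BinOp.eval, hi', Nat.mod_eq_of_lt hw]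
      exact Nat.mod_eq_of_lt (by omega)
    refine ⟨_, _, .seq hr (.assign _ _ _), by simp only [Expr.cost]; omega, ?_⟩
    rw [hev]
    refine ⟨⟨?_, ?_⟩, ?_⟩
    · simpa [State.setReg] using hlt
    · simpa [State.setReg] using hQ
    · simp only [State.setReg, Function.update_self]; omega
  · simp only [State.setReg, Function.update_self, Expr.cost]
    have : N * (1 + 1 + 1 + (c + 4) + 1) = N * (c + 8) := by ring
    rw [Nat.sub_zero, this]

/-! ### Evaluation of expressions -/

theorem eval_const {w c : ℕ} (σ : State) (h : c < 2 ^ w) : (Expr.const c).eval w σ = c :=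
  Nat.mod_eq_of_lt h

theorem eval_lt {w : ℕ} (σ : State) (e f : Expr) (hw : 1 < 2 ^ w) :
    (Expr.op .lt e f).eval w σ = if e.eval w σ < f.eval w σ then 1 else 0 := by
  simp only [Expr.eval, BinOp.eval]; split_ifs <;> simp [Nat.mod_eq_of_lt hw]

theorem eval_eq {w : ℕ} (σ : State) (e f : Expr) (hw : 1 < 2 ^ w) :
    (Expr.op .eq e f).eval w σ = if e.eval w σ = f.eval w σ then 1 else 0 := by
  simp only [Expr.eval, BinOp.eval]; split_ifs <;> simp [Nat.mod_eq_of_lt hw]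

theorem eval_mul {w : ℕ} (σ : State) (e f : Expr) (h : e.eval w σ * f.eval w σ < 2 ^ w) :
    (Expr.op .mul e f).eval w σ = e.eval w σ * f.eval w σ := Nat.mod_eq_of_lt h

theorem eval_sub {w : ℕ} (σ : State) (e f : Expr) (h : f.eval w σ ≤ e.eval w σ)
    (h' : e.eval w σ < 2 ^ w) :
    (Expr.op .sub e f).eval w σ = e.eval w σ - f.eval w σ := by
  simp only [Expr.eval, BinOp.eval]
  rw [Nat.add_sub_assoc h, Nat.add_mod_left, Nat.mod_eq_of_lt (by omega)]

theorem eval_mod {w : ℕ} (σ : State) (e f : Expr) (h : e.eval w σ < 2 ^ w) :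
    (Expr.op .mod e f).eval w σ = e.eval w σ % f.eval w σ :=
  Nat.mod_eq_of_lt ((Nat.mod_le _ _).trans_lt h)

theorem eval_top {w : ℕ} (σ : State) (hw : 1 < 2 ^ w) :
    (Expr.op .sub (.const 0) (.const 1)).eval w σ = 2 ^ w - 1 := by
  simp only [Expr.eval, BinOp.eval, Nat.mod_eq_of_lt hw, Nat.zero_mod, Nat.add_zero]
  exact Nat.mod_eq_of_lt (by omega)

open SimpleGraph

/-! ### Weights of walks -/

section Weight

variable {V : Type*} {G : SimpleGraph V} {wt : Sym2 V → ℕ}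

@[simp] theorem walkWeight_nil (u : V) : walkWeight wt (Walk.nil : G.Walk u u) = 0 := rfl

@[simp] theorem walkWeight_cons {u v x : V} (h : G.Adj u v) (p : G.Walk v x) :
    walkWeight wt (.cons h p) = wt s(u, v) + walkWeight wt p := by simp [walkWeight]

@[simp] theorem walkWeight_append {u v x : V} (p : G.Walk u v) (q : G.Walk v x) :
    walkWeight wt (p.append q) = walkWeight wt p + walkWeight wt q := by simp [walkWeight]

@[simp] theorem walkWeight_reverse {u v : V} (p : G.Walk u v) :
    walkWeight wt p.reverse = walkWeight wt p := by simp [walkWeight]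

theorem walkWeight_le_mul_length {M : ℕ} (hM : ∀ e ∈ G.edgeSet, wt e ≤ M) {u v : V}
    (p : G.Walk u v) : walkWeight wt p ≤ M * p.length := by
  induction p with
  | nil => simp
  | cons h p ih =>
    have := hM _ (G.mem_edgeSet.2 h)
    simp only [walkWeight_cons, Walk.length_cons]
    nlinarith

/-- The edges of the bypass are distinct and occur in the walk, so they form a sub-multiset; weights
are natural numbers, and dropping terms cannot increase the sum. -/
theorem walkWeight_bypass_le [DecidableEq V] {u v : V} (p : G.Walk u v) :
    walkWeight wt p.bypass ≤ walkWeight wt p := by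
  have h : p.bypass.edges.Subperm p.edges :=
    p.bypass_isPath.isTrail.edges_nodup.subperm p.edges_bypass_subset_edges
  obtain ⟨l, h₁, h₂⟩ := h
  unfold walkWeight
  rw [← (h₁.map wt).sum_eq]
  exact (h₂.map wt).sum_le_sum (by simp)

theorem wdist_le {s t : V} (p : G.Walk s t) : wdist G wt s t ≤ walkWeight wt p := iInf_le _ p

theorem wdist_self (s : V) : wdist G wt s s = 0 := by
  have := wdist_le (wt := wt) (Walk.nil : G.Walk s s)
  simpa using this

/-- The least weight of a walk from `s` to `t` without edges in `S`. -/
noncomputable def replDist (G : SimpleGraph V) (wt : Sym2 V → ℕ) (s t : V) (S : Set (Sym2 V)) :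
    ℕ∞ :=
  ⨅ (p : G.Walk s t) (_ : ∀ e ∈ p.edges, e ∉ S), (walkWeight wt p : ℕ∞)

theorem replDist_le {s t : V} {S : Set (Sym2 V)} (p : G.Walk s t) (h : ∀ e ∈ p.edges, e ∉ S) :
    replDist G wt s t S ≤ walkWeight wt p := iInf₂_le p h

theorem wdist_le_replDist {s t : V} (S : Set (Sym2 V)) :
    wdist G wt s t ≤ replDist G wt s t S := le_iInf₂ fun p _ => wdist_le p

/-- The infimum of a nonempty family in `ℕ∞` is attained, and cutting out cycles adds no edges. -/
theorem exists_isPath_of_replDist_ne_top {s t : V} {S : Set (Sym2 V)}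
    (h : replDist G wt s t S ≠ ⊤) : ∃ p : G.Walk s t, p.IsPath ∧ (∀ e ∈ p.edges, e ∉ S) ∧
      (walkWeight wt p : ℕ∞) = replDist G wt s t S := by
  classical
  have hne : Nonempty {p : G.Walk s t // ∀ e ∈ p.edges, e ∉ S} := by
    by_contra hne
    refine h (iInf₂_eq_top.2 fun p hp => (hne ⟨⟨p, hp⟩⟩).elim)
  obtain ⟨⟨p, hp⟩, hmin⟩ := ciInf_mem
    (fun p : {p : G.Walk s t // ∀ e ∈ p.edges, e ∉ S} => (walkWeight wt p.1 : ℕ∞))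
  rw [iInf_subtype] at hmin
  have hS : ∀ e ∈ p.bypass.edges, e ∉ S := fun e he => hp e (p.edges_bypass_subset_edges he)
  refine ⟨p.bypass, p.bypass_isPath, hS, le_antisymm ?_ (replDist_le _ hS)⟩
  exact (Nat.cast_le.2 (walkWeight_bypass_le p)).trans hmin.le

theorem replDist_le_mul_card [Fintype V] {M : ℕ} (hM : ∀ e ∈ G.edgeSet, wt e ≤ M) {s t : V}
    {S : Set (Sym2 V)} (h : replDist G wt s t S ≠ ⊤) :
    replDist G wt s t S ≤ (M * Fintype.card V : ℕ) := by
  obtain ⟨p, hp, -, hw⟩ := exists_isPath_of_replDist_ne_top h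
  rw [← hw]
  exact_mod_cast (walkWeight_le_mul_length hM p).trans (Nat.mul_le_mul_left _ hp.length_lt.le)

theorem edgeReplDist_eq_replDist (s t : V) (e : Sym2 V) :
    edgeReplDist G wt s t e = replDist G wt s t {e} := by
  unfold edgeReplDist replDist
  refine iInf_congr fun p => iInf_congr_Prop ?_ fun _ => rfl
  constructor
  · rintro h f hf rfl; exact h hf
  · exact fun h he => h e he rfl

/-- Every visited vertex other than the start is entered by an edge. This turns avoiding a vertex
into avoiding a set of edges; `x ≠ s` excludes the empty walk at `x`. -/
theorem notMem_support_iff {s t x : V} (hx : x ≠ s) (p : G.Walk s t) :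
    x ∉ p.support ↔ ∀ e ∈ p.edges, x ∉ e := by
  induction p with
  | nil => simp [hx]
  | @cons u v _ h p ih =>
    by_cases hv : x = v
    · subst hv; simp
    · simp only [Walk.support_cons, List.mem_cons, not_or, hx, not_false_eq_true, true_and, ih hv,
        Walk.edges_cons, forall_eq_or_imp, Sym2.mem_iff, hv]

theorem vertexReplDist_eq_replDist {s x : V} (t : V) (hx : x ≠ s) :
    vertexReplDist G wt s t x = replDist G wt s t {e | x ∈ e} := by
  unfold vertexReplDist replDist
  exact iInf_congr fun p => iInf_congr_Prop (notMem_support_iff hx p) fun _ => rfl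

end Weight

/-! ### Shortest-path trees -/

/-- In the forest with parent map `par`, the vertex `a` is `b` or an ancestor of `b`. -/
def Anc {V : Type*} (par : V → Option V) (a b : V) : Prop :=
  Relation.ReflTransGen (fun x y => par x = some y) b a

theorem Anc.refl {V : Type*} {par : V → Option V} (a : V) : Anc par a a :=
  Relation.ReflTransGen.refl

theorem Anc.trans {V : Type*} {par : V → Option V} {a b c : V} (h : Anc par a b)
    (h' : Anc par b c) : Anc par a c := Relation.ReflTransGen.trans h' h

theorem Anc.total {V : Type*} {par : V → Option V} {a b c : V} (h : Anc par a c)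
    (h' : Anc par b c) : Anc par a b ∨ Anc par b a :=
  (Relation.ReflTransGen.total_of_right_unique (fun _ _ _ h₁ h₂ => by
    simpa using h₁.symm.trans h₂) h' h)

/-- The distance from `s` as a natural number, `0` for vertices that are not reachable. -/
noncomputable def dst {V : Type*} (G : SimpleGraph V) (wt : Sym2 V → ℕ) (s t : V) : ℕ :=
  (wdist G wt s t).toNat

section Tree

variable {V : Type*} {G : SimpleGraph V} {wt : Sym2 V → ℕ} {s : V} {par : V → Option V}

theorem coe_dst {t : V} (h : G.Reachable s t) : (dst G wt s t : ℕ∞) = wdist G wt s t := by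
  obtain ⟨p⟩ := h
  exact ENat.natCast_toNat fun h => by simpa [h] using wdist_le (wt := wt) p

theorem dst_le {t : V} (p : G.Walk s t) : dst G wt s t ≤ walkWeight wt p := by
  have := wdist_le (wt := wt) p
  rw [← coe_dst ⟨p⟩] at this
  exact_mod_cast this

theorem dst_self : dst G wt s s = 0 := by simp [dst, wdist_self]

theorem dst_le_add {a t : V} (ha : G.Reachable s a) (p : G.Walk a t) :
    dst G wt s t ≤ dst G wt s a + walkWeight wt p := by
  have hne : replDist G wt s a ∅ ≠ ⊤ := by
    obtain ⟨q⟩ := ha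
    exact fun h => by simpa [h] using replDist_le (wt := wt) (S := ∅) q (by simp)
  obtain ⟨q, -, -, hq⟩ := exists_isPath_of_replDist_ne_top hne
  have : replDist G wt s a ∅ = dst G wt s a := by
    rw [coe_dst ha]; simp [replDist, wdist]
  rw [this] at hq
  have h := dst_le (wt := wt) (q.append p)
  rw [walkWeight_append] at h
  have : walkWeight wt q = dst G wt s a := by exact_mod_cast hq
  omega

theorem wdist_ne_top_iff {t : V} : wdist G wt s t ≠ ⊤ ↔ G.Reachable s t := by
  constructor
  · intro h
    by_contra hr
    exact h (iInf_eq_top.2 fun p => (hr ⟨p⟩).elim)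
  · intro h
    rw [← coe_dst h]
    exact ENat.natCast_ne_top _

theorem anc_of_walk {a t : V} (p : G.Walk a t) (hp : ∀ d ∈ p.darts, par d.snd = some d.fst) :
    Anc par a t := by
  induction p with
  | nil => exact .refl _
  | cons h p ih =>
    simp only [Walk.darts_cons, List.mem_cons, forall_eq_or_imp] at hp
    exact Anc.trans (.single hp.1) (ih hp.2)

namespace IsShortestPathTree

variable (hT : IsShortestPathTree G wt s par)
include hT

theorem par_eq_none_iff {v : V} : par v = none ↔ v = s ∨ ¬ G.Reachable s v := by
  constructor
  · intro h
    by_contra hc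
    push Not at hc
    obtain ⟨p, hp, -⟩ := hT.path v hc.2
    have : ∀ d ∈ p.darts, d.snd ≠ v := fun d hd hv => by simpa [hv, h] using hp d hd
    obtain ⟨d, hd, hv⟩ : ∃ d ∈ p.darts, d.snd = v := by
      have hnil : ¬ p.Nil := fun h => hc.1 h.eq.symm
      exact ⟨p.lastDart hnil, p.lastDart_mem_darts hnil, rfl⟩
    exact this d hd hv
  · rintro (rfl | h)
    · exact hT.root
    · exact hT.unreachable v h

theorem reachable_of_par {u v : V} (h : par v = some u) : G.Reachable s v := by
  by_contra hr
  simp [hT.unreachable v hr] at h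

/-- The last dart of the tree path to `v` is `(u, v)`. The rest of the path is shortest to `u`, as
otherwise a shorter walk to `u` extended by this edge would beat `d(s,v)`. -/
theorem adj_and_dst {u v : V} (h : par v = some u) :
    G.Adj u v ∧ G.Reachable s u ∧ dst G wt s v = dst G wt s u + wt s(u, v) := by
  have hr := hT.reachable_of_par h
  obtain ⟨p, hp, hw⟩ := hT.path v hr
  have hnil : ¬ p.Nil := by
    intro hn
    have := hn.eq
    subst this
    simp [hT.root] at h
  have hpen := hp _ (p.lastDart_mem_darts hnil)
  have hsnd : (p.lastDart hnil).snd = v := rfl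
  have hfst : (p.lastDart hnil).fst = p.penultimate := rfl
  rw [hsnd, h, hfst, Option.some_inj] at hpen
  subst hpen
  have hadj := p.adj_penultimate hnil
  have hru : G.Reachable s p.penultimate := ⟨p.dropLast⟩
  refine ⟨hadj, hru, le_antisymm ?_ ?_⟩
  · simpa using dst_le_add (wt := wt) hru (Walk.cons hadj .nil)
  · rw [← coe_dst hr] at hw
    have hw : walkWeight wt p = dst G wt s v := by exact_mod_cast hw
    have := dst_le (wt := wt) p.dropLast
    have hp' := congrArg (walkWeight wt) (p.concat_dropLast hadj)
    rw [Walk.concat_eq_append, walkWeight_append, walkWeight_cons, walkWeight_nil] at hp'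
    omega

/-- The location of the vertices and edges is recorded with the weight because it decides which
failures the tree path avoids. -/
theorem exists_walk {a b : V} (h : Anc par a b) :
    ∃ p : G.Walk a b, walkWeight wt p + dst G wt s a = dst G wt s b ∧
      (∀ y ∈ p.support, Anc par a y ∧ Anc par y b) ∧
      ∀ e ∈ p.edges, ∃ y u, par y = some u ∧ e = s(u, y) ∧ Anc par a u ∧ Anc par y b := by
  induction h using Relation.ReflTransGen.head_induction_on with
  | refl => exact ⟨.nil, by simp, by simp [Anc.refl], by simp⟩
  | @head b c hbc hca ih =>
    obtain ⟨p, h₁, h₂, h₃⟩ := ih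
    obtain ⟨hadj, -, hd⟩ := hT.adj_and_dst hbc
    have hcb : Anc par c b := .single hbc
    refine ⟨p.concat hadj, ?_, ?_, ?_⟩
    · rw [Walk.concat_eq_append, walkWeight_append]; simp only [walkWeight_cons, walkWeight_nil]
      omega
    · intro y hy
      rw [Walk.support_concat, List.mem_append, List.mem_singleton] at hy
      rcases hy with hy | rfl
      · exact ⟨(h₂ y hy).1, (h₂ y hy).2.trans hcb⟩
      · exact ⟨Anc.trans hca hcb, .refl _⟩
    · intro e he
      rw [Walk.edges_concat, List.concat_eq_append, List.mem_append, List.mem_singleton] at he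
      rcases he with he | rfl
      · obtain ⟨y, u, k₁, k₂, k₃, k₄⟩ := h₃ e he
        exact ⟨y, u, k₁, k₂, k₃, k₄.trans hcb⟩
      · exact ⟨b, c, hbc, rfl, hca, .refl _⟩

theorem anc_of_reachable {t : V} (h : G.Reachable s t) : Anc par s t := by
  obtain ⟨p, hp, -⟩ := hT.path t h
  exact anc_of_walk p hp

theorem reachable_of_anc {a t : V} (h : Anc par a t) (ht : G.Reachable s t) :
    G.Reachable s a := by
  obtain ⟨p, -⟩ := hT.exists_walk h
  exact ht.trans ⟨p.reverse⟩

theorem reachable_of_anc' {a t : V} (h : Anc par a t) (ha : G.Reachable s a) :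
    G.Reachable s t := by
  obtain ⟨p, -⟩ := hT.exists_walk h
  exact ha.trans ⟨p⟩

theorem dst_mono {a b : V} (h : Anc par a b) : dst G wt s a ≤ dst G wt s b := by
  obtain ⟨p, hp, -⟩ := hT.exists_walk h
  omega

theorem dst_lt (hpos : ∀ e ∈ G.edgeSet, 1 ≤ wt e) {a b : V} (h : Anc par a b) (hne : a ≠ b) :
    dst G wt s a < dst G wt s b := by
  rcases Relation.ReflTransGen.cases_head h with rfl | ⟨c, hc, hca⟩
  · exact absurd rfl hne
  · obtain ⟨hadj, -, hd⟩ := hT.adj_and_dst hc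
    have := hpos _ (G.mem_edgeSet.2 hadj)
    have := hT.dst_mono hca
    omega

/-- Distances strictly increase down the tree when weights are positive, which excludes cycles of
parent pointers. -/
theorem anc_antisymm (hpos : ∀ e ∈ G.edgeSet, 1 ≤ wt e) {a b : V} (h : Anc par a b)
    (h' : Anc par b a) : a = b := by
  by_contra hne
  have := hT.dst_lt hpos h hne
  have := hT.dst_mono h'
  omega

end IsShortestPathTree
end Tree
/-! ### Failures of edges and vertices -/

section Failure

variable {V : Type*} {G : SimpleGraph V} {wt : Sym2 V → ℕ} {s : V} {par : V → Option V}
  {S : V → Set (Sym2 V)}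

/-- The common properties of edge and vertex failures: the failure `v` removes either all edges
at `v`, or edges at `v` of which none leads to a child. -/
structure IsFailure (par : V → Option V) (S : V → Set (Sym2 V)) : Prop where
  incident : ∀ v, ∀ e ∈ S v, v ∈ e
  all_or_up : ∀ v, (∀ e, v ∈ e → e ∈ S v) ∨ ∀ y, par y = some v → s(v, y) ∉ S v

/-- The failure of the ancestor `v` of `x` is not handled by `x`: some replacement path to the
descendant `t` of `x` is shorter than every one through `x`. -/
def Bad (G : SimpleGraph V) (wt : Sym2 V → ℕ) (s : V) (par : V → Option V)
    (S : V → Set (Sym2 V)) (t x v : V) : Prop :=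
  Anc par v x ∧ Anc par x t ∧
    replDist G wt s t (S v) < replDist G wt s x (S v) + (dst G wt s t - dst G wt s x : ℕ)

theorem IsFailure.avoids (hS : IsFailure par S) {a b v : V} {p : G.Walk a b}
    (h : v ∉ p.support) : ∀ e ∈ p.edges, e ∉ S v := fun e he hv =>
  h (p.mem_support_of_mem_edges he (hS.incident v e hv))

/-- A surviving walk that reaches `v ≠ s` uses an edge at `v`, so `v` cannot remove all its edges.
-/
theorem IsFailure.up_of_mem_support (hS : IsFailure par S) {y v : V} {p : G.Walk s y} (hv : v ≠ s)
    (hp : ∀ e ∈ p.edges, e ∉ S v) (h : v ∈ p.support) : ∀ z, par z = some v → s(v, z) ∉ S v := by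
  refine (hS.all_or_up v).resolve_left fun hall => ?_
  exact (notMem_support_iff hv p).2 (fun e he hve => hp e he (hall e hve)) h

namespace IsShortestPathTree

variable (hT : IsShortestPathTree G wt s par) (hS : IsFailure par S)
include hT hS

/-- A removed edge contains `v`. An edge of the tree path below `y` has its lower end strictly
farther from `s` than `v`, so `v` would be its upper end; this forces `y = v`, and then the edge
leads to a child. -/
theorem exists_walk_avoiding (hpos : ∀ e ∈ G.edgeSet, 1 ≤ wt e) {v y x : V} (hv : Anc par v y)
    (hy : Anc par y x) (h : y = v → ∀ z, par z = some v → s(v, z) ∉ S v) :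
    ∃ p : G.Walk y x, walkWeight wt p + dst G wt s y = dst G wt s x ∧ ∀ e ∈ p.edges, e ∉ S v := by
  obtain ⟨p, h₁, -, h₃⟩ := hT.exists_walk hy
  refine ⟨p, h₁, fun e he hev => ?_⟩
  obtain ⟨z, u, hz, rfl, hu, hzx⟩ := h₃ e he
  have hlt : dst G wt s u < dst G wt s z := hT.dst_lt hpos (.single hz) (by
    rintro rfl; exact (hT.adj_and_dst hz).1.ne rfl)
  have h₄ := hT.dst_mono hv
  have h₅ := hT.dst_mono hu
  rcases Sym2.mem_iff.1 (hS.incident v _ hev) with rfl | rfl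
  · exact h (hT.anc_antisymm hpos hu hv) z hz hev
  · omega

theorem replDist_eq_of_not_anc {t v : V} (ht : G.Reachable s t) (h : ¬ Anc par v t) :
    replDist G wt s t (S v) = dst G wt s t := by
  refine le_antisymm ?_ ((coe_dst ht).trans_le (wdist_le_replDist _))
  obtain ⟨p, h₁, h₂, -⟩ := hT.exists_walk (hT.anc_of_reachable ht)
  refine (replDist_le p (hS.avoids fun hv => h (h₂ v hv).2)).trans ?_
  rw [dst_self] at h₁
  exact_mod_cast h₁.le

theorem replDist_le_add (hpos : ∀ e ∈ G.edgeSet, 1 ≤ wt e) {t x v : V} (hv : v ≠ s)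
    (hvx : Anc par v x) (hxt : Anc par x t) :
    replDist G wt s t (S v) ≤
      replDist G wt s x (S v) + (dst G wt s t - dst G wt s x : ℕ) := by
  by_cases htop : replDist G wt s x (S v) = ⊤
  · simp [htop]
  obtain ⟨p, -, hp, hw⟩ := exists_isPath_of_replDist_ne_top htop
  obtain ⟨q, h₁, h₂⟩ := hT.exists_walk_avoiding hS hpos hvx hxt fun hxv =>
    hS.up_of_mem_support hv hp (hxv ▸ p.end_mem_support)
  rw [← hw]
  refine (replDist_le (p.append q) fun e he => ?_).trans ?_
  · rw [Walk.edges_append, List.mem_append] at he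
    exact he.elim (hp e) (h₂ e)
  · rw [walkWeight_append, show dst G wt s t - dst G wt s x = walkWeight wt q by omega]
    push_cast; rfl

/-- A replacement path that witnesses `Bad` does not meet the tree path from `v` to `x`. -/
theorem exists_path_of_bad (hpos : ∀ e ∈ G.edgeSet, 1 ≤ wt e) {t x v : V} (hv : v ≠ s)
    (hb : Bad G wt s par S t x v) : ∃ p : G.Walk s t, p.IsPath ∧
      (walkWeight wt p : ℕ∞) = replDist G wt s t (S v) ∧
      ∀ y ∈ p.support, Anc par y x → ¬ Anc par v y := by
  classical
  obtain ⟨hvx, hxt, hlt⟩ := hb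
  obtain ⟨p, hpath, hp, hw⟩ := exists_isPath_of_replDist_ne_top (ne_top_of_lt hlt)
  refine ⟨p, hpath, hw, fun y hy hyx hvy => ?_⟩
  obtain ⟨p₁, p₂, rfl⟩ := Walk.mem_support_iff_exists_append.1 hy
  simp only [Walk.edges_append, List.mem_append] at hp
  obtain ⟨q, h₁, h₂⟩ := hT.exists_walk_avoiding hS hpos hvy hyx fun hyv => by
    subst hyv
    exact hS.up_of_mem_support hv (fun e he => hp e (.inl he)) p₁.end_mem_support
  -- Redirected at `y` to the tree path, `p` becomes a replacement walk to `x`. Since `d(s,t) -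
  -- d(s,y)` is at most the weight of `p₂`, going via `x` is no longer than `p`, against `Bad`.
  have h₃ : replDist G wt s x (S v) ≤ walkWeight wt (p₁.append q) := by
    refine replDist_le _ fun e he => ?_
    rw [Walk.edges_append, List.mem_append] at he
    exact he.elim (fun h => hp e (.inl h)) (h₂ e)
  have h₄ := dst_le_add (wt := wt) ⟨p₁⟩ p₂
  have h₅ := hT.dst_mono hxt
  have h₆ := hT.dst_mono hyx
  have := hlt.trans_le (add_le_add_left h₃ _)
  rw [← hw] at this
  simp only [walkWeight_append] at this
  norm_cast at this
  omega

/-- The replacement path for the bad `v` misses the tree path from `v` to `x`, in particular `v'`,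
so it also survives the failure `v'`. -/
theorem replDist_le_of_bad (hpos : ∀ e ∈ G.edgeSet, 1 ≤ wt e) {t x v v' : V} (hv : v ≠ s)
    (hb : Bad G wt s par S t x v) (h : Anc par v v') (h' : Anc par v' x) :
    replDist G wt s t (S v') ≤ replDist G wt s t (S v) := by
  obtain ⟨p, -, hw, hp⟩ := hT.exists_path_of_bad hS hpos hv hb
  rw [← hw]
  exact replDist_le p (hS.avoids fun hv' => hp v' hv' h' h)

end IsShortestPathTree

end Failure

/-! ### Detours and the number of distinct bad values. -/

section Detour

variable {V : Type*} {G : SimpleGraph V} {wt : Sym2 V → ℕ} {s : V} {par : V → Option V}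
  {S : V → Set (Sym2 V)}

theorem exists_last_append (P : V → Prop) {u t : V} (p : G.Walk u t)
    (h : ∃ z ∈ p.support, P z) : ∃ (a : V) (p₁ : G.Walk u a) (q : G.Walk a t),
      p = p₁.append q ∧ P a ∧ ∀ y ∈ q.support, y = a ∨ ¬ P y := by
  induction p with
  | nil =>
    obtain ⟨z, hz, hP⟩ := h
    simp only [Walk.support_nil, List.mem_singleton] at hz
    subst hz
    exact ⟨z, .nil, .nil, rfl, hP, by simp⟩
  | @cons u v t hadj p ih =>
    by_cases hp : ∃ z ∈ p.support, P z
    · obtain ⟨a, p₁, q, rfl, h₁, h₂⟩ := ih hp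
      exact ⟨a, .cons hadj p₁, q, rfl, h₁, h₂⟩
    · push Not at hp
      obtain ⟨z, hz, hP⟩ := h
      rw [Walk.support_cons, List.mem_cons] at hz
      rcases hz with rfl | hz
      · refine ⟨z, .nil, .cons hadj p, rfl, hP, fun y hy => ?_⟩
        rw [Walk.support_cons, List.mem_cons] at hy
        exact hy.imp_right (hp y)
      · exact absurd hP (hp z hz)

/-- The walk `q` from `a` to `t` leaves the tree path from `s` to `x` in `a` and never comes back;
together with the tree path from `s` to `a` it is a replacement path for the failure `v`. -/
structure IsDetour (G : SimpleGraph V) (wt : Sym2 V → ℕ) (s : V) (par : V → Option V)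
    (S : V → Set (Sym2 V)) (x v : V) {a t : V} (q : G.Walk a t) : Prop where
  isPath : q.IsPath
  anc : Anc par a x
  not_anc : ¬ Anc par v a
  last : ∀ y ∈ q.support, y = a ∨ ¬ Anc par y x
  weight : replDist G wt s t (S v) = (dst G wt s a + walkWeight wt q : ℕ)

namespace IsShortestPathTree

variable (hT : IsShortestPathTree G wt s par) (hS : IsFailure par S)
include hT hS

/-- All vertices of the tree path to `a` are ancestors of `a`, so that path misses `v` and may be
put in front of `q`. -/
theorem replDist_le_of_walk {v a y : V} (ha : G.Reachable s a) (hva : ¬ Anc par v a)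
    (q : G.Walk a y) (hq : v ∉ q.support) :
    replDist G wt s y (S v) ≤ (dst G wt s a + walkWeight wt q : ℕ) := by
  obtain ⟨p, h₁, h₂, -⟩ := hT.exists_walk (hT.anc_of_reachable ha)
  refine (replDist_le (p.append q) (hS.avoids ?_)).trans ?_
  · rw [Walk.mem_support_append_iff, not_or]
    exact ⟨fun h => hva (h₂ v h).2, hq⟩
  · rw [walkWeight_append, ← h₁, dst_self, Nat.add_zero]

/-- Cut the replacement path at its last vertex `a` on the tree path from `s` to `x`. As the
replacement path misses the tree path from `v` to `x`, the vertex `a` is strictly above `v`;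
exchanging the part before `a` for the tree path keeps the weight optimal. -/
theorem exists_detour (hpos : ∀ e ∈ G.edgeSet, 1 ≤ wt e) {t x v : V} (hv : v ≠ s)
    (ht : G.Reachable s t) (hb : Bad G wt s par S t x v) :
    ∃ (a : V) (q : G.Walk a t), IsDetour G wt s par S x v q := by
  obtain ⟨p, hpath, hw, hp⟩ := hT.exists_path_of_bad hS hpos hv hb
  have hx : G.Reachable s x := hT.reachable_of_anc hb.2.1 ht
  obtain ⟨a, p₁, q, rfl, ha, hq⟩ := exists_last_append (fun y => Anc par y x) p
    ⟨s, p.start_mem_support, hT.anc_of_reachable hx⟩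
  have hva : ¬ Anc par v a := hp a (by simp) ha
  refine ⟨a, q, hpath.of_append_right, ha, hva, hq, le_antisymm ?_ ?_⟩
  · refine hT.replDist_le_of_walk hS ⟨p₁⟩ hva q fun h => ?_
    rcases hq v h with rfl | h'
    · exact hva (.refl _)
    · exact h' hb.1
  · rw [← hw, walkWeight_append]
    have := dst_le (wt := wt) p₁
    exact_mod_cast Nat.add_le_add_right this _

/-- Otherwise the tree path to `a'` followed by `q'` would miss `v` as well, giving the failure `v`
a distance no larger than that of `v'`. -/
theorem anc_detour_start {t x v v' a' : V} (ht : G.Reachable s t) (hxt : Anc par x t)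
    (hvx : Anc par v x)
    {q' : G.Walk a' t} (hq' : IsDetour G wt s par S x v' q')
    (hlt : replDist G wt s t (S v') < replDist G wt s t (S v)) : Anc par v a' := by
  by_contra hva
  refine hlt.not_ge ?_
  rw [hq'.weight]
  refine hT.replDist_le_of_walk hS (hT.reachable_of_anc (hq'.anc.trans hxt) ht) hva q' fun h => ?_
  rcases hq'.last v h with rfl | h'
  · exact hva (.refl _)
  · exact h' hvx

/-- A vertex shared by two detours is far from the start of the lower one. -/
theorem lt_of_mem_detours {t x v v' a a' z : V} (hpos : ∀ e ∈ G.edgeSet, 1 ≤ wt e)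
    (ht : G.Reachable s t) (hb : Bad G wt s par S t x v) (hvv' : Anc par v v')
    (hv'x : Anc par v' x)
    {q : G.Walk a t} (hq : IsDetour G wt s par S x v q)
    {q₁' : G.Walk a' z} {q₂' : G.Walk z t} (hq' : IsDetour G wt s par S x v' (q₁'.append q₂'))
    (hva' : Anc par v a') (hne : v ≠ a') (hz : z ∈ q.support) :
    replDist G wt s t (S v') < (dst G wt s t + 2 * walkWeight wt q₁' : ℕ) := by
  obtain ⟨hvx, hxt, hlt⟩ := hb
  obtain ⟨q₁, q₂, rfl⟩ := Walk.mem_support_iff_exists_append.1 hz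
  have hra := hT.reachable_of_anc (hq.anc.trans hxt) ht
  have hra' := hT.reachable_of_anc (hq'.anc.trans hxt) ht
  obtain ⟨p, hp₁, hp₂, -⟩ := hT.exists_walk hq'.anc
  -- A route to `x` around `v`: along `q` to `z`, back along the lower detour to `a'`, then down the
  -- tree.
  have h₁ : replDist G wt s x (S v) ≤
      (dst G wt s a + walkWeight wt ((q₁.append q₁'.reverse).append p) : ℕ) := by
    refine hT.replDist_le_of_walk hS hra hq.not_anc _ ?_
    simp only [Walk.mem_support_append_iff, Walk.support_reverse, List.mem_reverse, not_or]
    refine ⟨⟨fun h => ?_, fun h => ?_⟩, fun h => ?_⟩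
    · rcases hq.last v (by simp [h]) with rfl | h'
      · exact hq.not_anc (.refl _)
      · exact h' hvx
    · rcases hq'.last v (by simp [h]) with h' | h'
      · exact hne h'
      · exact h' hvx
    · exact hne (hT.anc_antisymm hpos hva' (hp₂ v h).1)
  -- The opposite exchange at `z`: start on the lower detour and finish on the upper one. Badness of
  -- `v` and `h₁` bound `q₂` by `q₁'` plus `d(s,t) - d(s,a')`; inserting this here gives the claim.
  have h₂ : replDist G wt s t (S v') ≤
      (dst G wt s a' + walkWeight wt (q₁'.append q₂) : ℕ) := by
    refine hT.replDist_le_of_walk hS hra' hq'.not_anc _ ?_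
    simp only [Walk.mem_support_append_iff, not_or]
    refine ⟨fun h => ?_, fun h => ?_⟩
    · rcases hq'.last v' (by simp [h]) with rfl | h'
      · exact hq'.not_anc (.refl _)
      · exact h' hv'x
    · rcases hq.last v' (by simp [h]) with rfl | h'
      · exact hq.not_anc hvv'
      · exact h' hv'x
  have h₃ := hlt.trans_le (add_le_add_left h₁ _)
  have h₄ := hT.dst_mono hxt
  have h₅ := hT.dst_mono (hq'.anc.trans hxt)
  rw [hq.weight] at h₃
  rw [hq'.weight] at h₂ ⊢
  simp only [walkWeight_append, walkWeight_reverse] at h₂ h₃ ⊢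
  norm_cast at h₂ h₃ ⊢
  omega

end IsShortestPathTree

theorem sum_range_sub_mul_two (k : ℕ) : (∑ i ∈ Finset.range k, (k - i)) * 2 = k * (k + 1) := by
  induction k with
  | zero => simp
  | succ k ih =>
    rw [Finset.sum_range_succ']
    simp only [Nat.add_sub_add_right, Nat.sub_zero, add_mul, ih]
    ring

/-- A packing argument: initial pieces of the detours, longer the larger `D i` is, are disjoint, and
the strictly decreasing values `D i` force the pieces to be long in total. -/
theorem sq_le_of_detours [Fintype V] {M : ℕ} (hM1 : 1 ≤ M) (hM : ∀ e ∈ G.edgeSet, wt e ≤ M)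
    {t : V} {d k : ℕ} (D : Fin k → ℕ) (a : Fin k → V) (q : ∀ i, G.Walk (a i) t)
    (hpath : ∀ i, (q i).IsPath) (hd : ∀ i, d ≤ D i) (hDq : ∀ i, D i ≤ d + walkWeight wt (q i))
    (hD : ∀ i j, i < j → D j < D i)
    (hdis : ∀ i j, i < j → ∀ z ∈ (q i).support, ∀ (q₁ : G.Walk (a j) z) (q₂ : G.Walk z t),
      q j = q₁.append q₂ → D j < d + 2 * walkWeight wt q₁) :
    k ^ 2 ≤ 4 * M * Fintype.card V := by
  classical
  -- Counted from the last index, the values are distinct integers at least `d`, so they grow by at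
  -- least one each time.
  have hlow : ∀ j, ∀ i : Fin k, i.val + j + 1 = k → d + j ≤ D i := by
    intro j
    induction j with
    | zero => intro i _; exact hd i
    | succ j ih =>
      intro i hi
      have h₁ := ih ⟨i + 1, by omega⟩ (by simp only; omega)
      have h₂ := hD i ⟨i + 1, by omega⟩ (by simp [Fin.lt_def])
      omega
  -- With at most `m i` edges of weight at most `M`, twice the weight of an initial piece is at most
  -- `D i - d`; this is exactly what `hdis` forbids at a shared vertex.
  let m : Fin k → ℕ := fun i => (D i - d) / (2 * M)
  have hmul : ∀ i, 2 * M * m i ≤ D i - d := fun i => Nat.mul_div_le _ _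
  have hlt : ∀ i, D i - d < 2 * M * (m i + 1) := fun i => Nat.lt_mul_div_succ _ (by omega)
  have hlen : ∀ i, m i ≤ (q i).length := fun i => by
    refine Nat.div_le_of_le_mul ?_
    have h₁ := hDq i
    have h₂ := walkWeight_le_mul_length hM (q i)
    have h₃ : 2 * M * (q i).length = 2 * (M * (q i).length) := by ring
    omega
  clear_value m
  let A : Fin k → Finset V := fun i => (Finset.range (m i + 1)).image (q i).getVert
  have hcard : ∀ i, (A i).card = m i + 1 := fun i => by
    rw [Finset.card_image_of_injOn, Finset.card_range]
    refine (hpath i).getVert_injOn.mono fun j hj => ?_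
    have := hlen i
    simp only [Finset.coe_range, Set.mem_Iio] at hj
    simp only [Set.mem_ofPred_eq]
    omega
  have hdisj : ∀ i j, i < j → Disjoint (A i) (A j) := fun i j hij => by
    rw [Finset.disjoint_left]
    intro z hzi hzj
    obtain ⟨b, -, hb⟩ := Finset.mem_image.1 hzi
    obtain ⟨c, hc, rfl⟩ := Finset.mem_image.1 hzj
    have h₁ := hdis i j hij _ (hb ▸ (q i).getVert_mem_support b) ((q j).take c) ((q j).drop c)
      (by simp)
    have h₂ := walkWeight_le_mul_length hM ((q j).take c)
    have h₃ : ((q j).take c).length ≤ m j := by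
      rw [Finset.mem_range] at hc
      simp only [Walk.take_length]
      omega
    have h₄ := Nat.mul_le_mul_left M h₃
    have h₅ := hmul j
    have h₇ := hd j
    have h₆ : 2 * M * m j = 2 * (M * m j) := by ring
    omega
  have hsum : ∑ i, (m i + 1) ≤ Fintype.card V := by
    rw [← Finset.sum_congr rfl fun i _ => hcard i, ← Finset.card_biUnion]
    · exact Finset.card_le_univ _
    · intro i _ j _ hne
      rcases lt_or_gt_of_ne hne with h | h
      · exact hdisj i j h
      · exact (hdisj j i h).symm
  -- The extra one in `m i + 1` absorbs both the rounding in the division and the difference between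
  -- `k - i` and `k - 1 - i`.
  have h₁ : ∑ i : Fin k, (k - i.val) ≤ 2 * M * ∑ i, (m i + 1) := by
    rw [Finset.mul_sum]
    refine Finset.sum_le_sum fun i _ => ?_
    have h₁ := hlow (k - 1 - i) i (by omega)
    have h₂ := hlt i
    omega
  rw [Fin.sum_univ_eq_sum_range (fun i => k - i) k] at h₁
  have h₂ := sum_range_sub_mul_two k
  have h₃ := Nat.mul_le_mul_left (2 * M) hsum
  nlinarith

/-- Few different replacement distances to `t` are smaller than via `x`. -/
theorem IsShortestPathTree.sq_le_of_bad_chain [Fintype V] (hT : IsShortestPathTree G wt s par)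
    (hS : IsFailure par S) {M : ℕ} (hM1 : 1 ≤ M)
    (hM : ∀ e ∈ G.edgeSet, 1 ≤ wt e ∧ wt e ≤ M) {t x : V} (ht : G.Reachable s t) {m : ℕ}
    (v : ℕ → V) (hbad : ∀ i < m, v i ≠ s ∧ Bad G wt s par S t x (v i))
    (hanc : ∀ i j, i < j → j < m → Anc par (v i) (v j) ∧ v i ≠ v j)
    (hD : ∀ i j, i < j → j < m → replDist G wt s t (S (v j)) < replDist G wt s t (S (v i))) :
    m ^ 2 ≤ 16 * M * Fintype.card V := by
  have hpos : ∀ e ∈ G.edgeSet, 1 ≤ wt e := fun e he => (hM e he).1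
  -- Only failures of even index are used: the odd ones between them turn `anc_detour_start` into a
  -- strict separation, needed because a detour may start at the preceding failure itself.
  let k := (m + 1) / 2
  have hk : ∀ i : Fin k, 2 * i.val < m := fun i => by have := i.2; omega
  choose a q hq using fun i : Fin k =>
    hT.exists_detour hS hpos (hbad _ (hk i)).1 ht (hbad _ (hk i)).2
  have hup : ∀ i j : Fin k, i < j → Anc par (v (2 * i)) (a j) ∧ v (2 * i) ≠ a j := by
    intro i j hij
    have hij' : i.val < j.val := hij
    have hj := hk j
    have h₁ : Anc par (v (2 * j - 1)) (a j) :=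
      hT.anc_detour_start hS ht (hbad _ hj).2.2.1
        ((hanc _ _ (by omega) hj).1.trans (hbad _ hj).2.1) (hq j) (hD _ _ (by omega) hj)
    have h₂ := hanc (2 * i) (2 * j - 1) (by omega) (by omega)
    refine ⟨h₂.1.trans h₁, fun h => h₂.2 (hT.anc_antisymm hpos h₂.1 (h ▸ h₁))⟩
  have hDi : ∀ i, dst G wt s t ≤ dst G wt s (a i) + walkWeight wt (q i) := fun i => by
    have h₁ := wdist_le_replDist (G := G) (wt := wt) (s := s) (t := t) (S (v (2 * i)))
    rw [(hq i).weight, ← coe_dst ht] at h₁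
    exact_mod_cast h₁
  have key := sq_le_of_detours (wt := wt) (d := dst G wt s t) (k := k) hM1 (fun e he => (hM e he).2)
    (fun i => dst G wt s (a i) + walkWeight wt (q i)) a q (fun i => (hq i).isPath) hDi
    (fun i => Nat.add_le_add_right (hT.dst_mono ((hq i).anc.trans (hbad _ (hk i)).2.2.1)) _)
    (fun i j hij => ?_) (fun i j hij z hz q₁ q₂ hqj => ?_)
  · have : m ≤ 2 * k := by omega
    nlinarith [Nat.pow_le_pow_left this 2]
  · have h := hD (2 * i) (2 * j) (by have : i.val < j.val := hij; omega) (hk j)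
    rw [(hq i).weight, (hq j).weight] at h
    exact_mod_cast h
  · have h := hanc (2 * i) (2 * j) (by have : i.val < j.val := hij; omega) (hk j)
    have hqj' := hq j
    rw [hqj] at hqj'
    have := hT.lt_of_mem_detours hS hpos ht (hbad _ (hk i)).2 h.1 (hbad _ (hk j)).2.1 (hq i) hqj'
      (hup i j hij).1 (hup i j hij).2 hz
    rw [(hq j).weight] at this
    exact_mod_cast this

end Detour

/-! ### The preprocessing program -/

section Model

/-- The vertex `v` is an iterated parent of `t`. -/
def AncN (pr : ℕ → ℕ) (v t : ℕ) : Prop := ∃ k, pr^[k] t = v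

/-- The length of the replacement path for the failure `v` that is composed of a replacement path
to the ancestor `x` of `t` and the tree path from `x` to `t`, as a word. -/
def via (w : ℕ) (dist : ℕ → ℕ) (tab : ℕ → ℕ → ℕ) (t x v : ℕ) : ℕ :=
  if tab x v = 2 ^ w - 1 then 2 ^ w - 1 else tab x v + (dist t - dist x)

/-- `Bad` in terms of words. -/
structure BadN (w n : ℕ) (pr dist : ℕ → ℕ) (tab : ℕ → ℕ → ℕ) (t x v : ℕ) : Prop where
  lt : v < n
  pr_lt : pr v < n
  anc : AncN pr v x
  lt_via : tab t v < via w dist tab t x v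

/-- What the programs need to know about the tree and the table. The parent of a root is `n`. -/
structure Model (w n s K Dm : ℕ) (pr wts dep dist : ℕ → ℕ) (tab : ℕ → ℕ → ℕ) : Prop where
  s_lt : s < n
  K_le : K ≤ n
  -- Leaves room for all addresses and for sums of two finite distances, and keeps finite distances
  -- apart from the all-ones word.
  big : 100 * n ^ 2 + 4 * Dm + 1000 < 2 ^ w
  pr_n : pr n = n
  pr_le : ∀ v < n, pr v ≤ n
  dep_root : ∀ v < n, pr v = n → dep v = 0
  dep_succ : ∀ v < n, pr v < n → dep v = dep (pr v) + 1
  dep_lt : ∀ v < n, dep v < n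
  dist_s : dist s = 0
  dist_root : ∀ v < n, pr v = n → v ≠ s → dist v = 2 ^ w - 1
  dist_succ : ∀ v < n, pr v < n → dist v = dist (pr v) + wts v
  dist_le : ∀ v < n, pr v < n → dist v ≤ Dm
  tab_le : ∀ t < n, ∀ v < n, pr v < n → tab t v = 2 ^ w - 1 ∨ tab t v ≤ Dm
  tab_of_not_anc : ∀ t < n, ∀ v < n, pr v < n → ¬ AncN pr v t → tab t v = dist t
  dist_le_tab : ∀ t < n, ∀ v < n, pr v < n → dist t ≤ tab t v
  tab_le_via : ∀ t < n, ∀ x, ∀ v < n, pr v < n → AncN pr v x → AncN pr x t →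
    tab t v ≤ via w dist tab t x v
  tab_le_of_bad : ∀ t < n, ∀ x, AncN pr x t → ∀ v, BadN w n pr dist tab t x v →
    ∀ v' < n, pr v' < n → AncN pr v' x → dep v ≤ dep v' → tab t v' ≤ tab t v
  chain : ∀ t < n, ∀ x, AncN pr x t → ∀ (m : ℕ) (v : ℕ → ℕ),
    (∀ i < m, BadN w n pr dist tab t x (v i)) → (∀ i j, i < j → j < m → dep (v j) < dep (v i)) →
    (∀ i j, i < j → j < m → tab t (v i) < tab t (v j)) → m ≤ K

variable {w n s K Dm : ℕ} {pr wts dep dist : ℕ → ℕ} {tab : ℕ → ℕ → ℕ}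

theorem AncN.refl (v : ℕ) : AncN pr v v := ⟨0, rfl⟩

theorem AncN.step {v t : ℕ} (h : AncN pr v t) : AncN pr (pr v) t := by
  obtain ⟨k, rfl⟩ := h
  exact ⟨k + 1, Function.iterate_succ_apply' _ _ _⟩

namespace Model

variable (hm : Model w n s K Dm pr wts dep dist tab)
include hm

theorem one_lt : 1 < 2 ^ w := by have := hm.big; omega

theorem iterate_n (k : ℕ) : pr^[k] n = n := Function.iterate_fixed hm.pr_n k

theorem iterate_le {t : ℕ} (ht : t < n) (k : ℕ) : pr^[k] t ≤ n := by
  induction k with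
  | zero => exact ht.le
  | succ k ih =>
    rw [Function.iterate_succ_apply']
    rcases ih.lt_or_eq with h | h
    · exact hm.pr_le _ h
    · rw [h, hm.pr_n]

theorem dep_iterate {t k : ℕ} (ht : t < n) (h : pr^[k] t < n) : dep t = dep (pr^[k] t) + k := by
  induction k with
  | zero => rfl
  | succ k ih =>
    rw [Function.iterate_succ_apply'] at h ⊢
    have h' : pr^[k] t < n := by
      refine (hm.iterate_le ht k).lt_of_ne fun h' => ?_
      rw [h', hm.pr_n] at h
      exact h.false
    rw [ih h', hm.dep_succ _ h' h]
    ring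

theorem dist_lt {v : ℕ} (hv : v < n) : dist v < 2 ^ w := by
  have hb := hm.big
  rcases (hm.pr_le v hv).lt_or_eq with h | h
  · have := hm.dist_le v hv h
    omega
  · by_cases hs : v = s
    · rw [hs, hm.dist_s]
      omega
    · rw [hm.dist_root v hv h hs]
      omega

theorem dist_mono {x t : ℕ} (ht : t < n) (h : AncN pr x t) (hx : x < n) (hx' : pr x < n) :
    dist x ≤ dist t := by
  obtain ⟨k, rfl⟩ := h
  induction k with
  | zero => rfl
  | succ k ih =>
    rw [Function.iterate_succ_apply'] at hx hx' ⊢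
    have h' : pr^[k] t < n := by
      refine (hm.iterate_le ht k).lt_of_ne fun h' => ?_
      rw [h', hm.pr_n] at hx
      exact hx.false
    have := hm.dist_succ _ h' hx
    have := ih h' hx
    omega

end Model

theorem ite_mod {W : ℕ} (h : 1 < W) (c : Prop) [Decidable c] :
    (if c then 1 else 0) % W = if c then 1 else 0 := by
  split_ifs <;> simp [Nat.mod_eq_of_lt h]

theorem sub_mod' {W a b : ℕ} (h : b ≤ a) (h' : a < W) : (W + a - b) % W = a - b := by
  rw [Nat.add_sub_assoc h, Nat.add_mod_left, Nat.mod_eq_of_lt (by omega)]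

/-- Set the parent of the vertex `n` to `n`, and register `2` to the word for `⊤`. -/
def initProg : Prog :=
  .seq (.store 0 (.reg 0) (.reg 0)) (.assign 2 (.op .sub (.const 0) (.const 1)))

/-- Climb from `reg 6` to the root; count the edges in `reg 7`, their weights in `reg 8`. -/
def climbProg : Prog :=
  .loop (.op .lt (.cell 0 (.reg 6)) (.reg 0))
    (.seq (.assign 8 (.op .add (.reg 8) (.cell 1 (.reg 6))))
      (.seq (.assign 7 (.op .add (.reg 7) (.const 1))) (.assign 6 (.cell 0 (.reg 6)))))

/-- Compute the distances in array `4` and the depths in array `5`. -/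
def depthProg : Prog :=
  .forLoop 5 0 (.seq (.seq (.assign 6 (.reg 5)) (.seq (.assign 7 (.const 0)) (.assign 8 (.const 0))))
    (.seq climbProg (.seq (.store 5 (.reg 5) (.reg 7))
      (.ite (.op .lt (.op .eq (.reg 5) (.reg 1)) (.op .eq (.cell 0 (.reg 5)) (.reg 0)))
        (.store 4 (.reg 5) (.reg 2)) (.store 4 (.reg 5) (.reg 8))))))

/-- The input as seen by the programs, with the parent of `n` set. -/
structure Loaded (w n s : ℕ) (pr wts : ℕ → ℕ) (tab : ℕ → ℕ → ℕ) (σ : State) : Prop where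
  n_eq : σ.reg 0 = n
  s_eq : σ.reg 1 = s
  top_eq : σ.reg 2 = 2 ^ w - 1
  pr_eq : ∀ v ≤ n, σ.arr 0 v = pr v
  wts_eq : ∀ v < n, pr v < n → σ.arr 1 v = wts v
  tab_eq : ∀ t < n, ∀ v < n, σ.arr 2 (t * n + v) = tab t v

theorem Loaded.of_frame {p : Prog} {σ σ' : State} (h : Loaded w n s pr wts tab σ)
    (hf : Frame p σ σ') (h₁ : 0 ∉ p.regs ∧ 1 ∉ p.regs ∧ 2 ∉ p.regs)
    (h₂ : 0 ∉ p.arrs ∧ 1 ∉ p.arrs ∧ 2 ∉ p.arrs) : Loaded w n s pr wts tab σ' where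
  n_eq := (hf.reg 0 h₁.1).trans h.n_eq
  s_eq := (hf.reg 1 h₁.2.1).trans h.s_eq
  top_eq := (hf.reg 2 h₁.2.2).trans h.top_eq
  pr_eq v hv := (congrFun (hf.arr 0 h₂.1) v).trans (h.pr_eq v hv)
  wts_eq v hv hv' := (congrFun (hf.arr 1 h₂.2.1) v).trans (h.wts_eq v hv hv')
  tab_eq t ht v hv := (congrFun (hf.arr 2 h₂.2.2) _).trans (h.tab_eq t ht v hv)

namespace Model

variable (hm : Model w n s K Dm pr wts dep dist tab)
include hm

theorem climb {σ : State} (hl : Loaded w n s pr wts tab σ) {t : ℕ} (ht : t < n)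
    (h₆ : σ.reg 6 = t) (h₇ : σ.reg 7 = 0) (h₈ : σ.reg 8 = 0) :
    Wp w climbProg σ (n * 20 + 10) (fun σ' => σ'.reg 7 = dep t ∧
      (¬ (t ≠ s ∧ pr t = n) → σ'.reg 8 = dist t)) := by
  have hb := hm.big
  have hw := hm.one_lt
  refine Wp.mono (Wp.frame (Wp.loop (c := 12) (T := n * 20 + 10)
    (fun σ => σ.reg 6 < n ∧ σ.reg 7 + dep (σ.reg 6) = dep t ∧ σ.reg 8 + dist (σ.reg 6) = dist t)
    (fun σ => dep (σ.reg 6)) ?_ ?_ ?_)) le_rfl ?_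
  · simp [h₆, h₇, h₈, ht]
  · rintro σ₁ hf ⟨hy, hd, hD⟩ he
    have hl₁ := hl.of_frame (p := climbProg) ⟨hf.reg, hf.arr⟩ (by decide) (by decide)
    have hpr := hl₁.pr_eq _ hy.le
    rw [eval_lt _ _ _ hw] at he
    simp only [Expr.eval, hpr, hl₁.n_eq, ne_eq, ite_eq_right_iff, one_ne_zero, imp_false,
      not_not] at he
    have hwt := hl₁.wts_eq _ hy he
    have h₁ := hm.dep_succ _ hy he
    have h₂ := hm.dist_succ _ hy he
    have h₃ := hm.dist_lt ht
    have h₄ := hm.dep_lt _ ht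
    have h₅ : n ≤ n ^ 2 := Nat.le_self_pow (by omega) n
    refine Wp.straight rfl (by decide) ?_
    simp (disch := omega) [exec, Expr.eval, BinOp.eval, State.setReg, hwt,
      hpr, Nat.mod_eq_of_lt]
    omega
  · have h₄ := hm.dep_lt _ ht
    simp only [Expr.cost, h₆]
    omega
  · rintro σ' ⟨⟨⟨hy, hd, hD⟩, he⟩, hf⟩
    have hl₁ := hl.of_frame (p := climbProg) ⟨hf.reg, hf.arr⟩ (by decide) (by decide)
    have hpr := hl₁.pr_eq _ hy.le
    rw [eval_lt _ _ _ hw] at he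
    simp only [Expr.eval, hpr, hl₁.n_eq, ite_eq_right_iff, one_ne_zero, imp_false, not_lt] at he
    have hroot := le_antisymm (hm.pr_le _ hy) he
    refine ⟨by rw [hm.dep_root _ hy hroot] at hd; omega, fun h => ?_⟩
    -- A root other than `s` carries the all-ones word as distance, which exceeds every finite
    -- distance and so contradicts the invariant.
    have hys : σ'.reg 6 = s := by
      by_contra hys
      have h₁ := hm.dist_root _ hy hroot hys
      by_cases hts : t = s
      · rw [hts, hm.dist_s] at hD
        omega
      · have := hm.dist_le t ht ((hm.pr_le _ ht).lt_of_ne fun h' => h ⟨hts, h'⟩)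
        omega
    rw [hys, hm.dist_s] at hD
    omega

theorem depthProg_spec {σ : State} (hl : Loaded w n s pr wts tab σ) :
    Wp w depthProg σ (n * (n * 20 + 60) + 6)
      (fun σ' => ∀ t < n, σ'.arr 4 t = dist t ∧ σ'.arr 5 t = dep t) := by
  have hb := hm.big
  have hw := hm.one_lt
  have hnn : n ≤ n ^ 2 := Nat.le_self_pow (by omega) n
  refine Wp.forLoop n (fun k σ => ∀ t < k, σ.arr 4 t = dist t ∧ σ.arr 5 t = dep t)
    (by decide) (by decide) (by decide) hw (by omega) hl.n_eq (by simp) ?_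
    (c := n * 20 + 50) (Nat.add_le_add_right (Nat.mul_le_mul_left _ (by omega)) _)
  intro t σ₁ ht hf h₅ hI
  have hl₁ := hl.of_frame hf (by decide) (by decide)
  refine Wp.seq_straight rfl (T₁ := n * 20 + 30) ?_ (by simp [Prog.time, Expr.cost]; omega)
  refine Wp.seq (hm.climb (t := t) ?_ ht ?_ ?_ ?_) (T₂ := 20) ?_ (by omega)
  · exact hl₁.of_frame (p := .seq (.assign 6 (.reg 5)) (.seq (.assign 7 (.const 0))
      (.assign 8 (.const 0)))) (Run.frame (exists_run_of_straight w _ _ rfl).choose_spec.1)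
      (by decide) (by decide)
  · simp [exec, State.setReg, Expr.eval, h₅]
  · simp [exec, State.setReg, Expr.eval]
  · simp [exec, State.setReg, Expr.eval]
  intro σ₂ hf₂ ⟨h₇, h₈⟩
  have hn := hl₁.n_eq
  have hs := hl₁.s_eq
  have htop := hl₁.top_eq
  have hpr := hl₁.pr_eq t ht.le
  have e0 : σ₂.reg 0 = n := by rw [hf₂.reg 0 (by decide)]; simpa [exec, State.setReg] using hn
  have e1 : σ₂.reg 1 = s := by rw [hf₂.reg 1 (by decide)]; simpa [exec, State.setReg] using hs
  have e2 : σ₂.reg 2 = 2 ^ w - 1 := by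
    rw [hf₂.reg 2 (by decide)]; simpa [exec, State.setReg] using htop
  have e5 : σ₂.reg 5 = t := by rw [hf₂.reg 5 (by decide)]; simpa [exec, State.setReg] using h₅
  have a0 : σ₂.arr 0 = σ₁.arr 0 := by rw [hf₂.arr 0 (by decide)]; simp [exec, State.setReg]
  have a4 : σ₂.arr 4 = σ₁.arr 4 := by rw [hf₂.arr 4 (by decide)]; simp [exec, State.setReg]
  have a5 : σ₂.arr 5 = σ₁.arr 5 := by rw [hf₂.arr 5 (by decide)]; simp [exec, State.setReg]
  refine Wp.straight rfl (by decide) ?_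
  intro u hu
  -- The program tests this conjunction by comparing truth values: `0 < 1` holds exactly if `t = s`
  -- is false and `pr t = n` is true.
  by_cases hroot : t ≠ s ∧ pr t = n
  · have hd := hm.dist_root t ht hroot.2 hroot.1
    rcases Nat.lt_succ_iff_lt_or_eq.1 hu with hu | rfl
    · have := hI u hu
      simp [exec, Expr.eval, BinOp.eval, State.setReg, State.setArr, e0, e1, e2, e5, a0, a4, a5,
        h₇, hpr, hroot.1, hroot.2, Nat.mod_eq_of_lt hw, hu.ne, this]
    · simp [exec, Expr.eval, BinOp.eval, State.setReg, State.setArr, e0, e1, e2, e5, a0, a4, a5,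
        h₇, hpr, hroot.1, hroot.2, Nat.mod_eq_of_lt hw, hd]
  · have h₈ := h₈ hroot
    have he : ¬ ((if t = s then 1 else 0) < if pr t = n then 1 else 0) := by
      split_ifs <;> simp_all
    rcases Nat.lt_succ_iff_lt_or_eq.1 hu with hu | rfl
    · have := hI u hu
      simp [exec, Expr.eval, BinOp.eval, State.setReg, State.setArr, e0, e1, e5, a0, a4, a5,
        h₇, h₈, hpr, ite_mod hw, he, hu.ne, this]
    · simp [exec, Expr.eval, BinOp.eval, State.setReg, State.setArr, e0, e1, e5, a0, a4, a5,
        h₇, h₈, hpr, ite_mod hw, he]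

end Model

end Model

/-! ### Square root, sparse residue, pivot rows and near ancestors. -/

section Model

variable {w n s K Dm : ℕ} {pr wts dep dist : ℕ → ℕ} {tab : ℕ → ℕ → ℕ}

/-- Compute the least `L ≥ 1` with `n ≤ L * L` in register `3`. -/
def sqrtProg : Prog :=
  .seq (.assign 3 (.const 1)) (.loop (.op .lt (.op .mul (.reg 3) (.reg 3)) (.reg 0))
    (.assign 3 (.op .add (.reg 3) (.const 1))))

/-- Count in array `13` the vertices of each depth modulo `reg 3`. -/
def countProg : Prog :=
  .forLoop 5 0 (.seq (.assign 6 (.op .mod (.cell 5 (.reg 5)) (.reg 3)))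
    (.store 13 (.reg 6) (.op .add (.cell 13 (.reg 6)) (.const 1))))

/-- Find in register `4` a residue of at most `n / reg 3` depths. -/
def residueProg : Prog :=
  .seq (.assign 4 (.const 0)) (.loop (.op .lt (.reg 0) (.op .mul (.cell 13 (.reg 4)) (.reg 3)))
    (.assign 4 (.op .add (.reg 4) (.const 1))))

/-- Copy row `reg 5` of the table to array `11`, behind its first `reg 9` cells. -/
def copyRowProg : Prog :=
  .forLoop 6 0 (.store 11 (.op .add (.reg 9) (.reg 6))
    (.cell 2 (.op .add (.op .mul (.reg 5) (.reg 0)) (.reg 6))))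

/-- Copy the rows of the table for the pivots. -/
def rowsProg : Prog :=
  .seq (.assign 9 (.const 0)) (.forLoop 5 0
    (.ite (.op .eq (.op .mod (.cell 5 (.reg 5)) (.reg 3)) (.reg 4))
      (.seq (.store 7 (.reg 5) (.reg 9)) (.seq copyRowProg
        (.assign 9 (.op .add (.reg 9) (.reg 0))))) .skip))

/-- List the nearest `reg 3` ancestors of `reg 5` and their table entries. -/
def climbNearProg : Prog :=
  .forLoop 7 3 (.seq (.assign 8 (.op .add (.op .mul (.reg 5) (.reg 3)) (.reg 7)))
    (.seq (.store 14 (.reg 8) (.reg 6))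
      (.seq (.store 15 (.reg 8) (.cell 2 (.op .add (.op .mul (.reg 5) (.reg 0)) (.reg 6))))
        (.assign 6 (.cell 0 (.reg 6))))))

/-- List the nearest ancestors of every vertex. -/
def nearProg : Prog :=
  .forLoop 5 0 (.seq (.assign 6 (.reg 5)) climbNearProg)

/-- The number of vertices whose depth is `r` modulo `L`. -/
def residueCount (n L : ℕ) (dep : ℕ → ℕ) (r : ℕ) : ℕ :=
  ((Finset.range n).filter fun v => dep v % L = r).card

theorem residueCount_succ (n L : ℕ) (dep : ℕ → ℕ) (r : ℕ) :
    residueCount (n + 1) L dep r = residueCount n L dep r + if dep n % L = r then 1 else 0 := by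
  unfold residueCount
  rw [Finset.range_add_one, Finset.filter_insert]
  split_ifs with h
  · rw [Finset.card_insert_of_notMem (by simp)]
  · rfl

theorem residueCount_le (n L : ℕ) (dep : ℕ → ℕ) (r : ℕ) : residueCount n L dep r ≤ n :=
  (Finset.card_filter_le _ _).trans (Finset.card_range n).le

/-- Pigeonhole: the counts over all residues add up to `n`, so they cannot all exceed `n / L`. -/
theorem exists_residueCount_le {n L : ℕ} (hL : 1 ≤ L) (dep : ℕ → ℕ) :
    ∃ r < L, residueCount n L dep r * L ≤ n := by
  by_contra! h
  have h₁ : n = ∑ r ∈ Finset.range L, residueCount n L dep r := by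
    conv_lhs => rw [← Finset.card_range n]
    exact Finset.card_eq_sum_card_fiberwise fun v _ => by
      simpa using Nat.mod_lt _ (by omega)
  have h₂ : ∑ r ∈ Finset.range L, n < ∑ r ∈ Finset.range L, residueCount n L dep r * L :=
    Finset.sum_lt_sum_of_nonempty ⟨0, by simp; omega⟩ fun r hr => h r (by simpa using hr)
  rw [← Finset.sum_mul, ← h₁, Finset.sum_const, Finset.card_range, smul_eq_mul, mul_comm] at h₂
  exact h₂.false

/-- The state of the preprocessing after the first phases. -/
structure Ready (w n s L r : ℕ) (pr wts dep dist : ℕ → ℕ) (tab : ℕ → ℕ → ℕ) (σ : State) : Prop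
    extends Loaded w n s pr wts tab σ where
  L_eq : σ.reg 3 = L
  r_eq : σ.reg 4 = r
  dist_eq : ∀ t < n, σ.arr 4 t = dist t
  dep_eq : ∀ t < n, σ.arr 5 t = dep t

theorem Ready.of_frame {L r : ℕ} {p : Prog} {σ σ' : State}
    (h : Ready w n s L r pr wts dep dist tab σ)
    (hf : Frame p σ σ') (h₁ : 0 ∉ p.regs ∧ 1 ∉ p.regs ∧ 2 ∉ p.regs)
    (h₂ : 0 ∉ p.arrs ∧ 1 ∉ p.arrs ∧ 2 ∉ p.arrs) (h₃ : 3 ∉ p.regs ∧ 4 ∉ p.regs)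
    (h₄ : 4 ∉ p.arrs ∧ 5 ∉ p.arrs) :
    Ready w n s L r pr wts dep dist tab σ' where
  toLoaded := h.toLoaded.of_frame hf h₁ h₂
  L_eq := (hf.reg 3 h₃.1).trans h.L_eq
  r_eq := (hf.reg 4 h₃.2).trans h.r_eq
  dist_eq t ht := (congrFun (hf.arr 4 h₄.1) t).trans (h.dist_eq t ht)
  dep_eq t ht := (congrFun (hf.arr 5 h₄.2) t).trans (h.dep_eq t ht)

theorem frame_exec {w : ℕ} {p : Prog} {σ : State} (h : p.straight = true) :
    Frame p σ (exec w p σ) := (exists_run_of_straight w p σ h).choose_spec.1.frame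

theorem mul_add_lt_sq {t y n L : ℕ} (ht : t < n) (hy : y < L) (hL : L ≤ n) : t * L + y < n ^ 2 := by
  nlinarith

namespace Model

variable (hm : Model w n s K Dm pr wts dep dist tab)
include hm

/-- The last conjunct records minimality, which bounds the final `L` above in the size estimate.
Staying below `n` keeps the squares at most `n ^ 2`, so the multiplication does not wrap. -/
theorem sqrtProg_spec {σ : State} (h₀ : σ.reg 0 = n) :
    Wp w sqrtProg σ (n * 20 + 20) (fun σ' => 1 ≤ σ'.reg 3 ∧ σ'.reg 3 ≤ n ∧
      n ≤ σ'.reg 3 * σ'.reg 3 ∧ (σ'.reg 3 - 1) * (σ'.reg 3 - 1) < n) := by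
  have hb := hm.big
  have hw := hm.one_lt
  have hs := hm.s_lt
  have hnn := Nat.le_self_pow two_ne_zero n
  have key := Wp.loop (w := w) (e := .op .lt (.op .mul (.reg 3) (.reg 3)) (.reg 0))
    (p := .assign 3 (.op .add (.reg 3) (.const 1))) (σ₀ := σ.setReg 3 1) (c := 4)
    (T := n * 20 + 10) (fun σ => 1 ≤ σ.reg 3 ∧ σ.reg 3 ≤ n ∧
      (σ.reg 3 - 1) * (σ.reg 3 - 1) < n) (fun σ => n - σ.reg 3) ?_ ?_ ?_
  · refine Wp.seq_straight rfl (T₁ := n * 20 + 10) ?_ (by simp [Prog.time, Expr.cost]; omega)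
    rw [exec, eval_const _ hw]
    refine key.frame.mono le_rfl ?_
    rintro σ' ⟨⟨⟨h₁, h₂, h₃⟩, he⟩, hf⟩
    have e0 : σ'.reg 0 = n := by rw [hf.reg 0 (by decide)]; simpa [State.setReg] using h₀
    have hsq : σ'.reg 3 * σ'.reg 3 ≤ n ^ 2 := by nlinarith
    rw [eval_lt _ _ _ hw, eval_mul _ _ _ (by simp only [Expr.eval]; omega)] at he
    simp only [Expr.eval, e0, ite_eq_right_iff, one_ne_zero, imp_false, not_lt] at he
    exact ⟨h₁, h₂, he, h₃⟩
  · simp [State.setReg]; omega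
  · rintro σ' hf ⟨h₁, h₂, h₃⟩ he
    have e0 : σ'.reg 0 = n := by rw [hf.reg 0 (by decide)]; simpa [State.setReg] using h₀
    have hsq : σ'.reg 3 * σ'.reg 3 ≤ n ^ 2 := by nlinarith
    rw [eval_lt _ _ _ hw, eval_mul _ _ _ (by simp only [Expr.eval]; omega)] at he
    simp only [Expr.eval, e0, ne_eq, ite_eq_right_iff, one_ne_zero, imp_false, not_not] at he
    have hlt : σ'.reg 3 < n := by nlinarith
    refine Wp.straight rfl (by decide) ?_
    simp (disch := omega) [exec, Expr.eval, BinOp.eval, State.setReg, Nat.mod_eq_of_lt, he]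
    omega
  · simp only [State.setReg, Function.update_self, Expr.cost]
    omega

theorem countProg_spec {σ : State} {L : ℕ} (h₀ : σ.reg 0 = n) (h₃ : σ.reg 3 = L)
    (h₅ : ∀ t < n, σ.arr 5 t = dep t) (h₁₃ : ∀ r, σ.arr 13 r = 0) :
    Wp w countProg σ (n * 30 + 6) (fun σ' => ∀ r, σ'.arr 13 r = residueCount n L dep r) := by
  have hb := hm.big
  have hw := hm.one_lt
  have hnn := Nat.le_self_pow two_ne_zero n
  refine Wp.forLoop n (fun k σ => ∀ r, σ.arr 13 r = residueCount k L dep r)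
    (by decide) (by decide) (by decide) hw (by omega) h₀ (by simp [State.setReg, h₁₃, residueCount])
    ?_ (c := 22) (by omega)
  intro t σ₁ ht hf h5 hI
  have e3 : σ₁.reg 3 = L := by rw [hf.reg 3 (by decide), h₃]
  have a5 : σ₁.arr 5 t = dep t := by rw [hf.arr 5 (by decide), h₅ t ht]
  have hd := hm.dep_lt t ht
  have hmod := Nat.mod_le (dep t) L
  have hc := residueCount_le t L dep (dep t % L)
  refine Wp.straight rfl (by decide) ?_
  intro r
  rw [residueCount_succ]
  by_cases hr : dep t % L = r
  · subst hr
    simp (disch := omega) [exec, Expr.eval, BinOp.eval, State.setReg, State.setArr, h5, a5, e3, hI,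
      Nat.mod_eq_of_lt]
  · simp (disch := omega) [exec, Expr.eval, BinOp.eval, State.setReg, State.setArr, h5, a5, e3, hI,
      Nat.mod_eq_of_lt, hr]

/-- Every rejected residue is too frequent, while some residue below `L` is not, so the search stops
before `L`. -/
theorem residueProg_spec {σ : State} {L : ℕ} (h₀ : σ.reg 0 = n) (h₃ : σ.reg 3 = L) (hL : 1 ≤ L)
    (hLn : L ≤ n) (h₁₃ : ∀ r, σ.arr 13 r = residueCount n L dep r) :
    Wp w residueProg σ (n * 20 + 20)
      (fun σ' => σ'.reg 4 < L ∧ residueCount n L dep (σ'.reg 4) * L ≤ n) := by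
  have hb := hm.big
  have hw := hm.one_lt
  have hnn := Nat.le_self_pow two_ne_zero n
  obtain ⟨r₀, hr₀, hr₀'⟩ := exists_residueCount_le (n := n) hL dep
  have hmul : ∀ r, residueCount n L dep r * L ≤ n ^ 2 := fun r => by
    rw [sq]; exact Nat.mul_le_mul (residueCount_le _ _ _ _) hLn
  have hle : ∀ σ' : State, (∀ r < σ'.reg 4, n < residueCount n L dep r * L) → σ'.reg 4 < L := by
    intro σ' h
    by_contra hlt
    exact (h r₀ (by omega)).not_ge hr₀'
  have key := Wp.loop (w := w)
    (e := .op .lt (.reg 0) (.op .mul (.cell 13 (.reg 4)) (.reg 3)))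
    (p := .assign 4 (.op .add (.reg 4) (.const 1))) (σ₀ := σ.setReg 4 0) (c := 4)
    (T := n * 20 + 10) (fun σ => ∀ r < σ.reg 4, n < residueCount n L dep r * L)
    (fun σ => L - σ.reg 4) ?_ ?_ ?_
  · refine Wp.seq_straight rfl (T₁ := n * 20 + 10) ?_ (by simp [Prog.time, Expr.cost]; omega)
    rw [exec, eval_const _ (by omega)]
    refine key.frame.mono le_rfl ?_
    rintro σ' ⟨⟨h, he⟩, hf⟩
    have e0 : σ'.reg 0 = n := by rw [hf.reg 0 (by decide)]; simpa [State.setReg] using h₀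
    have e3 : σ'.reg 3 = L := by rw [hf.reg 3 (by decide)]; simpa [State.setReg] using h₃
    have a13 : ∀ r, σ'.arr 13 r = residueCount n L dep r := by
      rw [hf.arr 13 (by decide)]; simpa [State.setReg] using h₁₃
    have := hmul (σ'.reg 4)
    rw [eval_lt _ _ _ hw, eval_mul _ _ _ (by simp only [Expr.eval, e3, a13]; omega)] at he
    simp only [Expr.eval, e0, e3, a13, ite_eq_right_iff, one_ne_zero, imp_false, not_lt] at he
    exact ⟨hle _ h, he⟩
  · simp [State.setReg]
  · rintro σ' hf h he
    have e0 : σ'.reg 0 = n := by rw [hf.reg 0 (by decide)]; simpa [State.setReg] using h₀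
    have e3 : σ'.reg 3 = L := by rw [hf.reg 3 (by decide)]; simpa [State.setReg] using h₃
    have a13 : ∀ r, σ'.arr 13 r = residueCount n L dep r := by
      rw [hf.arr 13 (by decide)]; simpa [State.setReg] using h₁₃
    have := hmul (σ'.reg 4)
    rw [eval_lt _ _ _ hw, eval_mul _ _ _ (by simp only [Expr.eval, e3, a13]; omega)] at he
    simp only [Expr.eval, e0, e3, a13, ne_eq, ite_eq_right_iff, one_ne_zero, imp_false,
      not_not] at he
    have hlt := hle _ h
    refine Wp.straight rfl (by decide) ?_
    have hev : (Expr.op .add (.reg 4) (.const 1)).eval w σ' = σ'.reg 4 + 1 := by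
      simp (disch := omega) [Expr.eval, BinOp.eval, Nat.mod_eq_of_lt]
    simp only [exec, hev, State.setReg, Function.update_self]
    refine ⟨fun r hr => ?_, by omega⟩
    rcases Nat.lt_succ_iff_lt_or_eq.1 hr with hr | rfl
    · exact h r hr
    · exact he
  · simp only [State.setReg, Function.update_self, Expr.cost]
    omega

theorem copyRowProg_spec {σ : State} (hl : Loaded w n s pr wts tab σ) {v c : ℕ} (hv : v < n)
    (h₅ : σ.reg 5 = v) (h₉ : σ.reg 9 = c) (hc : c ≤ n ^ 2) :
    Wp w copyRowProg σ (n * 30 + 6) (fun σ' => (∀ i < n, σ'.arr 11 (c + i) = tab v i) ∧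
      ∀ i < c, σ'.arr 11 i = σ.arr 11 i) := by
  have hb := hm.big
  have hw := hm.one_lt
  have hnn := Nat.le_self_pow two_ne_zero n
  refine Wp.forLoop n (fun k σ' => (∀ i < k, σ'.arr 11 (c + i) = tab v i) ∧
      ∀ i < c, σ'.arr 11 i = σ.arr 11 i)
    (by decide) (by decide) (by decide) hw (by omega) hl.n_eq (by simp [State.setReg])
    ?_ (c := 22) (by omega)
  intro t σ₁ ht hf h6 ⟨hI, hI'⟩
  have hl₁ := hl.of_frame hf (by decide) (by decide)
  have e5 : σ₁.reg 5 = v := by rw [hf.reg 5 (by decide), h₅]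
  have e9 : σ₁.reg 9 = c := by rw [hf.reg 9 (by decide), h₉]
  have h₁ := mul_add_lt_sq hv ht le_rfl
  have h₂ := hl₁.tab_eq v hv t ht
  have h₃ := hl₁.n_eq
  refine Wp.straight rfl (by decide) ⟨fun i hi => ?_, fun i hi => ?_⟩
  · rcases Nat.lt_succ_iff_lt_or_eq.1 hi with hi | rfl
    · simp (disch := omega) [exec, Expr.eval, BinOp.eval, State.setReg, State.setArr, h6, e9, e5,
        h₃, Nat.mod_eq_of_lt, hI]
    · simp (disch := omega) [exec, Expr.eval, BinOp.eval, State.setReg, State.setArr, h6, e9, e5,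
        h₃, Nat.mod_eq_of_lt, h₂]
  · have : i ≠ c + t := by omega
    simp (disch := omega) [exec, Expr.eval, BinOp.eval, State.setReg, State.setArr, h6, e9, e5,
      h₃, Nat.mod_eq_of_lt, hI' i hi]

theorem rowsProg_spec {L r : ℕ} {σ : State} (hl : Ready w n s L r pr wts dep dist tab σ) :
    Wp w rowsProg σ (n * (n * 30 + 60) + 20)
      (fun σ' => σ'.reg 9 = n * residueCount n L dep r ∧ ∀ v < n, dep v % L = r →
        σ'.arr 7 v + n ≤ σ'.reg 9 ∧ ∀ i < n, σ'.arr 11 (σ'.arr 7 v + i) = tab v i) := by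
  have hb := hm.big
  have hw := hm.one_lt
  have hnn := Nat.le_self_pow two_ne_zero n
  refine Wp.seq_straight rfl ?_ (T₁ := n * (n * 30 + 60) + 6)
    (by simp only [Prog.time, Expr.cost]; omega)
  have hl' := hl.of_frame (frame_exec (w := w) (p := .assign 9 (.const 0)) (σ := σ) rfl)
    (by decide) (by decide) (by decide) (by decide)
  refine Wp.forLoop n (fun k σ' => σ'.reg 9 = n * residueCount k L dep r ∧
      ∀ v < k, dep v % L = r →
        σ'.arr 7 v + n ≤ σ'.reg 9 ∧ ∀ i < n, σ'.arr 11 (σ'.arr 7 v + i) = tab v i)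
    (by decide) (by decide) (by decide) hw (by omega) hl'.n_eq
    (by simp [State.setReg, residueCount, exec, Expr.eval])
    ?_ (c := n * 30 + 40) (Nat.add_le_add_right (Nat.mul_le_mul_left _ (by omega)) _)
  intro t σ₁ ht hf h5 ⟨hI, hI'⟩
  have hl₁ := hl'.of_frame hf (by decide) (by decide) (by decide) (by decide)
  have hd := hm.dep_lt t ht
  have hmod := Nat.mod_le (dep t) L
  have e3 := hl₁.L_eq
  have e4 := hl₁.r_eq
  have e0 := hl₁.n_eq
  have a5 := hl₁.dep_eq t ht
  have hev : (Expr.op .eq (.op .mod (.cell 5 (.reg 5)) (.reg 3)) (.reg 4)).eval w σ₁ =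
      if dep t % L = r then 1 else 0 := by
    simp (disch := omega) [Expr.eval, BinOp.eval, h5, e3, e4, a5, Nat.mod_eq_of_lt, ite_mod hw]
  have hc := residueCount_le t L dep r
  have hc' : n * residueCount t L dep r ≤ n ^ 2 := by rw [sq]; exact Nat.mul_le_mul_left _ (by omega)
  refine Wp.ite (T' := n * 30 + 30) ?_ ?_ (by simp only [Expr.cost]; omega)
  · intro he
    have hr : dep t % L = r := by
      rw [hev] at he; by_contra h; simp [h] at he
    refine Wp.seq_straight rfl ?_ (T₁ := n * 30 + 20) (by simp only [Prog.time, Expr.cost]; omega)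
    have hl₂ := hl₁.of_frame (frame_exec (w := w) (p := .store 7 (.reg 5) (.reg 9)) (σ := σ₁) rfl)
      (by decide) (by decide) (by decide) (by decide)
    refine Wp.seq (hm.copyRowProg_spec hl₂.toLoaded (v := t) (c := n * residueCount t L dep r) ht
      ?_ ?_ hc') ?_ (T₂ := 10) (by omega)
    · simpa [exec, State.setArr] using h5
    · simpa [exec, State.setArr] using hI
    · rintro σ₃ hf₃ ⟨hrow, hold⟩
      have e9 : σ₃.reg 9 = n * residueCount t L dep r := by
        rw [hf₃.reg 9 (by decide)]; simpa [exec, State.setArr] using hI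
      have e0' : σ₃.reg 0 = n := by
        rw [hf₃.reg 0 (by decide)]; simpa [exec, State.setArr] using e0
      have a7 : σ₃.arr 7 = Function.update (σ₁.arr 7) t (n * residueCount t L dep r) := by
        rw [hf₃.arr 7 (by decide)]; simp [exec, State.setArr, Expr.eval, h5, hI]
      have hold' : ∀ i < n * residueCount t L dep r, σ₃.arr 11 i = σ₁.arr 11 i := fun i hi => by
        rw [hold i hi]; simp [exec, State.setArr]
      refine Wp.straight rfl (by decide) ?_
      have hev : (Expr.op .add (.reg 9) (.reg 0)).eval w σ₃ =
          n * residueCount t L dep r + n := by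
        simp (disch := omega) [Expr.eval, BinOp.eval, e9, e0', Nat.mod_eq_of_lt]
      simp only [exec, hev, State.setReg]
      refine ⟨by simp [residueCount_succ, hr, mul_add], fun v hv hvr => ?_⟩
      rcases Nat.lt_succ_iff_lt_or_eq.1 hv with hv | rfl
      · obtain ⟨k₁, k₂⟩ := hI' v hv hvr
        rw [hI] at k₁
        simp only [a7, Function.update_of_ne hv.ne]
        refine ⟨by simp; omega, fun i hi => ?_⟩
        rw [hold' _ (by omega), k₂ i hi]
      · simp only [a7, Function.update_self]
        exact ⟨by simp, hrow⟩
  · intro he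
    have hr : dep t % L ≠ r := by
      rw [hev] at he; intro h; simp [h] at he
    refine Wp.straight rfl (by simp [Prog.time]) ?_
    refine ⟨by simpa [exec, State.setReg, residueCount_succ, hr] using hI, fun v hv hvr => ?_⟩
    rcases Nat.lt_succ_iff_lt_or_eq.1 hv with hv | rfl
    · simpa [exec, State.setReg] using hI' v hv hvr
    · exact absurd hvr hr

/-- The climb may run past the root; from then on it stays at `n`, the fixed point of `pr`. The
table word read there is meaningless, hence the implication for array `15`. -/
theorem climbNearProg_spec {L r : ℕ} {σ : State} (hl : Ready w n s L r pr wts dep dist tab σ)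
    (hLn : L ≤ n) {t : ℕ} (ht : t < n) (h₅ : σ.reg 5 = t) (h₆ : σ.reg 6 = t) :
    Wp w climbNearProg σ (n * 40 + 6) (fun σ' => (∀ j < L, σ'.arr 14 (t * L + j) = pr^[j] t ∧
      (pr^[j] t < n → σ'.arr 15 (t * L + j) = tab t (pr^[j] t))) ∧
      ∀ i < t * L, σ'.arr 14 i = σ.arr 14 i ∧ σ'.arr 15 i = σ.arr 15 i) := by
  have hb := hm.big
  have hw := hm.one_lt
  have hnn := Nat.le_self_pow two_ne_zero n
  refine (Wp.forLoop L (fun k σ' => σ'.reg 6 = pr^[k] t ∧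
      (∀ j < k, σ'.arr 14 (t * L + j) = pr^[j] t ∧
        (pr^[j] t < n → σ'.arr 15 (t * L + j) = tab t (pr^[j] t))) ∧
      ∀ i < t * L, σ'.arr 14 i = σ.arr 14 i ∧ σ'.arr 15 i = σ.arr 15 i)
    (by decide) (by decide) (by decide) hw (by omega) hl.L_eq (by simp [State.setReg, h₆])
    ?_ (c := 30) (T := n * 40 + 6) (by omega)).mono le_rfl fun _ h => h.2
  intro k σ₁ hk hf h7 ⟨h6, hI, hI'⟩
  have hl₁ := hl.of_frame hf (by decide) (by decide) (by decide) (by decide)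
  have e5 : σ₁.reg 5 = t := by rw [hf.reg 5 (by decide), h₅]
  have e3 := hl₁.L_eq
  have e0 := hl₁.n_eq
  have h₁ := mul_add_lt_sq ht hk hLn
  have hle := hm.iterate_le ht k
  have h₂ : t * n + pr^[k] t ≤ n ^ 2 := by nlinarith
  have h₃ := hl₁.pr_eq _ hle
  refine Wp.straight rfl (by decide) ⟨?_, fun j hj => ?_, fun i hi => ?_⟩
  · rw [Function.iterate_succ_apply']
    simp (disch := omega) [exec, Expr.eval, BinOp.eval, State.setReg, State.setArr, h6, h₃]
  · rcases Nat.lt_succ_iff_lt_or_eq.1 hj with hj | rfl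
    · simp (disch := omega) [exec, Expr.eval, BinOp.eval, State.setReg, State.setArr, h6, h7, e5,
        e3, e0, Nat.mod_eq_of_lt]
      exact hI j hj
    · simp (disch := omega) [exec, Expr.eval, BinOp.eval, State.setReg, State.setArr, h6, h7, e5,
        e3, e0, Nat.mod_eq_of_lt]
      exact fun h => hl₁.tab_eq t ht _ h
  · have : i ≠ t * L + k := by omega
    simp (disch := omega) [exec, Expr.eval, BinOp.eval, State.setReg, State.setArr, h6, h7, e5,
      e3, e0, Nat.mod_eq_of_lt]
    exact hI' i hi

theorem nearProg_spec {L r : ℕ} {σ : State} (hl : Ready w n s L r pr wts dep dist tab σ)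
    (hLn : L ≤ n) :
    Wp w nearProg σ (n * (n * 40 + 60) + 6) (fun σ' => ∀ t < n, ∀ j < L,
      σ'.arr 14 (t * L + j) = pr^[j] t ∧
        (pr^[j] t < n → σ'.arr 15 (t * L + j) = tab t (pr^[j] t))) := by
  have hb := hm.big
  have hw := hm.one_lt
  have hnn := Nat.le_self_pow two_ne_zero n
  refine Wp.forLoop n (fun k σ' => ∀ t < k, ∀ j < L,
      σ'.arr 14 (t * L + j) = pr^[j] t ∧
        (pr^[j] t < n → σ'.arr 15 (t * L + j) = tab t (pr^[j] t)))
    (by decide) (by decide) (by decide) hw (by omega) hl.n_eq (by simp)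
    ?_ (c := n * 40 + 40) (Nat.add_le_add_right (Nat.mul_le_mul_left _ (by omega)) _)
  intro t σ₁ ht hf h5 hI
  have hl₁ := hl.of_frame hf (by decide) (by decide) (by decide) (by decide)
  refine Wp.seq_straight rfl ?_ (T₁ := n * 40 + 6) (by simp only [Prog.time, Expr.cost]; omega)
  refine (hm.climbNearProg_spec (hl₁.of_frame (frame_exec rfl) (by decide) (by decide) (by decide)
    (by decide)) hLn ht ?_ ?_).mono le_rfl ?_
  · simpa [exec, State.setReg] using h5
  · simp [exec, State.setReg, Expr.eval, h5]
  · rintro σ' ⟨h₁, h₂⟩ u hu j hj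
    rcases Nat.lt_succ_iff_lt_or_eq.1 hu with hu | rfl
    · have hlt : u * L + j < t * L := by nlinarith
      simp only [State.setReg, (h₂ _ hlt).1, (h₂ _ hlt).2]
      simpa [exec, State.setReg] using hI u hu j hj
    · exact h₁ j hj

end Model

end Model

/-! ### Pivots and segments of bad values. -/

section Model

variable {w n s K Dm : ℕ} {pr wts dep dist : ℕ → ℕ} {tab : ℕ → ℕ → ℕ}

/-- The cells `lo, …, hi - 1` of `bd` and `bv` describe the table entries of `t` for the bad
failures of depth more than `d`: each value, together with the smallest depth where it occurs. -/
structure IsSegment (w n : ℕ) (pr dep dist : ℕ → ℕ) (tab : ℕ → ℕ → ℕ) (t x lo hi d : ℕ)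
    (bd bv : ℕ → ℕ) : Prop where
  le : lo ≤ hi
  sound : ∀ i, lo ≤ i → i < hi →
    ∃ y, BadN w n pr dist tab t x y ∧ dep y = bd i ∧ tab t y = bv i ∧ d < bd i
  complete : ∀ y, BadN w n pr dist tab t x y → d < dep y →
    ∃ i, lo ≤ i ∧ i < hi ∧ bd i ≤ dep y ∧ bv i = tab t y
  mono : ∀ i j, lo ≤ i → i < j → j < hi → bd j < bd i ∧ bv i < bv j

theorem IsSegment.congr {t x lo hi d : ℕ} {bd bv bd' bv' : ℕ → ℕ}
    (h : IsSegment w n pr dep dist tab t x lo hi d bd bv)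
    (hd : ∀ i < hi, bd' i = bd i) (hv : ∀ i < hi, bv' i = bv i) :
    IsSegment w n pr dep dist tab t x lo hi d bd' bv' where
  le := h.le
  sound i hi hi' := by rw [hd i hi', hv i hi']; exact h.sound i hi hi'
  complete y hy hy' := by
    obtain ⟨i, h₁, h₂, h₃⟩ := h.complete y hy hy'
    exact ⟨i, h₁, h₂, by rwa [hd i h₂, hv i h₂]⟩
  mono i j h₁ h₂ h₃ := by
    rw [hd i (by omega), hd j h₃, hv i (by omega), hv j h₃]
    exact h.mono i j h₁ h₂ h₃

namespace Model

variable (hm : Model w n s K Dm pr wts dep dist tab)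
include hm

theorem eq_of_dep_eq {x y y' : ℕ} (hx : x < n) (hy : y < n) (hy' : y' < n) (h : AncN pr y x)
    (h' : AncN pr y' x) (hd : dep y = dep y') : y = y' := by
  obtain ⟨k, rfl⟩ := h
  obtain ⟨l, rfl⟩ := h'
  have h₁ := hm.dep_iterate hx hy
  have h₂ := hm.dep_iterate hx hy'
  rw [show k = l by omega]

theorem dep_le_of_anc {x y : ℕ} (hx : x < n) (hy : y < n) (h : AncN pr y x) : dep y ≤ dep x := by
  obtain ⟨k, rfl⟩ := h
  have h₁ := hm.dep_iterate hx hy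
  omega

theorem dep_pos {y : ℕ} (hy : y < n) (hy' : pr y < n) : 1 ≤ dep y := by
  rw [hm.dep_succ y hy hy']; omega

theorem segment_empty {t x lo : ℕ} (hx : x < n) (bd bv : ℕ → ℕ) :
    IsSegment w n pr dep dist tab t x lo lo (dep x) bd bv where
  le := le_rfl
  sound i h₁ h₂ := by omega
  complete y hy h := by
    have := hm.dep_le_of_anc hx hy.lt hy.anc
    omega
  mono i j h₁ h₂ h₃ := by omega

theorem segment_skip {t x y lo hi d : ℕ} {bd bv : ℕ → ℕ} (hx : x < n) (hy : y < n)
    (hyx : AncN pr y x) (hd : dep y = d + 1)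
    (h : IsSegment w n pr dep dist tab t x lo hi (d + 1) bd bv)
    (hb : ¬ BadN w n pr dist tab t x y) : IsSegment w n pr dep dist tab t x lo hi d bd bv where
  le := h.le
  sound i h₁ h₂ := by
    obtain ⟨z, k₁, k₂, k₃, k₄⟩ := h.sound i h₁ h₂
    exact ⟨z, k₁, k₂, k₃, by omega⟩
  complete z hz hdz := by
    by_cases hzd : dep z = d + 1
    · exact absurd (hm.eq_of_dep_eq hx hz.lt hy hz.anc hyx (by omega) ▸ hz) hb
    · exact h.complete z hz (by omega)
  mono := h.mono

/-- Covers both updates: `m = hi` appends an entry, `m = hi - 1` overwrites the last one. In the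
second case the lost entry has the same value at a larger depth, so the new one serves all its
failures. -/
theorem segment_add {t x y lo m hi d : ℕ} {bd bv bd' bv' : ℕ → ℕ} (hx : x < n)
    (hd : dep y = d + 1) (h : IsSegment w n pr dep dist tab t x lo hi (d + 1) bd bv)
    (hb : BadN w n pr dist tab t x y) (hlo : lo ≤ m) (hm' : m ≤ hi)
    (hold : ∀ i < m, bd' i = bd i ∧ bv' i = bv i) (hbd : bd' m = d + 1) (hbv : bv' m = tab t y)
    (hlt : ∀ i, lo ≤ i → i < m → bv i < tab t y)
    (heq : ∀ i, m ≤ i → i < hi → bv i = tab t y) :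
    IsSegment w n pr dep dist tab t x lo (m + 1) d bd' bv' where
  le := by omega
  sound i h₁ h₂ := by
    rcases Nat.lt_succ_iff_lt_or_eq.1 h₂ with h₂ | rfl
    · obtain ⟨z, k₁, k₂, k₃, k₄⟩ := h.sound i h₁ (by omega)
      exact ⟨z, k₁, by rw [(hold i h₂).1, k₂], by rw [(hold i h₂).2, k₃], by
        rw [(hold i h₂).1]; omega⟩
    · exact ⟨y, hb, by rw [hbd, hd], hbv.symm, by omega⟩
  complete z hz hdz := by
    by_cases hzd : dep z = d + 1
    · have hzy := hm.eq_of_dep_eq hx hz.lt hb.lt hz.anc hb.anc (by omega)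
      exact ⟨m, hlo, by omega, by omega, by rw [hbv, hzy]⟩
    · obtain ⟨i, k₁, k₂, k₃, k₄⟩ := h.complete z hz (by omega)
      by_cases him : i < m
      · exact ⟨i, k₁, by omega, by rw [(hold i him).1]; exact k₃, by rw [(hold i him).2]; exact k₄⟩
      · exact ⟨m, hlo, by omega, by omega, by rw [hbv, ← k₄, heq i (by omega) k₂]⟩
  mono i j h₁ h₂ h₃ := by
    rcases Nat.lt_succ_iff_lt_or_eq.1 h₃ with h₃ | rfl
    · rw [(hold i (by omega)).1, (hold i (by omega)).2, (hold j h₃).1, (hold j h₃).2]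
      exact h.mono i j h₁ h₂ (by omega)
    · obtain ⟨z, -, -, -, k₄⟩ := h.sound i h₁ (by omega)
      rw [(hold i h₂).1, (hold i h₂).2, hbd, hbv]
      exact ⟨k₄, hlt i h₁ h₂⟩

/-- The stored failures are deeper than `y`, so their values are no larger. Hence comparing a new
value with the last one is enough to detect repetition. -/
theorem segment_value_le {t x y lo hi d : ℕ} {bd bv : ℕ → ℕ} (ht : t < n) (hxt : AncN pr x t)
    (hd : dep y = d + 1) (h : IsSegment w n pr dep dist tab t x lo hi (d + 1) bd bv)
    (hb : BadN w n pr dist tab t x y) {i : ℕ} (h₁ : lo ≤ i) (h₂ : i < hi) : bv i ≤ tab t y := by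
  obtain ⟨z, k₁, k₂, k₃, k₄⟩ := h.sound i h₁ h₂
  rw [← k₃]
  exact hm.tab_le_of_bad t ht x hxt y hb z k₁.lt k₁.pr_lt k₁.anc (by omega)

/-- The failures behind the entries form a chain with strictly monotone depths and values, to which
the counting bound applies. -/
theorem segment_length_le {t x lo hi d : ℕ} {bd bv : ℕ → ℕ} (ht : t < n) (hxt : AncN pr x t)
    (h : IsSegment w n pr dep dist tab t x lo hi d bd bv) : hi ≤ lo + K := by
  choose! y hy using h.sound
  have := hm.chain t ht x hxt (hi - lo) (fun i => y (lo + i))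
    (fun i hi => (hy _ (by omega) (by omega)).1) (fun i j hij hj => by
      rw [(hy (lo + i) (by omega) (by omega)).2.1, (hy (lo + j) (by omega) (by omega)).2.1]
      exact (h.mono _ _ (by omega) (by omega) (by omega)).1) (fun i j hij hj => by
      rw [(hy (lo + i) (by omega) (by omega)).2.2.1, (hy (lo + j) (by omega) (by omega)).2.2.1]
      exact (h.mono _ _ (by omega) (by omega) (by omega)).2)
  omega

/-- A finite value is a sum of two numbers at most `Dm`. So the addition does not wrap, and a bad
value, being smaller than this, is never the all-ones word. -/
theorem via_le_top {t x y : ℕ} (ht : t < n) (hx : x < n) (hy : y < n) (hpy : pr y < n)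
    (hxt : AncN pr x t) (hpx : pr x < n) : via w dist tab t x y ≤ 2 ^ w - 1 := by
  have hb := hm.big
  unfold via
  split_ifs with h
  · rfl
  · have h₁ := (hm.tab_le x hx y hy hpy).resolve_left h
    have h₂ : dist t ≤ Dm := by
      obtain ⟨k, rfl⟩ := hxt
      refine hm.dist_le t ht ?_
      cases k with
      | zero => exact hpx
      | succ k =>
        rw [Function.iterate_succ_apply] at hx
        refine (hm.pr_le t ht).lt_of_ne fun h => ?_
        rw [h, hm.iterate_n] at hx
        exact hx.false
    omega

end Model

/-- Climb from `reg 6` to the next vertex with depth `reg 4` modulo `reg 3`, or to the root. -/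
def pivotProg : Prog :=
  .loop (.op .lt (.op .eq (.op .mod (.cell 5 (.reg 6)) (.reg 3)) (.reg 4))
    (.op .lt (.cell 0 (.reg 6)) (.reg 0))) (.assign 6 (.cell 0 (.reg 6)))

/-- The table entry of `reg 5` for the failure `reg 7`, and that via `reg 6`. -/
def compareProg : Prog :=
  .seq (.assign 8 (.cell 2 (.op .add (.op .mul (.reg 5) (.reg 0)) (.reg 7))))
    (.seq (.assign 13 (.cell 2 (.op .add (.op .mul (.reg 6) (.reg 0)) (.reg 7))))
      (.ite (.op .eq (.reg 13) (.reg 2)) (.assign 14 (.reg 2))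
        (.assign 14 (.op .add (.reg 13) (.op .sub (.cell 4 (.reg 5)) (.cell 4 (.reg 6)))))))

/-- Add the value `reg 8` at the failure `reg 7` to the segment that ends at `reg 11`. -/
def pushProg : Prog :=
  .ite (.op .lt (.reg 8) (.reg 14))
    (.seq (.ite (.op .eq (.reg 8) (.reg 12)) .skip
      (.seq (.store 17 (.reg 11) (.reg 8))
        (.seq (.assign 11 (.op .add (.reg 11) (.const 1))) (.assign 12 (.reg 8)))))
      (.store 16 (.op .sub (.reg 11) (.const 1)) (.cell 5 (.reg 7)))) .skip

/-- Climb from `reg 7` to the root and write the segment for `reg 5` and the pivot `reg 6`. -/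
def segmentProg : Prog :=
  .loop (.op .lt (.cell 0 (.reg 7)) (.reg 0))
    (.seq compareProg (.seq pushProg (.assign 7 (.cell 0 (.reg 7)))))

/-- Compute the pivots and the segments of all vertices. -/
def breaksProg : Prog :=
  .seq (.assign 11 (.const 0)) (.forLoop 5 0 (.seq (.assign 6 (.reg 5)) (.seq pivotProg
    (.seq (.seq (.store 6 (.reg 5) (.reg 6)) (.seq (.store 8 (.reg 5) (.reg 11))
      (.seq (.assign 12 (.reg 2)) (.assign 7 (.reg 6)))))
      (.seq segmentProg (.store 9 (.reg 5) (.reg 11)))))))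

/-- The state of the climb at the vertex `y`. -/
structure Climbing (w n : ℕ) (pr dep dist : ℕ → ℕ) (tab : ℕ → ℕ → ℕ)
    (t x lo d : ℕ) (σ₀ σ : State) : Prop where
  seg : IsSegment w n pr dep dist tab t x lo (σ.reg 11) d (σ.arr 16) (σ.arr 17)
  last : σ.reg 12 = if σ.reg 11 = lo then 2 ^ w - 1 else σ.arr 17 (σ.reg 11 - 1)
  old : ∀ i < lo, σ.arr 16 i = σ₀.arr 16 i ∧ σ.arr 17 i = σ₀.arr 17 i

/-- The vertex `x` is the pivot of `t`. -/
structure IsPivot (n L r : ℕ) (pr dep : ℕ → ℕ) (t x : ℕ) : Prop where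
  lt : x < n
  anc : AncN pr x t
  dep_mod : dep x % L = r ∨ pr x = n
  near : dep t < dep x + L

/-- Any `L` consecutive depths contain one with residue `r`, so the pivot is fewer than `L` levels
up. -/
theorem exists_mod_eq {L r a : ℕ} (hr : r < L) : ∃ d, a ≤ d ∧ d < a + L ∧ d % L = r := by
  have h₁ := Nat.div_add_mod a L
  have h₂ := Nat.mod_lt a (by omega : L > 0)
  by_cases h : a % L ≤ r
  · exact ⟨L * (a / L) + r, by omega, by omega, by
      rw [Nat.mul_add_mod, Nat.mod_eq_of_lt hr]⟩
  · exact ⟨L * (a / L) + L + r, by omega, by omega, by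
      rw [← Nat.mul_succ, Nat.mul_add_mod, Nat.mod_eq_of_lt hr]⟩

namespace Model

variable (hm : Model w n s K Dm pr wts dep dist tab)
include hm

theorem pivotProg_spec {L r : ℕ} {σ : State} (hl : Ready w n s L r pr wts dep dist tab σ)
    (hr : r < L) {t : ℕ} (ht : t < n) (h₆ : σ.reg 6 = t) :
    Wp w pivotProg σ (n * 20 + 20) (fun σ' => IsPivot n L r pr dep t (σ'.reg 6)) := by
  have hb := hm.big
  have hw := hm.one_lt
  have hnn := Nat.le_self_pow two_ne_zero n
  -- Comparing the two truth values again encodes a conjunction: the climb goes on while the residue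
  -- is wrong and a parent exists.
  have hev : ∀ σ₁ : State, Frame pivotProg σ σ₁ → σ₁.reg 6 < n →
      (Expr.op .lt (.op .eq (.op .mod (.cell 5 (.reg 6)) (.reg 3)) (.reg 4))
        (.op .lt (.cell 0 (.reg 6)) (.reg 0))).eval w σ₁ =
        if dep (σ₁.reg 6) % L ≠ r ∧ pr (σ₁.reg 6) < n then 1 else 0 := by
    intro σ₁ hf hlt
    have hl₁ := hl.of_frame hf (by decide) (by decide) (by decide) (by decide)
    have hd := hm.dep_lt _ hlt
    rw [eval_lt _ _ _ hw, eval_eq _ _ _ hw, eval_lt _ _ _ hw, eval_mod _ _ _ (by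
      simp only [Expr.eval, hl₁.dep_eq _ hlt]; omega)]
    simp only [Expr.eval, hl₁.dep_eq _ hlt, hl₁.L_eq, hl₁.r_eq, hl₁.n_eq, hl₁.pr_eq _ hlt.le]
    split_ifs <;> simp_all
  refine Wp.mono (Wp.frame (Wp.loop (c := 3) (T := n * 20 + 20) (fun σ => σ.reg 6 < n ∧
    AncN pr (σ.reg 6) t ∧ ∀ d, dep (σ.reg 6) < d → d ≤ dep t → d % L ≠ r)
    (fun σ => dep (σ.reg 6)) ?_ ?_ ?_)) le_rfl ?_
  · rw [h₆]
    exact ⟨ht, .refl t, fun d h₁ h₂ => by omega⟩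
  · rintro σ₁ hf ⟨hy, hyt, hI⟩ he
    have hf' : Frame pivotProg σ σ₁ := ⟨hf.reg, hf.arr⟩
    rw [hev σ₁ hf' hy] at he
    simp only [ne_eq, ite_eq_right_iff, one_ne_zero, imp_false, not_not] at he
    have hl₁ := hl.of_frame hf' (by decide) (by decide) (by decide) (by decide)
    have hd := hm.dep_succ _ hy he.2
    refine Wp.straight rfl (by decide) ?_
    have hev' : (Expr.cell 0 (.reg 6)).eval w σ₁ = pr (σ₁.reg 6) := hl₁.pr_eq _ hy.le
    simp only [exec, hev', State.setReg, Function.update_self]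
    refine ⟨⟨he.2, hyt.step, fun d h₁ h₂ => ?_⟩, by omega⟩
    rcases Nat.lt_or_ge (dep (σ₁.reg 6)) d with h | h
    · exact hI d h h₂
    · rw [show d = dep (σ₁.reg 6) by omega]
      exact he.1
  · have := hm.dep_lt t ht
    simp only [Expr.cost, h₆]
    omega
  · rintro σ' ⟨⟨⟨hy, hyt, hI⟩, he⟩, hf⟩
    rw [hev σ' ⟨hf.reg, hf.arr⟩ hy] at he
    simp only [ne_eq, ite_eq_right_iff, one_ne_zero, imp_false, not_and, not_lt] at he
    refine ⟨hy, hyt, ?_, ?_⟩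
    · by_contra! h
      exact h.2 (le_antisymm (hm.pr_le _ hy) (he h.1))
    · by_contra! h
      obtain ⟨d, h₁, h₂, h₃⟩ := exists_mod_eq (a := dep (σ'.reg 6) + 1) hr
      exact hI d (by omega) (by omega) h₃

theorem compareProg_spec {L r : ℕ} {σ : State} (hl : Ready w n s L r pr wts dep dist tab σ)
    {t x y : ℕ} (ht : t < n) (hx : x < n) (hy : y < n) (hpy : pr y < n) (hxt : AncN pr x t)
    (hpx : pr x < n) (h₅ : σ.reg 5 = t) (h₆ : σ.reg 6 = x) (h₇ : σ.reg 7 = y) :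
    Wp w compareProg σ 40
      (fun σ' => σ'.reg 8 = tab t y ∧ σ'.reg 14 = via w dist tab t x y) := by
  have hb := hm.big
  have hw := hm.one_lt
  have e0 := hl.n_eq
  have e2 := hl.top_eq
  have h₁ := mul_add_lt_sq ht hy le_rfl
  have h₂ := mul_add_lt_sq hx hy le_rfl
  have h₃ := hl.tab_eq t ht y hy
  have h₄ := hl.tab_eq x hx y hy
  have a4 := hl.dist_eq t ht
  have a4' := hl.dist_eq x hx
  have h₅' := hm.dist_mono ht hxt hx hpx
  have h₆' := hm.dist_lt ht
  have hv := hm.via_le_top ht hx hy hpy hxt hpx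
  refine Wp.straight rfl (by decide) ?_
  by_cases htop : tab x y = 2 ^ w - 1
  · simp (disch := omega) [compareProg, exec, Expr.eval, BinOp.eval, State.setReg, h₅, h₆, h₇, e0,
      e2, Nat.mod_eq_of_lt, h₃, h₄, htop, via]
  · simp only [via, htop, if_false] at hv
    simp (disch := omega) [compareProg, exec, Expr.eval, BinOp.eval, State.setReg, h₅, h₆, h₇, e0,
      e2, Nat.mod_eq_of_lt, h₃, h₄, htop, via, a4, a4', sub_mod']

theorem pushProg_spec {L r : ℕ} {σ₀ σ : State} (hl : Ready w n s L r pr wts dep dist tab σ)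
    {t x y lo d : ℕ} (ht : t < n) (hx : x < n) (hy : y < n) (hxt : AncN pr x t)
    (hyx : AncN pr y x) (hpy : pr y < n) (hpx : pr x < n) (hd : dep y = d + 1)
    (h₇ : σ.reg 7 = y) (h₈ : σ.reg 8 = tab t y) (h₁₄ : σ.reg 14 = via w dist tab t x y)
    (hlo : lo ≤ n ^ 2) (hc : Climbing w n pr dep dist tab t x lo (d + 1) σ₀ σ) :
    Wp w pushProg σ 30 (fun σ' => Climbing w n pr dep dist tab t x lo d σ₀ σ') := by
  have hb := hm.big
  have hw := hm.one_lt
  have hnn := Nat.le_self_pow two_ne_zero n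
  have hv := hm.via_le_top ht hx hy hpy hxt hpx
  have a5 := hl.dep_eq y hy
  have hK := hm.K_le
  have hlen := hm.segment_length_le ht hxt hc.seg
  have hle := hc.seg.le
  refine Wp.straight rfl (by decide) ?_
  by_cases hlt : tab t y < via w dist tab t x y
  · have hbad : BadN w n pr dist tab t x y := ⟨hy, hpy, hyx, hlt⟩
    have hvle : ∀ i, lo ≤ i → i < σ.reg 11 → σ.arr 17 i ≤ tab t y := fun i h₁ h₂ =>
      hm.segment_value_le ht hxt hd hc.seg hbad h₁ h₂
    by_cases heq : tab t y = σ.reg 12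
    · have hne : σ.reg 11 ≠ lo := by
        intro h
        have := hc.last
        rw [if_pos h] at this
        omega
      have hlast := hc.last
      rw [if_neg hne] at hlast
      -- A repeated value: only the depth of its entry is lowered to that of `y`.
      have hσ : exec w pushProg σ = σ.setArr 16 (σ.reg 11 - 1) (d + 1) := by
        simp (disch := omega) [pushProg, exec, Expr.eval, BinOp.eval, Nat.mod_eq_of_lt, h₇,
          h₁₄, hlt, a5, sub_mod', hd, ← heq, h₈]
      rw [hσ]
      refine ⟨?_, ?_, fun i hi => ?_⟩
      · have := hm.segment_add (m := σ.reg 11 - 1)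
          (bd' := Function.update (σ.arr 16) (σ.reg 11 - 1) (d + 1)) (bv' := σ.arr 17)
          hx hd hc.seg hbad (by omega) (by omega)
          (fun i hi => ⟨Function.update_of_ne hi.ne _ _, rfl⟩) (Function.update_self _ _ _)
          (by rw [heq, hlast]) (fun i h₁ h₂ => by
            have := (hc.seg.mono i (σ.reg 11 - 1) h₁ h₂ (by omega)).2
            omega) (fun i h₁ h₂ => by
            rw [show i = σ.reg 11 - 1 by omega, heq, hlast])
        rw [show σ.reg 11 - 1 + 1 = σ.reg 11 by omega] at this
        simpa [State.setArr] using this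
      · simpa [State.setArr] using hc.last
      · have : i ≠ σ.reg 11 - 1 := by omega
        simpa [State.setArr, this] using hc.old i hi
    · have hlast := hc.last
      have hσ : exec w pushProg σ = (((σ.setArr 17 (σ.reg 11) (tab t y)).setReg 11
          (σ.reg 11 + 1)).setReg 12 (tab t y)).setArr 16 (σ.reg 11) (d + 1) := by
        simp (disch := omega) [pushProg, exec, Expr.eval, BinOp.eval, Nat.mod_eq_of_lt, h₇,
          h₁₄, hlt, a5, hd, heq, h₈, State.setReg, State.setArr]
      rw [hσ]
      refine ⟨?_, ?_, fun i hi => ?_⟩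
      · have := hm.segment_add (m := σ.reg 11)
          (bd' := Function.update (σ.arr 16) (σ.reg 11) (d + 1))
          (bv' := Function.update (σ.arr 17) (σ.reg 11) (tab t y))
          hx hd hc.seg hbad (by omega) (by omega)
          (fun i hi => ⟨Function.update_of_ne hi.ne _ _, Function.update_of_ne hi.ne _ _⟩)
          (Function.update_self _ _ _) (Function.update_self _ _ _) (fun i h₁ h₂ => by
            have hle := hvle (σ.reg 11 - 1) (by omega) (by omega)
            rw [if_neg (by omega)] at hlast
            rcases Nat.lt_or_ge i (σ.reg 11 - 1) with h | h
            · have := (hc.seg.mono i (σ.reg 11 - 1) h₁ h (by omega)).2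
              omega
            · rw [show i = σ.reg 11 - 1 by omega]
              omega) (fun i h₁ h₂ => by omega)
        simpa [State.setArr, State.setReg] using this
      · have : σ.reg 11 + 1 ≠ lo := by omega
        simp [State.setArr, State.setReg, this]
      · have : i ≠ σ.reg 11 := by omega
        simpa [State.setArr, State.setReg, this] using hc.old i hi
  · have hσ : exec w pushProg σ = σ := by
      simp [pushProg, exec, Expr.eval, BinOp.eval, h₁₄, hlt, h₈]
    rw [hσ]
    exact ⟨hm.segment_skip hx hy hyx hd hc.seg fun h => hlt h.lt_via, hc.last, hc.old⟩

theorem segmentProg_spec {L r : ℕ} {σ : State} (hl : Ready w n s L r pr wts dep dist tab σ)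
    {t x : ℕ} (ht : t < n) (hx : x < n) (hxt : AncN pr x t)
    (h₅ : σ.reg 5 = t) (h₆ : σ.reg 6 = x) (h₇ : σ.reg 7 = x) (h₁₂ : σ.reg 12 = 2 ^ w - 1)
    (hlo : σ.reg 11 ≤ n ^ 2) :
    Wp w segmentProg σ (n * 90 + 10)
      (fun σ' => Climbing w n pr dep dist tab t x (σ.reg 11) 0 σ σ') := by
  have hb := hm.big
  have hw := hm.one_lt
  refine Wp.mono (Wp.frame (Wp.loop (c := 80) (T := n * 90 + 10) (fun σ' => σ'.reg 7 < n ∧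
    AncN pr (σ'.reg 7) x ∧
    Climbing w n pr dep dist tab t x (σ.reg 11) (dep (σ'.reg 7)) σ σ')
    (fun σ => dep (σ.reg 7)) ?_ ?_ ?_)) le_rfl ?_
  · rw [h₇]
    exact ⟨hx, .refl x, hm.segment_empty hx _ _, by simp [h₁₂], by simp⟩
  · rintro σ₁ hf ⟨hy, hyx, hc⟩ he
    have hf' : Frame segmentProg σ σ₁ := ⟨hf.reg, hf.arr⟩
    have hl₁ := hl.of_frame hf' (by decide) (by decide) (by decide) (by decide)
    have e5 : σ₁.reg 5 = t := by rw [hf'.reg 5 (by decide), h₅]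
    have e6 : σ₁.reg 6 = x := by rw [hf'.reg 6 (by decide), h₆]
    have hpr := hl₁.pr_eq _ hy.le
    rw [eval_lt _ _ _ hw] at he
    simp only [Expr.eval, hpr, hl₁.n_eq, ne_eq, ite_eq_right_iff, one_ne_zero, imp_false,
      not_not] at he
    have hd := hm.dep_succ _ hy he
    have hpx : pr x < n := by
      obtain ⟨k, hk⟩ := hyx
      refine (hm.pr_le x hx).lt_of_ne fun h => ?_
      cases k with
      | zero => rw [← hk] at he; exact he.ne h
      | succ k =>
        rw [Function.iterate_succ_apply, h, hm.iterate_n] at hk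
        omega
    refine Wp.seq (hm.compareProg_spec hl₁ ht hx hy he hxt hpx e5 e6 rfl) (T₂ := 40) ?_ le_rfl
    rintro σ₂ hf₂ ⟨h₈, h₁₄⟩
    have hl₂ := hl₁.of_frame hf₂ (by decide) (by decide) (by decide) (by decide)
    have e7 : σ₂.reg 7 = σ₁.reg 7 := hf₂.reg 7 (by decide)
    refine Wp.seq (hm.pushProg_spec (σ₀ := σ) hl₂ ht hx hy hxt hyx he hpx hd e7 h₈ h₁₄ hlo ?_)
      (T₂ := 10) ?_ le_rfl
    · rw [← hd]
      refine ⟨?_, ?_, fun i hi => ?_⟩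
      · rw [hf₂.reg 11 (by decide), hf₂.arr 16 (by decide), hf₂.arr 17 (by decide)]
        exact hc.seg
      · rw [hf₂.reg 11 (by decide), hf₂.reg 12 (by decide), hf₂.arr 17 (by decide)]
        exact hc.last
      · rw [hf₂.arr 16 (by decide), hf₂.arr 17 (by decide)]
        exact hc.old i hi
    · rintro σ₃ hf₃ hc₃
      have hl₃ := hl₂.of_frame hf₃ (by decide) (by decide) (by decide) (by decide)
      have e7' : σ₃.reg 7 = σ₁.reg 7 := (hf₃.reg 7 (by decide)).trans e7
      have hev : (Expr.cell 0 (.reg 7)).eval w σ₃ = pr (σ₁.reg 7) := by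
        simpa only [Expr.eval, e7'] using hl₃.pr_eq _ hy.le
      refine Wp.straight rfl (by decide) ?_
      simp only [exec, hev]
      refine ⟨?_, ?_⟩
      · simp only [State.setReg, Function.update_self]
        refine ⟨he, hyx.step, ?_⟩
        exact ⟨hc₃.seg, hc₃.last, hc₃.old⟩
      · simp only [State.setReg, Function.update_self]
        omega
  · have := hm.dep_lt x hx
    simp only [Expr.cost, h₇]
    omega
  · rintro σ' ⟨⟨⟨hy, hyx, hc⟩, he⟩, hf⟩
    have hl₁ := hl.of_frame (p := segmentProg) ⟨hf.reg, hf.arr⟩ (by decide) (by decide)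
      (by decide) (by decide)
    have hpr := hl₁.pr_eq _ hy.le
    rw [eval_lt _ _ _ hw] at he
    simp only [Expr.eval, hpr, hl₁.n_eq, ite_eq_right_iff, one_ne_zero, imp_false, not_lt] at he
    rwa [hm.dep_root _ hy (le_antisymm (hm.pr_le _ hy) he)] at hc

theorem breaksProg_spec {L r : ℕ} {σ : State} (hl : Ready w n s L r pr wts dep dist tab σ)
    (hr : r < L) :
    Wp w breaksProg σ (n * (n * 110 + 100) + 20) (fun σ' => σ'.reg 11 ≤ n * K ∧
      ∀ t < n, IsPivot n L r pr dep t (σ'.arr 6 t) ∧ σ'.arr 9 t ≤ σ'.reg 11 ∧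
        IsSegment w n pr dep dist tab t (σ'.arr 6 t) (σ'.arr 8 t) (σ'.arr 9 t) 0
          (σ'.arr 16) (σ'.arr 17)) := by
  have hb := hm.big
  have hw := hm.one_lt
  have hnn := Nat.le_self_pow two_ne_zero n
  have hK := hm.K_le
  refine Wp.seq_straight rfl ?_ (T₁ := n * (n * 110 + 100) + 6)
    (by simp only [Prog.time, Expr.cost]; omega)
  have hl' := hl.of_frame (frame_exec (w := w) (p := .assign 11 (.const 0)) (σ := σ) rfl)
    (by decide) (by decide) (by decide) (by decide)
  refine Wp.forLoop n (fun k σ' => σ'.reg 11 ≤ k * K ∧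
      ∀ t < k, IsPivot n L r pr dep t (σ'.arr 6 t) ∧ σ'.arr 9 t ≤ σ'.reg 11 ∧
        IsSegment w n pr dep dist tab t (σ'.arr 6 t) (σ'.arr 8 t) (σ'.arr 9 t) 0
          (σ'.arr 16) (σ'.arr 17))
    (by decide) (by decide) (by decide) hw (by omega) hl'.n_eq
    (by simp [State.setReg, exec, Expr.eval])
    ?_ (c := n * 110 + 80) (Nat.add_le_add_right (Nat.mul_le_mul_left _ (by omega)) _)
  intro t σ₁ ht hf h5 ⟨hI, hI'⟩
  have hl₁ := hl'.of_frame hf (by decide) (by decide) (by decide) (by decide)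
  have hcur : σ₁.reg 11 ≤ n ^ 2 := by nlinarith
  refine Wp.seq_straight rfl ?_ (T₁ := n * 110 + 60) (by simp only [Prog.time, Expr.cost]; omega)
  have hl₂ := hl₁.of_frame (frame_exec (w := w) (p := .assign 6 (.reg 5)) (σ := σ₁) rfl)
    (by decide) (by decide) (by decide) (by decide)
  refine Wp.seq (hm.pivotProg_spec hl₂ hr ht (by simp [exec, State.setReg, Expr.eval, h5]))
    ?_ (T₂ := n * 90 + 40) (by omega)
  intro σ₃ hf₃ hpiv
  have hl₃ := hl₂.of_frame hf₃ (by decide) (by decide) (by decide) (by decide)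
  have hr₃ : ∀ i, i ≠ 6 → σ₃.reg i = σ₁.reg i := fun i hi => by
    rw [hf₃.reg i (by simpa [pivotProg, Prog.regs] using hi)]
    simp [exec, State.setReg, hi]
  have ha₃ : ∀ a, σ₃.arr a = σ₁.arr a := fun a => by
    rw [hf₃.arr a (by simp [pivotProg, Prog.arrs])]
    simp [exec, State.setReg]
  refine Wp.seq_straight rfl ?_ (T₁ := n * 90 + 20) (by simp only [Prog.time, Expr.cost]; omega)
  have hl₄ := hl₃.of_frame (frame_exec (w := w) (p := .seq (.store 6 (.reg 5) (.reg 6))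
    (.seq (.store 8 (.reg 5) (.reg 11)) (.seq (.assign 12 (.reg 2)) (.assign 7 (.reg 6)))))
    (σ := σ₃) rfl) (by decide) (by decide) (by decide) (by decide)
  refine Wp.seq (hm.segmentProg_spec hl₄ ht hpiv.lt hpiv.anc ?_ ?_ ?_ ?_ ?_)
    ?_ (T₂ := 10) (by omega)
  · simp [exec, State.setReg, State.setArr, hr₃, h5]
  · simp [exec, State.setReg, State.setArr]
  · simp [exec, State.setReg, State.setArr, Expr.eval]
  · simp [exec, State.setReg, State.setArr, Expr.eval, hl₃.top_eq]
  · simpa [exec, State.setReg, State.setArr, hr₃] using hcur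
  intro σ₅ hf₅ hc
  have e11 : (exec w (.seq (.store 6 (.reg 5) (.reg 6))
    (.seq (.store 8 (.reg 5) (.reg 11)) (.seq (.assign 12 (.reg 2)) (.assign 7 (.reg 6))))) σ₃).reg 11
      = σ₁.reg 11 := by simp [exec, State.setReg, State.setArr, hr₃]
  have e5 : σ₅.reg 5 = t := by
    rw [hf₅.reg 5 (by decide)]; simp [exec, State.setReg, State.setArr, hr₃, h5]
  have a6 : σ₅.arr 6 = Function.update (σ₁.arr 6) t (σ₃.reg 6) := by
    rw [hf₅.arr 6 (by decide)]
    simp [exec, State.setReg, State.setArr, Expr.eval, hr₃, ha₃, h5]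
  have a8 : σ₅.arr 8 = Function.update (σ₁.arr 8) t (σ₁.reg 11) := by
    rw [hf₅.arr 8 (by decide)]
    simp [exec, State.setReg, State.setArr, Expr.eval, hr₃, ha₃, h5]
  have a9 : σ₅.arr 9 = σ₁.arr 9 := by
    rw [hf₅.arr 9 (by decide)]
    simp [exec, State.setReg, State.setArr, ha₃]
  rw [e11] at hc
  have hold : ∀ i < σ₁.reg 11, σ₅.arr 16 i = σ₁.arr 16 i ∧ σ₅.arr 17 i = σ₁.arr 17 i := by
    intro i hi
    have := hc.old i hi
    simpa [exec, State.setReg, State.setArr, ha₃] using this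
  have hlen := hm.segment_length_le ht hpiv.anc hc.seg
  have hle := hc.seg.le
  refine Wp.straight rfl (by decide) ?_
  simp only [exec, Expr.eval, e5, State.setReg, State.setArr, a9]
  refine ⟨?_, fun u hu => ?_⟩
  · simp
    rw [Nat.succ_mul]
    omega
  · rcases Nat.lt_succ_iff_lt_or_eq.1 hu with hu | rfl
    · obtain ⟨k₁, k₂, k₃⟩ := hI' u hu
      simp [a6, a8, hu.ne]
      exact ⟨k₁, by omega, k₃.congr (fun i hi => (hold i (by omega)).1)
        (fun i hi => (hold i (by omega)).2)⟩
    · simp [a6, a8]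
      exact ⟨hpiv, hc.seg⟩

end Model

end Model

/-! ### Output of the data structure and assembly of the preprocessing. -/

section Model

variable {w n s K Dm : ℕ} {pr wts dep dist : ℕ → ℕ} {tab : ℕ → ℕ → ℕ}

/-- Append the first `reg ℓ` cells of array `a` to the output, whose length is in `reg 15`. -/
def copySeg (a ℓ : ℕ) : Prog :=
  .forLoop 5 ℓ (.seq (.store 3 (.reg 15) (.cell a (.reg 5)))
    (.assign 15 (.op .add (.reg 15) (.const 1))))

/-- Append several arrays to the output. -/
def copyAll : List (ℕ × ℕ) → Prog
  | [] => .skip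
  | c :: cs => .seq (copySeg c.1 c.2) (copyAll cs)

/-- The first `reg 15` cells of array `3` hold the list `l`. -/
structure Written (σ : State) (l : List ℕ) : Prop where
  length_eq : σ.reg 15 = l.length
  cell_eq : ∀ i < l.length, σ.arr 3 i = l.getD i 0

theorem copySeg_spec {σ : State} {l : List ℕ} {a ℓ N : ℕ} (ha : a ≠ 3) (hℓ : ℓ ≠ 5 ∧ ℓ ≠ 15)
    (hN : σ.reg ℓ = N) (hw : l.length + N + 1 < 2 ^ w) (hσ : Written σ l) :
    Wp w (copySeg a ℓ) σ (N * 20 + 6)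
      (fun σ' => Written σ' (l ++ (List.range N).map (σ.arr a))) := by
  have hw' : 1 < 2 ^ w := by omega
  refine Wp.forLoop N (fun k σ' => Written σ' (l ++ (List.range k).map (σ.arr a)))
    (by simp [Prog.regs]) (by simp [Prog.regs, hℓ.2]) hℓ.1 hw' (by omega) hN
    (by simpa [State.setReg] using ⟨hσ.1, hσ.2⟩) ?_ (c := 12) (by omega)
  intro k σ₁ hk hf h5 ⟨h₁, h₂⟩
  have a3 : σ₁.arr a = σ.arr a :=
    hf.arr a (by simp [Prog.forLoop, Prog.arrs, ha])
  simp only [List.length_append, List.length_map, List.length_range] at h₁ h₂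
  refine Wp.straight rfl (by simp [Prog.time, Expr.cost]) ⟨?_, fun i hi => ?_⟩
  · simp (disch := omega) [exec, Expr.eval, BinOp.eval, State.setReg, State.setArr, h₁,
      Nat.mod_eq_of_lt]
    ring
  · simp only [List.range_succ, List.map_append, List.map_cons, List.map_nil,
      ← List.append_assoc]
    simp only [List.length_append, List.length_map, List.length_range] at hi
    by_cases h : i = l.length + k
    · subst h
      rw [List.getD_append_right _ _ _ _ (by simp)]
      simp (disch := omega) [exec, Expr.eval, State.setReg, State.setArr, h₁, h5, a3]
      rfl
    · rw [List.getD_append _ _ _ _ (by simp; omega), ← h₂ i (by omega)]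
      simp (disch := omega) [exec, Expr.eval, State.setReg, State.setArr, h₁]

/-- The list that `copyAll` appends. -/
def segments (σ : State) (cs : List (ℕ × ℕ)) : List ℕ :=
  cs.flatMap fun c => (List.range (σ.reg c.2)).map (σ.arr c.1)

theorem copyAll_spec (cs : List (ℕ × ℕ)) (hcs : ∀ c ∈ cs, c.1 ≠ 3 ∧ c.2 ≠ 5 ∧ c.2 ≠ 15)
    {σ : State} {l : List ℕ} (hw : l.length + (segments σ cs).length + 1 < 2 ^ w)
    (hσ : Written σ l) :
    Wp w (copyAll cs) σ ((segments σ cs).length * 20 + cs.length * 6 + 1)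
      (fun σ' => Written σ' (l ++ segments σ cs)) := by
  induction cs generalizing σ l with
  | nil => exact Wp.straight rfl (by simp [copyAll, Prog.time]) (by simpa [segments, copyAll, exec])
  | cons c cs ih =>
    have hc := hcs c (by simp)
    have hlen : (segments σ (c :: cs)).length = σ.reg c.2 + (segments σ cs).length := by
      simp [segments]
    rw [hlen] at hw ⊢
    refine Wp.seq (copySeg_spec (a := c.1) hc.1 hc.2 rfl (by omega) hσ)
      (T₂ := (segments σ cs).length * 20 + cs.length * 6 + 1) ?_ (by simp; omega)
    intro σ' hf hσ'
    have hseg : segments σ' cs = segments σ cs := by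
      refine List.flatMap_congr fun d hd => ?_
      have hd' := hcs d (by simp [hd])
      rw [hf.reg d.2 (by simp [copySeg, Prog.forLoop, Prog.regs, hd'.2]),
        hf.arr d.1 (by simp [copySeg, Prog.forLoop, Prog.arrs, hd'.1])]
    have := ih (fun d hd => hcs d (by simp [hd])) (σ := σ')
      (l := l ++ (List.range (σ.reg c.2)).map (σ.arr c.1))
      (by rw [hseg]; simp; omega) hσ'
    rw [hseg] at this
    simpa [segments, List.append_assoc] using this

/-- The arrays of the data structure and the registers with their lengths. -/
def layout : List (ℕ × ℕ) :=
  [(0, 0), (4, 0), (5, 0), (6, 0), (7, 0), (8, 0), (9, 0), (11, 9), (14, 16), (15, 16), (16, 11),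
    (17, 11)]

/-- Write the header of the data structure, and the length of the lists of near ancestors to
register `16`. -/
def headerProg : Prog :=
  .seq (.store 3 (.const 0) (.reg 0)) (.seq (.store 3 (.const 1) (.reg 3))
    (.seq (.store 3 (.const 2) (.reg 9)) (.seq (.store 3 (.const 3) (.reg 11))
      (.seq (.assign 15 (.const 4)) (.assign 16 (.op .mul (.reg 0) (.reg 3)))))))

/-- Write the data structure to the output. -/
def outputProg : Prog :=
  .seq headerProg (.seq (copyAll layout) (.assign 0 (.reg 15)))

/-- The data structure as a list of words. -/
def oracleList (n L R B : ℕ) (par dist dep piv rb lo hi rows nid nval bd bv : ℕ → ℕ) : List ℕ :=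
  [n, L, R, B] ++ ((List.range n).map par ++ ((List.range n).map dist ++ ((List.range n).map dep ++
  ((List.range n).map piv ++ ((List.range n).map rb ++ ((List.range n).map lo ++
  ((List.range n).map hi ++ ((List.range R).map rows ++ ((List.range (n * L)).map nid ++
  ((List.range (n * L)).map nval ++ ((List.range B).map bd ++
  ((List.range B).map bv ++ []))))))))))))

theorem outputProg_spec {σ : State} {L R B : ℕ} (hn : σ.reg 0 = n) (hL : σ.reg 3 = L)
    (hR : σ.reg 9 = R) (hB : σ.reg 11 = B)
    (hw : 1000 + 7 * n + R + 2 * (n * L) + 2 * B < 2 ^ w) :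
    Wp w outputProg σ ((7 * n + R + 2 * (n * L) + 2 * B) * 20 + 200) (fun σ' =>
      σ'.output = oracleList n L R B (σ.arr 0) (σ.arr 4) (σ.arr 5) (σ.arr 6) (σ.arr 7) (σ.arr 8)
        (σ.arr 9) (σ.arr 11) (σ.arr 14) (σ.arr 15) (σ.arr 16) (σ.arr 17)) := by
  refine Wp.seq_straight rfl ?_ (T₁ := (7 * n + R + 2 * (n * L) + 2 * B) * 20 + 150)
    (by simp only [headerProg, Prog.time, Expr.cost]; omega)
  have hreg : ∀ i, i ≠ 15 → i ≠ 16 → (exec w headerProg σ).reg i = σ.reg i := fun i h₁ h₂ => by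
    simp [headerProg, exec, State.setReg, State.setArr, h₁, h₂]
  have h16 : (exec w headerProg σ).reg 16 = n * L := by
    simp (disch := omega) [headerProg, exec, State.setReg, State.setArr, Expr.eval, BinOp.eval, hn,
      hL, Nat.mod_eq_of_lt]
  have harr : ∀ a, a ≠ 3 → (exec w headerProg σ).arr a = σ.arr a := fun a h => by
    simp [headerProg, exec, State.setReg, State.setArr, h]
  have hseg : segments (exec w headerProg σ) layout = (oracleList n L R B (σ.arr 0) (σ.arr 4)
      (σ.arr 5) (σ.arr 6) (σ.arr 7) (σ.arr 8) (σ.arr 9) (σ.arr 11) (σ.arr 14) (σ.arr 15) (σ.arr 16)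
      (σ.arr 17)).drop 4 := by
    simp [segments, layout, oracleList, h16, hreg, harr, hn, hR, hB]
  have hlen : (segments (exec w headerProg σ) layout).length =
      7 * n + R + 2 * (n * L) + 2 * B := by
    rw [hseg]
    simp [oracleList]
    ring
  have hwr : Written (exec w headerProg σ) [n, L, R, B] := by
    constructor
    · simp (disch := omega) [headerProg, exec, State.setReg, State.setArr, Expr.eval,
        Nat.mod_eq_of_lt]
    · intro i hi
      simp only [List.length_cons, List.length_nil] at hi
      interval_cases i <;> simp (disch := omega) [headerProg, exec, State.setReg, State.setArr,
        Expr.eval, Nat.mod_eq_of_lt, hn, hL, hR, hB]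
  refine Wp.seq (copyAll_spec layout (by simp [layout]) (by rw [hlen]; simp; omega) hwr)
    (T₂ := 10) ?_ (by rw [hlen]; simp [layout])
  rintro σ' hf ⟨h₁, h₂⟩
  refine Wp.straight rfl (by decide) ?_
  rw [hseg] at h₁ h₂
  have hD : [n, L, R, B] ++ (oracleList n L R B (σ.arr 0) (σ.arr 4)
      (σ.arr 5) (σ.arr 6) (σ.arr 7) (σ.arr 8) (σ.arr 9) (σ.arr 11) (σ.arr 14) (σ.arr 15) (σ.arr 16)
      (σ.arr 17)).drop 4 = oracleList n L R B (σ.arr 0) (σ.arr 4)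
      (σ.arr 5) (σ.arr 6) (σ.arr 7) (σ.arr 8) (σ.arr 9) (σ.arr 11) (σ.arr 14) (σ.arr 15) (σ.arr 16)
      (σ.arr 17) := by simp [oracleList]
  rw [hD] at h₁ h₂
  refine List.ext_getElem (by simp [State.output, exec, State.setReg, Expr.eval, h₁]) ?_
  intro i hi hi'
  rw [List.getElem_eq_getD 0 (h := hi'), ← h₂ i hi']
  simp [State.output, exec, State.setReg]

/-- The preprocessing program. -/
def buildProg : Prog :=
  .seq initProg (.seq depthProg (.seq sqrtProg (.seq countProg (.seq residueProg (.seq rowsProg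
    (.seq nearProg (.seq breaksProg outputProg)))))))

/-- The list `D` is a data structure for the model. -/
structure IsOracle (w n K L r R B : ℕ) (pr dep dist : ℕ → ℕ) (tab : ℕ → ℕ → ℕ)
    (par dist' dep' piv rb lo hi rows nid nval bd bv : ℕ → ℕ) : Prop where
  L_le : L ≤ n
  L_sq : (L - 1) * (L - 1) < n
  le_sq : n ≤ L * L
  R_eq : R = n * residueCount n L dep r
  count_le : residueCount n L dep r * L ≤ n
  B_le : B ≤ n * K
  par_eq : ∀ t < n, par t = pr t
  dist_eq : ∀ t < n, dist' t = dist t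
  dep_eq : ∀ t < n, dep' t = dep t
  row : ∀ v < n, dep v % L = r → rb v + n ≤ R ∧ ∀ i < n, rows (rb v + i) = tab v i
  near : ∀ t < n, ∀ j < L, nid (t * L + j) = pr^[j] t ∧
    (pr^[j] t < n → nval (t * L + j) = tab t (pr^[j] t))
  seg : ∀ t < n, IsPivot n L r pr dep t (piv t) ∧ hi t ≤ B ∧
    IsSegment w n pr dep dist tab t (piv t) (lo t) (hi t) 0 bd bv

theorem Model.buildProg_spec (hm : Model w n s K Dm pr wts dep dist tab) {σ : State}
    (h₀ : σ.reg 0 = n) (h₁ : σ.reg 1 = s) (hpr : ∀ v < n, σ.arr 0 v = pr v)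
    (hwts : ∀ v < n, pr v < n → σ.arr 1 v = wts v)
    (htab : ∀ t < n, ∀ v < n, σ.arr 2 (t * n + v) = tab t v) (h₁₃ : ∀ i, σ.arr 13 i = 0) :
    Wp w buildProg σ (2000 * n ^ 2) (fun σ' =>
      ∃ (L r R B : ℕ) (par dist' dep' piv rb lo hi rows nid nval bd bv : ℕ → ℕ),
        IsOracle w n K L r R B pr dep dist tab par dist' dep' piv rb lo hi rows nid nval bd bv ∧
        σ'.output = oracleList n L R B par dist' dep' piv rb lo hi rows nid nval bd bv) := by
  have hb := hm.big
  have hw := hm.one_lt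
  have hs := hm.s_lt
  have hK := hm.K_le
  have hnn : n ≤ n ^ 2 := Nat.le_self_pow two_ne_zero n
  have e20 : n * (n * 20 + 60) = 20 * n ^ 2 + 60 * n := by ring
  have e30 : n * (n * 30 + 60) = 30 * n ^ 2 + 60 * n := by ring
  have e40 : n * (n * 40 + 60) = 40 * n ^ 2 + 60 * n := by ring
  have e110 : n * (n * 110 + 100) = 110 * n ^ 2 + 100 * n := by ring
  refine Wp.seq_straight rfl ?_ (T₁ := 1990 * n ^ 2)
    (by simp only [initProg, Prog.time, Expr.cost]; omega)
  have hl₁ : Loaded w n s pr wts tab (exec w initProg σ) := by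
    refine ⟨?_, ?_, ?_, fun v hv => ?_, fun v hv hv' => ?_, fun t ht v hv => ?_⟩
    · simpa [initProg, exec, State.setReg, State.setArr] using h₀
    · simpa [initProg, exec, State.setReg, State.setArr] using h₁
    · simp only [initProg, exec, State.setReg, State.setArr, Function.update_self, eval_top _ hw]
    · rcases hv.lt_or_eq with hv | rfl
      · simp [initProg, exec, State.setReg, State.setArr, Expr.eval, h₀, hv.ne, hpr v hv]
      · simp [initProg, exec, State.setReg, State.setArr, Expr.eval, h₀, hm.pr_n]
    · simpa [initProg, exec, State.setReg, State.setArr] using hwts v hv hv'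
    · simpa [initProg, exec, State.setReg, State.setArr] using htab t ht v hv
  have h₁₃' : ∀ i, (exec w initProg σ).arr 13 i = 0 := fun i => by
    simpa [initProg, exec, State.setReg, State.setArr] using h₁₃ i
  refine Wp.seq (hm.depthProg_spec hl₁) (T₂ := 1900 * n ^ 2) ?_ (by omega)
  intro σ₂ hf₂ hd
  have hl₂ := hl₁.of_frame hf₂ (by decide) (by decide)
  refine Wp.seq (hm.sqrtProg_spec hl₂.n_eq) (T₂ := 1860 * n ^ 2) ?_ (by omega)
  rintro σ₃ hf₃ ⟨hL₁, hL₂, hL₃, hL₄⟩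
  have hl₃ := hl₂.of_frame hf₃ (by decide) (by decide)
  have hd₃ : ∀ t < n, σ₃.arr 4 t = dist t ∧ σ₃.arr 5 t = dep t := by
    rw [hf₃.arr 4 (by decide), hf₃.arr 5 (by decide)]; exact hd
  refine Wp.seq (hm.countProg_spec hl₃.n_eq rfl (fun t ht => (hd₃ t ht).2) ?_)
    (T₂ := 1820 * n ^ 2) ?_ (by omega)
  · rw [hf₃.arr 13 (by decide), hf₂.arr 13 (by decide)]; exact h₁₃'
  intro σ₄ hf₄ hcnt
  have hl₄ := hl₃.of_frame hf₄ (by decide) (by decide)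
  have e3 : σ₄.reg 3 = σ₃.reg 3 := hf₄.reg 3 (by decide)
  refine Wp.seq (hm.residueProg_spec hl₄.n_eq e3 hL₁ hL₂ hcnt) (T₂ := 1780 * n ^ 2) ?_ (by omega)
  rintro σ₅ hf₅ ⟨hr, hr'⟩
  have hl₅ : Ready w n s (σ₃.reg 3) (σ₅.reg 4) pr wts dep dist tab σ₅ := by
    refine ⟨hl₄.of_frame hf₅ (by decide) (by decide), ?_, rfl, fun t ht => ?_, fun t ht => ?_⟩
    · rw [hf₅.reg 3 (by decide), e3]
    · rw [hf₅.arr 4 (by decide), hf₄.arr 4 (by decide), (hd₃ t ht).1]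
    · rw [hf₅.arr 5 (by decide), hf₄.arr 5 (by decide), (hd₃ t ht).2]
  generalize σ₅.reg 4 = r at hl₅ hr hr'
  generalize σ₃.reg 3 = L at *
  refine Wp.seq (hm.rowsProg_spec hl₅) (T₂ := 1660 * n ^ 2) ?_ (by omega)
  rintro σ₆ hf₆ ⟨hR, hrows⟩
  have hl₆ := hl₅.of_frame hf₆ (by decide) (by decide) (by decide) (by decide)
  refine Wp.seq (hm.nearProg_spec hl₆ hL₂) (T₂ := 1540 * n ^ 2) ?_ (by omega)
  rintro σ₇ hf₇ hnear
  have hl₇ := hl₆.of_frame hf₇ (by decide) (by decide) (by decide) (by decide)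
  refine Wp.seq (hm.breaksProg_spec hl₇ hr) (T₂ := 1200 * n ^ 2) ?_ (by omega)
  rintro σ₈ hf₈ ⟨hB, hseg⟩
  have hl₈ := hl₇.of_frame hf₈ (by decide) (by decide) (by decide) (by decide)
  have hR' : σ₈.reg 9 = n * residueCount n L dep r := by
    rw [hf₈.reg 9 (by decide), hf₇.reg 9 (by decide), hR]
  have hcle := residueCount_le n L dep r
  have hR'' : n * residueCount n L dep r ≤ n ^ 2 := by rw [sq]; exact Nat.mul_le_mul_left _ hcle
  have hL'' : n * L ≤ n ^ 2 := by rw [sq]; exact Nat.mul_le_mul_left _ hL₂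
  have hB'' : n * K ≤ n ^ 2 := by rw [sq]; exact Nat.mul_le_mul_left _ hK
  refine (outputProg_spec hl₈.n_eq hl₈.L_eq hR' rfl (by omega)).mono (by omega) ?_
  intro σ₉ hout
  refine ⟨L, r, _, _, _, _, _, _, _, _, _, _, _, _, _, _, ⟨hL₂, hL₄, hL₃, rfl, hr', hB,
    fun t ht => hl₈.pr_eq t ht.le, hl₈.dist_eq, hl₈.dep_eq, ?_, ?_, hseg⟩, hout⟩
  · rw [hf₈.arr 7 (by decide), hf₇.arr 7 (by decide), hf₈.arr 11 (by decide),
      hf₇.arr 11 (by decide), ← hR]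
    exact hrows
  · rw [hf₈.arr 14 (by decide), hf₈.arr 15 (by decide)]
    exact hnear

end Model

/-! ### The query programs -/

section Query

variable {w n s K Dm : ℕ} {pr wts dep dist : ℕ → ℕ} {tab : ℕ → ℕ → ℕ}

theorem getD_map_range_append_add (m i : ℕ) (f : ℕ → ℕ) (l : List ℕ) :
    ((List.range m).map f ++ l).getD (m + i) 0 = l.getD i 0 := by
  rw [List.getD_append_right _ _ _ _ (by simp)]
  simp

theorem getD_map_range_append {m i : ℕ} (f : ℕ → ℕ) (l : List ℕ) (h : i < m) :
    ((List.range m).map f ++ l).getD i 0 = f i := by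
  rw [List.getD_append _ _ _ _ (by simpa)]
  simp [h]

/-- The cells `D` hold the parts of the data structure. -/
structure IsStored (n L R B : ℕ) (par dist dep piv rb lo hi rows nid nval bd bv : ℕ → ℕ)
    (D : ℕ → ℕ) : Prop where
  n_eq : D 0 = n
  L_eq : D 1 = L
  R_eq : D 2 = R
  B_eq : D 3 = B
  par_eq : ∀ t < n, D (0 * n + (t + 4)) = par t
  dist_eq : ∀ t < n, D (1 * n + (t + 4)) = dist t
  dep_eq : ∀ t < n, D (2 * n + (t + 4)) = dep t
  piv_eq : ∀ t < n, D (3 * n + (t + 4)) = piv t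
  rb_eq : ∀ t < n, D (4 * n + (t + 4)) = rb t
  lo_eq : ∀ t < n, D (5 * n + (t + 4)) = lo t
  hi_eq : ∀ t < n, D (6 * n + (t + 4)) = hi t
  rows_eq : ∀ i < R, D (4 + 7 * n + i) = rows i
  nid_eq : ∀ i < n * L, D (4 + 7 * n + R + i) = nid i
  nval_eq : ∀ i < n * L, D (4 + 7 * n + R + n * L + i) = nval i
  bd_eq : ∀ i < B, D (4 + 7 * n + R + n * L + n * L + i) = bd i
  bv_eq : ∀ i < B, D (4 + 7 * n + R + n * L + n * L + B + i) = bv i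

theorem isStored_oracleList (n L R B : ℕ)
    (par dist dep piv rb lo hi rows nid nval bd bv : ℕ → ℕ) :
    IsStored n L R B par dist dep piv rb lo hi rows nid nval bd bv
      (cells (oracleList n L R B par dist dep piv rb lo hi rows nid nval bd bv)) := by
  have h4 : ∀ (i : ℕ) (l : List ℕ), ([n, L, R, B] ++ l).getD (4 + i) 0 = l.getD i 0 := fun i l => by
    rw [List.getD_append_right _ _ _ _ (by simp)]
    simp
  refine ⟨rfl, rfl, rfl, rfl, fun t ht => ?_, fun t ht => ?_, fun t ht => ?_, fun t ht => ?_,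
    fun t ht => ?_, fun t ht => ?_, fun t ht => ?_, fun t ht => ?_, fun t ht => ?_,
    fun t ht => ?_, fun t ht => ?_, fun t ht => ?_⟩ <;> unfold cells oracleList
  · rw [show 0 * n + (t + 4) = 4 + t by ring]
    simp only [h4, getD_map_range_append _ _ ht]
  · rw [show 1 * n + (t + 4) = 4 + (n + t) by ring]
    simp only [h4, getD_map_range_append_add, getD_map_range_append _ _ ht]
  · rw [show 2 * n + (t + 4) = 4 + (n + (n + t)) by ring]
    simp only [h4, getD_map_range_append_add, getD_map_range_append _ _ ht]
  · rw [show 3 * n + (t + 4) = 4 + (n + (n + (n + t))) by ring]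
    simp only [h4, getD_map_range_append_add, getD_map_range_append _ _ ht]
  · rw [show 4 * n + (t + 4) = 4 + (n + (n + (n + (n + t)))) by ring]
    simp only [h4, getD_map_range_append_add, getD_map_range_append _ _ ht]
  · rw [show 5 * n + (t + 4) = 4 + (n + (n + (n + (n + (n + t))))) by ring]
    simp only [h4, getD_map_range_append_add, getD_map_range_append _ _ ht]
  · rw [show 6 * n + (t + 4) = 4 + (n + (n + (n + (n + (n + (n + t)))))) by ring]
    simp only [h4, getD_map_range_append_add, getD_map_range_append _ _ ht]
  · rw [show 4 + 7 * n + t = 4 + (n + (n + (n + (n + (n + (n + (n + t))))))) by ring]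
    simp only [h4, getD_map_range_append_add, getD_map_range_append _ _ ht]
  · rw [show 4 + 7 * n + R + t = 4 + (n + (n + (n + (n + (n + (n + (n + (R + t)))))))) by ring]
    simp only [h4, getD_map_range_append_add, getD_map_range_append _ _ ht]
  · rw [show 4 + 7 * n + R + n * L + t =
      4 + (n + (n + (n + (n + (n + (n + (n + (R + (n * L + t))))))))) by ring]
    simp only [h4, getD_map_range_append_add, getD_map_range_append _ _ ht]
  · rw [show 4 + 7 * n + R + n * L + n * L + t =
      4 + (n + (n + (n + (n + (n + (n + (n + (R + (n * L + (n * L + t)))))))))) by ring]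
    simp only [h4, getD_map_range_append_add, getD_map_range_append _ _ ht]
  · rw [show 4 + 7 * n + R + n * L + n * L + B + t =
      4 + (n + (n + (n + (n + (n + (n + (n + (R + (n * L + (n * L + (B + t))))))))))) by ring]
    simp only [h4, getD_map_range_append_add, getD_map_range_append _ _ ht]

/-- Entry `reg x` of the `k`-th array of the data structure. -/
def field (k x : ℕ) : Expr :=
  .cell 0 (.op .add (.op .mul (.const k) (.reg 10)) (.op .add (.reg x) (.const 4)))

/-- Compute the positions of the parts of the data structure. -/
def setupProg : Prog :=
  .seq (.assign 10 (.cell 0 (.const 0))) (.seq (.assign 11 (.cell 0 (.const 1)))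
    (.seq (.assign 12 (.op .add (.const 4) (.op .mul (.const 7) (.reg 10))))
      (.seq (.assign 13 (.op .add (.reg 12) (.cell 0 (.const 2))))
        (.seq (.assign 14 (.op .add (.reg 13) (.op .mul (.reg 10) (.reg 11))))
          (.seq (.assign 15 (.op .add (.reg 14) (.op .mul (.reg 10) (.reg 11))))
            (.seq (.assign 16 (.op .add (.reg 15) (.cell 0 (.const 3))))
              (.assign 9 (.op .sub (.const 0) (.const 1)))))))))

/-- Answer by the list of near ancestors. -/
def nearQuery : Prog :=
  .seq (.assign 7 (.op .add (.op .mul (.reg 0) (.reg 11)) (.op .sub (.reg 5) (.reg 6))))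
    (.ite (.op .eq (.cell 0 (.op .add (.reg 13) (.reg 7))) (.reg 1))
      (.assign 0 (.cell 0 (.op .add (.reg 14) (.reg 7)))) (.assign 0 (.reg 4)))

/-- Binary search for the first entry of the segment whose depth is at most `reg 6`. -/
def searchProg : Prog :=
  .loop (.op .lt (.reg 18) (.reg 20))
    (.seq (.assign 21 (.op .div (.op .add (.reg 18) (.reg 20)) (.const 2)))
      (.ite (.op .lt (.reg 6) (.cell 0 (.op .add (.reg 15) (.reg 21))))
        (.assign 18 (.op .add (.reg 21) (.const 1))) (.assign 20 (.reg 21))))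

/-- Compute the distance via the pivot in `reg 17`, and the ends of the segment. -/
def viaProg : Prog :=
  .seq (.assign 7 (field 3 0)) (.seq
    (.assign 8 (.cell 0 (.op .add (.reg 12) (.op .add (field 4 7) (.reg 1)))))
    (.seq (.ite (.op .eq (.reg 8) (.reg 9)) (.assign 17 (.reg 9))
      (.assign 17 (.op .add (.reg 8) (.op .sub (.reg 4) (field 1 7)))))
      (.seq (.assign 18 (field 5 0)) (.seq (.assign 19 (field 6 0)) (.assign 20 (.reg 19))))))

/-- Answer by the pivot and the segment. -/
def farQuery : Prog :=
  .seq viaProg (.seq searchProg (.ite (.op .lt (.reg 18) (.reg 19))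
    (.ite (.op .lt (.cell 0 (.op .add (.reg 16) (.reg 18))) (.reg 17))
      (.assign 0 (.cell 0 (.op .add (.reg 16) (.reg 18)))) (.assign 0 (.reg 17)))
    (.assign 0 (.reg 17))))

/-- Answer the query for the vertex `reg 0` and the failure `reg 1`, a vertex with a parent. -/
def coreQuery : Prog :=
  .seq (.seq (.assign 4 (field 1 0)) (.seq (.assign 5 (field 2 0)) (.assign 6 (field 2 1))))
    (.ite (.op .lt (.reg 5) (.reg 6)) (.assign 0 (.reg 4))
      (.ite (.op .lt (.op .sub (.reg 5) (.reg 6)) (.reg 11)) nearQuery farQuery))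

/-- The query for an edge failure. -/
def edgeQuery : Prog :=
  .seq setupProg (.ite (.op .eq (field 0 2) (.reg 1)) (.seq (.assign 1 (.reg 2)) coreQuery)
    (.ite (.op .eq (field 0 1) (.reg 2)) coreQuery (.assign 0 (field 1 0))))

/-- The query for a vertex failure. -/
def vertexQuery : Prog :=
  .seq setupProg (.ite (.op .lt (field 0 1) (.reg 10)) coreQuery
    (.ite (field 1 1) (.assign 0 (field 1 0)) (.assign 0 (.reg 9))))

/-- The state of a query after `setupProg`. -/
structure Located (w n L R B : ℕ) (D : ℕ → ℕ) (σ : State) : Prop where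
  D_eq : σ.arr 0 = D
  top_eq : σ.reg 9 = 2 ^ w - 1
  n_eq : σ.reg 10 = n
  L_eq : σ.reg 11 = L
  rows_eq : σ.reg 12 = 4 + 7 * n
  nid_eq : σ.reg 13 = 4 + 7 * n + R
  nval_eq : σ.reg 14 = 4 + 7 * n + R + n * L
  bd_eq : σ.reg 15 = 4 + 7 * n + R + n * L + n * L
  bv_eq : σ.reg 16 = 4 + 7 * n + R + n * L + n * L + B

theorem Located.of_frame {L R B : ℕ} {D : ℕ → ℕ} {p : Prog} {σ σ' : State}
    (h : Located w n L R B D σ) (hf : Frame p σ σ') (h₁ : ∀ x ∈ p.regs, x < 9 ∨ 16 < x)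
    (h₂ : 0 ∉ p.arrs) : Located w n L R B D σ' := by
  have hreg : ∀ x, 9 ≤ x → x ≤ 16 → σ'.reg x = σ.reg x := fun x k₁ k₂ =>
    hf.reg x fun hx => by have := h₁ x hx; omega
  exact ⟨(hf.arr 0 h₂).trans h.1, (hreg 9 (by omega) (by omega)).trans h.2,
    (hreg 10 (by omega) (by omega)).trans h.3, (hreg 11 (by omega) (by omega)).trans h.4,
    (hreg 12 (by omega) (by omega)).trans h.5, (hreg 13 (by omega) (by omega)).trans h.6,
    (hreg 14 (by omega) (by omega)).trans h.7, (hreg 15 (by omega) (by omega)).trans h.8,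
    (hreg 16 (by omega) (by omega)).trans h.9⟩

theorem eval_field {L R B : ℕ} {D : ℕ → ℕ} {σ : State} (h : Located w n L R B D σ) {k x t : ℕ}
    (hx : σ.reg x = t) (hk : k < 7) (ht : t < n) (hw : 100 * n + 100 < 2 ^ w) :
    (field k x).eval w σ = D (k * n + (t + 4)) := by
  have h₁ : k * n ≤ 7 * n := Nat.mul_le_mul_right _ (by omega)
  have h₂ := h.n_eq
  have h₃ := h.D_eq
  simp (disch := omega) [field, Expr.eval, BinOp.eval, hx, h₂, h₃, Nat.mod_eq_of_lt]

theorem setupProg_spec {L R B : ℕ} {D : ℕ → ℕ} {σ : State} (h0 : D 0 = n) (h1 : D 1 = L)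
    (h2 : D 2 = R) (h3 : D 3 = B) (hσ : σ.arr 0 = D)
    (hw : 1000 + 7 * n + R + 2 * (n * L) + 2 * B < 2 ^ w) :
    Located w n L R B D (exec w setupProg σ) := by
  constructor <;>
  simp (disch := omega) [setupProg, exec, Expr.eval, BinOp.eval, State.setReg, hσ, h0, h1, h2, h3,
      Nat.mod_eq_of_lt]

end Query

/-! ### Correctness and running time of the queries. -/

section Query

variable {w n s K Dm : ℕ} {pr wts dep dist : ℕ → ℕ} {tab : ℕ → ℕ → ℕ}

namespace Model

variable (hm : Model w n s K Dm pr wts dep dist tab)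
include hm

theorem anc_of_dep_le {t x v : ℕ} (ht : t < n) (hx : x < n) (hv : v < n) (hxt : AncN pr x t)
    (hvt : AncN pr v t) (hd : dep v ≤ dep x) : AncN pr v x := by
  obtain ⟨k, rfl⟩ := hvt
  obtain ⟨l, rfl⟩ := hxt
  have h₁ := hm.dep_iterate ht hv
  have h₂ := hm.dep_iterate ht hx
  exact ⟨k - l, by rw [← Function.iterate_add_apply, show k - l + l = k by omega]⟩

/-- The distance via the pivot together with the segment determines the table entry. -/
theorem far_correct {t x v lo hi p : ℕ} {bd bv : ℕ → ℕ} (ht : t < n) (hv : v < n)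
    (hpv : pr v < n) (hx : x < n) (hpx : pr x < n) (hxt : AncN pr x t) (hd : dep v ≤ dep x)
    (hseg : IsSegment w n pr dep dist tab t x lo hi 0 bd bv) (hlo : lo ≤ p) (hhi : p ≤ hi)
    (h₁ : ∀ i, lo ≤ i → i < p → dep v < bd i) (h₂ : p < hi → bd p ≤ dep v) :
    (if p < hi then if bv p < via w dist tab t x v then bv p else via w dist tab t x v
      else via w dist tab t x v) = tab t v := by
  have hb := hm.big
  by_cases hvx : AncN pr v x
  · have hle := hm.tab_le_via t ht x v hv hpv hvx hxt
    -- The entry at `p` comes from a bad failure at or above `v`, and its value bounds those of all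
    -- failures down to `x`.
    have hlow : p < hi → tab t v ≤ bv p := fun hp => by
      obtain ⟨y, hy, k₂, k₃, -⟩ := hseg.sound p hlo hp
      rw [← k₃]
      exact hm.tab_le_of_bad t ht x hxt y hy v hv hpv hvx (by have := h₂ hp; omega)
    by_cases hlt : tab t v < via w dist tab t x v
    · obtain ⟨i, k₁, k₂, k₃, k₄⟩ := hseg.complete v ⟨hv, hpv, hvx, hlt⟩ (hm.dep_pos hv hpv)
      -- An entry of value `tab t v` occurs at depth at most `dep v`, hence not before `p`; values
      -- grow along the segment, so the entry at `p` is no larger, and `hlow` gives equality.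
      have hpi : p ≤ i := by
        by_contra h
        have := h₁ i k₁ (by omega)
        omega
      have hbv : bv p ≤ bv i := by
        rcases hpi.lt_or_eq with h | h
        · exact (hseg.mono p i hlo h k₂).2.le
        · rw [h]
      have := hlow (by omega)
      rw [if_pos (by omega), if_pos (by omega)]
      omega
    · split_ifs with h h'
      · have := hlow h
        omega
      · omega
      · omega
  -- No test for ancestry is needed: `v` is above neither `x` nor `t`, so the value via `x` is `dist
  -- t`, and no segment entry is below `dist t`.
  · have hvt : ¬ AncN pr v t := fun h => hvx (hm.anc_of_dep_le ht hx hv hxt h hd)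
    have e₁ := hm.tab_of_not_anc x hx v hv hpv hvx
    have e₂ := hm.tab_of_not_anc t ht v hv hpv hvt
    have e₃ := hm.dist_le x hx hpx
    have e₄ := hm.dist_mono ht hxt hx hpx
    have hvia : via w dist tab t x v = dist t := by
      rw [via, e₁, if_neg (by omega)]
      omega
    rw [hvia, e₂]
    split_ifs with h h'
    · obtain ⟨y, hy, k₂, k₃, -⟩ := hseg.sound p hlo h
      have := hm.dist_le_tab t ht y hy.lt hy.pr_lt
      omega
    · rfl
    · rfl

end Model

variable {L r R B : ℕ} {par dist' dep' piv rb lo hi rows nid nval bd bv D : ℕ → ℕ}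

theorem searchProg_spec {σ : State} {a b d : ℕ} (hloc : Located w n L R B D σ)
    (hbd : ∀ i < B, D (4 + 7 * n + R + n * L + n * L + i) = bd i)
    (hw : 1000 + 7 * n + R + 2 * (n * L) + 2 * B < 2 ^ w) (hab : a ≤ b) (hbB : b ≤ B)
    (hn : b - a ≤ n) (hn0 : n ≠ 0)
    (hmono : ∀ i j, a ≤ i → i < j → j < b → bd j < bd i)
    (h₆ : σ.reg 6 = d) (h₁₈ : σ.reg 18 = a) (h₂₀ : σ.reg 20 = b) :
    Wp w searchProg σ ((Nat.log 2 n + 1) * 60 + 10) (fun σ' => a ≤ σ'.reg 18 ∧ σ'.reg 18 ≤ b ∧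
      (∀ i, a ≤ i → i < σ'.reg 18 → d < bd i) ∧ (σ'.reg 18 < b → bd (σ'.reg 18) ≤ d)) := by
  have hw' : 1 < 2 ^ w := by omega
  -- The length is doubled inside the logarithm so that the variant still drops in the step from
  -- length one to length zero.
  refine Wp.mono (Wp.loop (c := 50) (T := (Nat.log 2 n + 1) * 60 + 10) (fun σ' => a ≤ σ'.reg 18 ∧
    σ'.reg 18 ≤ σ'.reg 20 ∧ σ'.reg 20 ≤ b ∧ (∀ i, a ≤ i → i < σ'.reg 18 → d < bd i) ∧
    (∀ i, σ'.reg 20 ≤ i → i < b → bd i ≤ d)) (fun σ' => Nat.log 2 (2 * (σ'.reg 20 - σ'.reg 18)))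
    ?_ ?_ ?_) le_rfl ?_
  · rw [h₁₈, h₂₀]
    exact ⟨le_rfl, hab, le_rfl, fun i h₁ h₂ => by omega, fun i h₁ h₂ => by omega⟩
  · rintro σ₁ hf ⟨i₁, i₂, i₃, i₄, i₅⟩ he
    have hf' : Frame searchProg σ σ₁ := ⟨hf.reg, hf.arr⟩
    have hloc₁ := hloc.of_frame hf' (by decide) (by decide)
    have e6 : σ₁.reg 6 = d := by rw [hf'.reg 6 (by decide), h₆]
    have e0 := hloc₁.D_eq
    have e15 := hloc₁.bd_eq
    rw [eval_lt _ _ _ hw'] at he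
    have he : σ₁.reg 18 < σ₁.reg 20 := by by_contra h; exact he (if_neg h)
    obtain ⟨m, hm⟩ : ∃ m, m = (σ₁.reg 18 + σ₁.reg 20) / 2 := ⟨_, rfl⟩
    have hbdm := hbd m (by omega)
    have hlog : ∀ q, q ≤ (σ₁.reg 20 - σ₁.reg 18) / 2 →
        Nat.log 2 (2 * q) < Nat.log 2 (2 * (σ₁.reg 20 - σ₁.reg 18)) := by
      intro q hq
      rw [mul_comm 2 (σ₁.reg 20 - σ₁.reg 18), Nat.log_mul_base one_lt_two (by omega)]
      exact Nat.lt_succ_of_le (Nat.log_mono_right (by omega))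
    refine Wp.straight rfl (by decide) ?_
    by_cases hdm : d < bd m
    · have hσ : exec w (.seq (.assign 21 (.op .div (.op .add (.reg 18) (.reg 20)) (.const 2)))
          (.ite (.op .lt (.reg 6) (.cell 0 (.op .add (.reg 15) (.reg 21))))
          (.assign 18 (.op .add (.reg 21) (.const 1))) (.assign 20 (.reg 21)))) σ₁ =
          (σ₁.setReg 21 m).setReg 18 (m + 1) := by
        simp (disch := omega) [exec, Expr.eval, BinOp.eval, State.setReg, ← hm, e6, e0, e15,
          Nat.mod_eq_of_lt, hbdm, hdm]
      rw [hσ]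
      simp only [State.setReg, Function.update_self, ne_eq, Nat.reduceEqDiff, not_false_eq_true,
        Function.update_of_ne]
      refine ⟨⟨by omega, by omega, i₃, fun i k₁ k₂ => ?_, i₅⟩, hlog _ (by omega)⟩
      rcases Nat.lt_succ_iff_lt_or_eq.1 k₂ with k₂ | rfl
      · have := hmono i m k₁ k₂ (by omega)
        omega
      · exact hdm
    · have hσ : exec w (.seq (.assign 21 (.op .div (.op .add (.reg 18) (.reg 20)) (.const 2)))
          (.ite (.op .lt (.reg 6) (.cell 0 (.op .add (.reg 15) (.reg 21))))
          (.assign 18 (.op .add (.reg 21) (.const 1))) (.assign 20 (.reg 21)))) σ₁ =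
          (σ₁.setReg 21 m).setReg 20 m := by
        simp (disch := omega) [exec, Expr.eval, BinOp.eval, State.setReg, ← hm, e6, e0, e15,
          Nat.mod_eq_of_lt, hbdm, hdm]
      rw [hσ]
      simp only [State.setReg, Function.update_self, ne_eq, Nat.reduceEqDiff, not_false_eq_true,
        Function.update_of_ne]
      refine ⟨⟨i₁, by omega, by omega, i₄, fun i k₁ k₂ => ?_⟩, hlog _ (by omega)⟩
      rcases k₁.lt_or_eq with k₁ | rfl
      · have := hmono m i (by omega) k₁ k₂
        omega
      · omega
  · rw [h₁₈, h₂₀]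
    have h₁ : Nat.log 2 (2 * (b - a)) ≤ Nat.log 2 n + 1 := by
      rw [← Nat.log_mul_base one_lt_two hn0, mul_comm]
      exact Nat.log_mono_right (by omega)
    have := Nat.mul_le_mul_right 54 h₁
    simp only [Expr.cost]
    omega
  · rintro σ' ⟨⟨i₁, i₂, i₃, i₄, i₅⟩, he⟩
    rw [eval_lt _ _ _ hw'] at he
    have he : σ'.reg 20 ≤ σ'.reg 18 := by by_contra h; exact absurd (if_pos (not_le.1 h)) (he ▸ zero_ne_one)
    exact ⟨i₁, by omega, i₄, fun h => i₅ _ he h⟩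

/-- What the queries need: the data structure is stored in array `0` and located. -/
structure Prepared (w n s K Dm L r R B : ℕ) (pr wts dep dist : ℕ → ℕ) (tab : ℕ → ℕ → ℕ)
    (par dist' dep' piv rb lo hi rows nid nval bd bv D : ℕ → ℕ) : Prop where
  model : Model w n s K Dm pr wts dep dist tab
  oracle : IsOracle w n K L r R B pr dep dist tab par dist' dep' piv rb lo hi rows nid nval bd bv
  stored : IsStored n L R B par dist' dep' piv rb lo hi rows nid nval bd bv D

namespace Prepared

variable (hp : Prepared w n s K Dm L r R B pr wts dep dist tab
  par dist' dep' piv rb lo hi rows nid nval bd bv D)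
include hp

theorem bound : 1000 + 7 * n + R + 2 * (n * L) + 2 * B < 2 ^ w ∧ 100 * n + 100 < 2 ^ w := by
  have hb := hp.model.big
  have hnn : n ≤ n ^ 2 := Nat.le_self_pow two_ne_zero n
  have hR := hp.oracle.R_eq
  have hB := hp.oracle.B_le
  have h₁ : n * residueCount n L dep r ≤ n ^ 2 := by
    rw [sq]; exact Nat.mul_le_mul_left _ (residueCount_le _ _ _ _)
  have h₂ : n * L ≤ n ^ 2 := by rw [sq]; exact Nat.mul_le_mul_left _ hp.oracle.L_le
  have h₃ : n * K ≤ n ^ 2 := by rw [sq]; exact Nat.mul_le_mul_left _ hp.model.K_le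
  omega

/-- The only candidate for an ancestor at depth `dep v` is the iterated parent of `t` at that level.
If it differs from `v`, then `v` is not an ancestor and the unperturbed distance is the answer. -/
theorem nearQuery_spec {σ : State} (hloc : Located w n L R B D σ) {t v : ℕ} (ht : t < n)
    (hv : v < n) (hpv : pr v < n) (h₀ : σ.reg 0 = t) (h₁ : σ.reg 1 = v) (h₄ : σ.reg 4 = dist t)
    (h₅ : σ.reg 5 = dep t) (h₆ : σ.reg 6 = dep v) (hle : dep v ≤ dep t)
    (hlt : dep t - dep v < L) : (exec w nearQuery σ).reg 0 = tab t v := by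
  have hm := hp.model
  have hb := hm.big
  obtain ⟨hw₁, hw₂⟩ := hp.bound
  have hw := hm.one_lt
  have hdt := hm.dep_lt t ht
  have hi : t * L + (dep t - dep v) < n * L := by nlinarith
  have e₁ := hp.stored.nid_eq _ hi
  have e₂ := hp.stored.nval_eq _ hi
  obtain ⟨e₃, e₄⟩ := hp.oracle.near t ht _ hlt
  rw [e₃] at e₁
  have f₁ := hloc.D_eq
  have f₂ := hloc.L_eq
  have f₃ := hloc.nid_eq
  have f₄ := hloc.nval_eq
  by_cases h : pr^[dep t - dep v] t = v
  · rw [h] at e₁ e₄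
    rw [e₄ hv] at e₂
    simp (disch := omega) [nearQuery, exec, Expr.eval, BinOp.eval, State.setReg, h₀, h₁, h₅, h₆, f₁,
      f₂, f₃, f₄, Nat.mod_eq_of_lt, sub_mod', e₁, e₂]
  · rw [hm.tab_of_not_anc t ht v hv hpv]
    · simp (disch := omega) [nearQuery, exec, Expr.eval, BinOp.eval, State.setReg, h₀, h₁, h₄, h₅,
        h₆, f₁, f₂, f₃, Nat.mod_eq_of_lt, sub_mod', e₁, h]
    · rintro ⟨k, hk⟩
      have := hm.dep_iterate ht (hk ▸ hv : pr^[k] t < n)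
      rw [hk] at this
      exact h (by rw [this, Nat.add_sub_cancel_left, hk])

theorem farQuery_spec {σ : State} (hloc : Located w n L R B D σ) {t v : ℕ} (ht : t < n)
    (hv : v < n) (hpv : pr v < n) (h₀ : σ.reg 0 = t) (h₁ : σ.reg 1 = v) (h₄ : σ.reg 4 = dist t)
    (h₆ : σ.reg 6 = dep v) (hge : dep v + L ≤ dep t) :
    Wp w farQuery σ ((Nat.log 2 n + 1) * 60 + 200) (fun σ' => σ'.reg 0 = tab t v) := by
  have hm := hp.model
  have hb := hm.big
  obtain ⟨hw₁, hw₂⟩ := hp.bound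
  have hw := hm.one_lt
  obtain ⟨hpiv, hhi, hseg⟩ := hp.oracle.seg t ht
  obtain ⟨x, hx⟩ : ∃ x, x = piv t := ⟨_, rfl⟩
  rw [← hx] at hpiv hseg
  -- The pivot is fewer than `L` levels above `t`, the failure at least `L`.
  have hdx : dep v ≤ dep x := by have := hpiv.near; omega
  -- `v` has positive depth, so the pivot is not a root. It was therefore chosen for its residue and
  -- its row is stored.
  have hpx : pr x < n := by
    refine (hm.pr_le x hpiv.lt).lt_of_ne fun h => ?_
    have := hm.dep_root x hpiv.lt h
    have := hm.dep_pos hv hpv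
    omega
  obtain ⟨hrb, hrow⟩ := hp.oracle.row x hpiv.lt (hpiv.dep_mod.resolve_right hpx.ne)
  have e₁ := hp.stored.rows_eq (rb x + v) (by omega)
  rw [hrow v hv] at e₁
  have hvia := hm.via_le_top ht hpiv.lt hv hpv hpiv.anc hpx
  have hdm := hm.dist_mono ht hpiv.anc hpiv.lt hpx
  have hdt := hm.dist_lt ht
  have hxlt := hpiv.lt
  obtain ⟨σ₂, hσ₂⟩ : ∃ σ₂, σ₂ = exec w viaProg σ := ⟨_, rfl⟩
  have hf₂ : Frame viaProg σ σ₂ := hσ₂ ▸ frame_exec rfl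
  have hloc₂ := hloc.of_frame hf₂ (by decide) (by decide)
  have D1 := hp.stored.dist_eq x hpiv.lt
  rw [hp.oracle.dist_eq x hpiv.lt] at D1
  have D3 := hp.stored.piv_eq t ht
  rw [← hx] at D3
  have D4 := hp.stored.rb_eq x hpiv.lt
  have D5 := hp.stored.lo_eq t ht
  have D6 := hp.stored.hi_eq t ht
  have f₁ := hloc.D_eq
  have f₂ := hloc.n_eq
  have f₃ := hloc.rows_eq
  have f₄ := hloc.top_eq
  have hregs : σ₂.reg 17 = via w dist tab t x v ∧ σ₂.reg 18 = lo t ∧ σ₂.reg 19 = hi t ∧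
      σ₂.reg 20 = hi t := by
    simp only [one_mul] at D1
    rw [hσ₂]
    by_cases htop : tab x v = 2 ^ w - 1
    · simp (disch := omega) [viaProg, field, exec, Expr.eval, BinOp.eval, State.setReg, h₀, h₁, f₁,
        f₂, f₃, f₄, Nat.mod_eq_of_lt, D3, D4, D5, D6, e₁, htop, via]
    · simp only [via, htop, if_false] at hvia
      simp (disch := omega) [viaProg, field, exec, Expr.eval, BinOp.eval, State.setReg, h₀, h₁, h₄,
        f₁, f₂, f₃, f₄, Nat.mod_eq_of_lt, D1, D3, D4, D5, D6, e₁, htop, via, sub_mod']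
  have hlen := hm.segment_length_le ht hpiv.anc hseg
  have hK := hm.K_le
  refine Wp.seq_straight rfl ?_ (T₁ := (Nat.log 2 n + 1) * 60 + 100)
    (by simp only [viaProg, field, Prog.time, Expr.cost]; omega)
  rw [← hσ₂]
  refine Wp.seq (searchProg_spec (d := dep v) hloc₂ hp.stored.bd_eq hw₁ hseg.le hhi (by omega) (by omega)
    (fun i j k₁ k₂ k₃ => (hseg.mono i j k₁ k₂ k₃).1) ?_ hregs.2.1 hregs.2.2.2) (T₂ := 60) ?_
    (by omega)
  · rw [hf₂.reg 6 (by decide), h₆]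
  rintro σ₃ hf₃ ⟨i₁, i₂, i₃, i₄⟩
  have hloc₃ := hloc₂.of_frame hf₃ (by decide) (by decide)
  have e17 : σ₃.reg 17 = via w dist tab t x v := (hf₃.reg 17 (by decide)).trans hregs.1
  have e19 : σ₃.reg 19 = hi t := (hf₃.reg 19 (by decide)).trans hregs.2.2.1
  have key := hm.far_correct ht hv hpv hpiv.lt hpx hpiv.anc hdx hseg i₁ i₂ i₃ i₄
  have g₁ := hloc₃.D_eq
  have g₂ := hloc₃.bv_eq
  refine Wp.straight rfl (by decide) ?_
  by_cases hlt : σ₃.reg 18 < hi t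
  · have hbv := hp.stored.bv_eq (σ₃.reg 18) (by omega)
    rw [if_pos hlt] at key
    by_cases hlt' : bv (σ₃.reg 18) < via w dist tab t x v
    · rw [if_pos hlt'] at key
      rw [key] at hlt' hbv
      simp (disch := omega) [exec, Expr.eval, BinOp.eval, State.setReg, e17, e19, hlt, g₁, g₂, hbv,
        Nat.mod_eq_of_lt, hlt']
    · rw [if_neg hlt'] at key
      rw [key] at hlt'
      simp (disch := omega) [exec, Expr.eval, BinOp.eval, State.setReg, e17, e19, hlt, g₁, g₂, hbv,
        Nat.mod_eq_of_lt, hlt', key]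
  · rw [if_neg hlt] at key
    simp [exec, Expr.eval, BinOp.eval, State.setReg, e17, e19, hlt, key]

theorem coreQuery_spec {σ : State} (hloc : Located w n L R B D σ) {t v : ℕ} (ht : t < n)
    (hv : v < n) (hpv : pr v < n) (h₀ : σ.reg 0 = t) (h₁ : σ.reg 1 = v) :
    Wp w coreQuery σ ((Nat.log 2 n + 1) * 60 + 300) (fun σ' => σ'.reg 0 = tab t v) := by
  have hm := hp.model
  have hb := hm.big
  obtain ⟨hw₁, hw₂⟩ := hp.bound
  have hw := hm.one_lt
  have D1 := hp.stored.dist_eq t ht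
  have D2 := hp.stored.dep_eq t ht
  have D2' := hp.stored.dep_eq v hv
  rw [hp.oracle.dist_eq t ht] at D1
  rw [hp.oracle.dep_eq t ht] at D2
  rw [hp.oracle.dep_eq v hv] at D2'
  simp only [one_mul] at D1
  have f₁ := hloc.D_eq
  have f₂ := hloc.n_eq
  obtain ⟨σ₂, hσ₂⟩ : ∃ σ₂, σ₂ = exec w (.seq (.assign 4 (field 1 0))
    (.seq (.assign 5 (field 2 0)) (.assign 6 (field 2 1)))) σ := ⟨_, rfl⟩
  have hf₂ := hσ₂ ▸ frame_exec (w := w) (σ := σ) (p := (.seq (.assign 4 (field 1 0))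
    (.seq (.assign 5 (field 2 0)) (.assign 6 (field 2 1))))) rfl
  have hregs : σ₂.reg 4 = dist t ∧ σ₂.reg 5 = dep t ∧ σ₂.reg 6 = dep v := by
    rw [hσ₂]
    simp (disch := omega) [field, exec, Expr.eval, BinOp.eval, State.setReg, h₀, h₁, f₁, f₂,
      Nat.mod_eq_of_lt, D1, D2, D2']
  obtain ⟨e4, e5, e6⟩ := hregs
  have hloc₂ := hloc.of_frame hf₂ (by decide) (by decide)
  have e0 : σ₂.reg 0 = t := by rw [hf₂.reg 0 (by decide), h₀]
  have e1 : σ₂.reg 1 = v := by rw [hf₂.reg 1 (by decide), h₁]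
  have hdt := hm.dep_lt t ht
  refine Wp.seq_straight rfl ?_ (T₁ := (Nat.log 2 n + 1) * 60 + 250)
    (by simp only [field, Prog.time, Expr.cost]; omega)
  rw [← hσ₂]
  refine Wp.ite (T' := (Nat.log 2 n + 1) * 60 + 240) (fun he => ?_) (fun he => ?_)
    (by simp only [Expr.cost]; omega)
  · rw [eval_lt _ _ _ hw] at he
    simp only [Expr.eval, e5, e6, ne_eq, ite_eq_right_iff, one_ne_zero, imp_false, not_not] at he
    refine Wp.straight rfl (by simp only [Prog.time, Expr.cost]; omega) ?_
    rw [hm.tab_of_not_anc t ht v hv hpv fun h => by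
      have := hm.dep_le_of_anc ht hv h
      omega]
    simp [exec, State.setReg, Expr.eval, e4]
  · rw [eval_lt _ _ _ hw] at he
    simp only [Expr.eval, e5, e6, ite_eq_right_iff, one_ne_zero, imp_false, not_lt] at he
    have hev : (Expr.op .lt (.op .sub (.reg 5) (.reg 6)) (.reg 11)).eval w σ₂ =
        if dep t - dep v < L then 1 else 0 := by
      rw [eval_lt _ _ _ hw, eval_sub _ _ _ (by simpa [Expr.eval, e5, e6])
        (by simp only [Expr.eval, e5]; omega)]
      simp only [Expr.eval, e5, e6, hloc₂.L_eq]
    refine Wp.ite (T' := (Nat.log 2 n + 1) * 60 + 200) (fun he' => ?_) (fun he' => ?_)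
      (by simp only [Expr.cost]; omega)
    · rw [hev] at he'
      simp only [ne_eq, ite_eq_right_iff, one_ne_zero, imp_false, not_not] at he'
      refine Wp.straight rfl ?_ (hp.nearQuery_spec hloc₂ ht hv hpv e0 e1 e4 e5 e6 he he')
      simp only [nearQuery, Prog.time, Expr.cost]
      omega
    · rw [hev] at he'
      simp only [ite_eq_right_iff, one_ne_zero, imp_false, not_lt] at he'
      exact hp.farQuery_spec hloc₂ ht hv hpv e0 e1 e4 e6 (by omega)

theorem setup {σ : State} (hσ : σ.arr 0 = D) : Located w n L R B D (exec w setupProg σ) :=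
  setupProg_spec hp.stored.n_eq hp.stored.L_eq hp.stored.R_eq hp.stored.B_eq hσ hp.bound.1

theorem eval_par {σ : State} (hloc : Located w n L R B D σ) {x t : ℕ} (hx : σ.reg x = t)
    (ht : t < n) : (field 0 x).eval w σ = pr t := by
  rw [eval_field hloc hx (by omega) ht hp.bound.2, hp.stored.par_eq t ht, hp.oracle.par_eq t ht]

theorem eval_dist {σ : State} (hloc : Located w n L R B D σ) {x t : ℕ} (hx : σ.reg x = t)
    (ht : t < n) : (field 1 x).eval w σ = dist t := by
  rw [eval_field hloc hx (by omega) ht hp.bound.2, hp.stored.dist_eq t ht,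
    hp.oracle.dist_eq t ht]

theorem edgeQuery_spec {σ : State} (hσ : σ.arr 0 = D) {t u v : ℕ} (ht : t < n) (hu : u < n)
    (hv : v < n) (h₀ : σ.reg 0 = t) (h₁ : σ.reg 1 = u) (h₂ : σ.reg 2 = v) :
    Wp w edgeQuery σ ((Nat.log 2 n + 1) * 60 + 500) (fun σ' => σ'.reg 0 =
      if pr v = u then tab t v else if pr u = v then tab t u else dist t) := by
  have hw := hp.model.one_lt
  have hloc := hp.setup hσ
  have hf : Frame setupProg σ (exec w setupProg σ) := frame_exec rfl
  have e0 : (exec w setupProg σ).reg 0 = t := by rw [hf.reg 0 (by decide), h₀]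
  have e1 : (exec w setupProg σ).reg 1 = u := by rw [hf.reg 1 (by decide), h₁]
  have e2 : (exec w setupProg σ).reg 2 = v := by rw [hf.reg 2 (by decide), h₂]
  refine Wp.seq_straight rfl ?_ (T₁ := (Nat.log 2 n + 1) * 60 + 400)
    (by simp only [setupProg, Prog.time, Expr.cost]; omega)
  generalize exec w setupProg σ = σ₁ at *
  have k₁ : (Expr.op .eq (field 0 2) (.reg 1)).eval w σ₁ = if pr v = u then 1 else 0 := by
    rw [eval_eq _ _ _ hw, hp.eval_par hloc e2 hv, Expr.eval, e1]
  have k₂ : (Expr.op .eq (field 0 1) (.reg 2)).eval w σ₁ = if pr u = v then 1 else 0 := by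
    rw [eval_eq _ _ _ hw, hp.eval_par hloc e1 hu, Expr.eval, e2]
  refine Wp.ite (T' := (Nat.log 2 n + 1) * 60 + 350) (fun he => ?_) (fun he => ?_)
    (by simp only [field, Expr.cost]; omega)
  · rw [k₁] at he
    have he : pr v = u := by by_contra h; simp [h] at he
    rw [if_pos he]
    refine Wp.seq_straight rfl ?_ (T₁ := (Nat.log 2 n + 1) * 60 + 300)
      (by simp only [Prog.time, Expr.cost]; omega)
    refine hp.coreQuery_spec (hloc.of_frame (frame_exec (p := .assign 1 (.reg 2)) rfl) (by decide)
      (by decide)) ht hv (by omega) ?_ ?_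
    · simpa [exec, State.setReg] using e0
    · simpa [exec, State.setReg, Expr.eval] using e2
  · rw [k₁] at he
    have he : pr v ≠ u := by intro h; simp [h] at he
    rw [if_neg he]
    refine Wp.ite (T' := (Nat.log 2 n + 1) * 60 + 300) (fun he => ?_) (fun he => ?_)
      (by simp only [field, Expr.cost]; omega)
    · rw [k₂] at he
      have he : pr u = v := by by_contra h; simp [h] at he
      rw [if_pos he]
      exact hp.coreQuery_spec hloc ht hu (by omega) e0 e1
    · rw [k₂] at he
      have he : pr u ≠ v := by intro h; simp [h] at he
      rw [if_neg he]
      refine Wp.straight rfl (by simp only [field, Prog.time, Expr.cost]; omega) ?_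
      simp [exec, State.setReg, hp.eval_dist hloc e0 ht]

theorem vertexQuery_spec {σ : State} (hσ : σ.arr 0 = D) {t v : ℕ} (ht : t < n)
    (hv : v < n) (h₀ : σ.reg 0 = t) (h₁ : σ.reg 1 = v) :
    Wp w vertexQuery σ ((Nat.log 2 n + 1) * 60 + 500) (fun σ' => σ'.reg 0 =
      if pr v < n then tab t v else if v = s then 2 ^ w - 1 else dist t) := by
  have hm := hp.model
  have hw := hm.one_lt
  have hloc := hp.setup hσ
  have hf : Frame setupProg σ (exec w setupProg σ) := frame_exec rfl
  have e0 : (exec w setupProg σ).reg 0 = t := by rw [hf.reg 0 (by decide), h₀]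
  have e1 : (exec w setupProg σ).reg 1 = v := by rw [hf.reg 1 (by decide), h₁]
  refine Wp.seq_straight rfl ?_ (T₁ := (Nat.log 2 n + 1) * 60 + 400)
    (by simp only [setupProg, Prog.time, Expr.cost]; omega)
  generalize exec w setupProg σ = σ₁ at *
  have k₁ : (Expr.op .lt (field 0 1) (.reg 10)).eval w σ₁ = if pr v < n then 1 else 0 := by
    rw [eval_lt _ _ _ hw, hp.eval_par hloc e1 hv, Expr.eval, hloc.n_eq]
  refine Wp.ite (T' := (Nat.log 2 n + 1) * 60 + 350) (fun he => ?_) (fun he => ?_)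
    (by simp only [field, Expr.cost]; omega)
  · rw [k₁] at he
    have he : pr v < n := by by_contra h; simp [h] at he
    rw [if_pos he]
    exact (hp.coreQuery_spec hloc ht hv he e0 e1).mono (by omega) fun _ h => h
  · rw [k₁] at he
    have he : ¬ pr v < n := by intro h; simp [h] at he
    have hroot : pr v = n := le_antisymm (hm.pr_le v hv) (not_lt.1 he)
    rw [if_neg he]
    -- Among the vertices without a parent, `s` is recognised by its distance `0`; the others carry
    -- the all-ones word.
    refine Wp.ite (T' := (Nat.log 2 n + 1) * 60 + 300) (fun he => ?_) (fun he => ?_)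
      (by simp only [field, Expr.cost]; omega)
    · rw [hp.eval_dist hloc e1 hv] at he
      rw [if_neg (by rintro rfl; exact he hm.dist_s)]
      refine Wp.straight rfl (by simp only [field, Prog.time, Expr.cost]; omega) ?_
      simp [exec, State.setReg, hp.eval_dist hloc e0 ht]
    · rw [hp.eval_dist hloc e1 hv] at he
      have hvs : v = s := by
        by_contra h
        rw [hm.dist_root v hv hroot h] at he
        omega
      rw [if_pos hvs]
      refine Wp.straight rfl (by simp only [Prog.time, Expr.cost]; omega) ?_
      simp [exec, State.setReg, Expr.eval, hloc.top_eq]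

end Prepared

end Query

/-! ### The model of a graph -/

theorem anc_iff {V : Type*} {par : V → Option V} {a v : V} :
    Anc par a v ↔ a = v ∨ ∃ u, par v = some u ∧ Anc par a u := by
  rw [Anc, Relation.ReflTransGen.cases_head_iff, eq_comm]
  rfl

theorem Anc.par_some {V : Type*} {par : V → Option V} {v u t : V} (ha : Anc par v t)
    (h : par v = some u) : ∃ u', par t = some u' := by
  rcases anc_iff.1 ha with rfl | ⟨u', hu', -⟩
  · exact ⟨u, h⟩
  · exact ⟨u', hu'⟩

section Depth

variable {V : Type*} [Fintype V] {G : SimpleGraph V} {wt : Sym2 V → ℕ} {s : V}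
  {par : V → Option V}

open Classical in
/-- The number of proper ancestors. -/
noncomputable def depth (par : V → Option V) (v : V) : ℕ :=
  (Finset.univ.filter fun a => Anc par a v ∧ a ≠ v).card

open Classical in
theorem depth_root {v : V} (h : par v = none) : depth par v = 0 := by
  rw [depth, Finset.card_eq_zero, Finset.filter_eq_empty_iff]
  rintro a - ⟨h₁, h₂⟩
  rcases anc_iff.1 h₁ with h₁ | ⟨u, hu, -⟩
  · exact h₂ h₁
  · simp [h] at hu

namespace IsShortestPathTree

variable (hT : IsShortestPathTree G wt s par) (hpos : ∀ e ∈ G.edgeSet, 1 ≤ wt e)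
include hT hpos

theorem depth_succ {u v : V} (h : par v = some u) : depth par v = depth par u + 1 := by
  classical
  have huv : u ≠ v := (hT.adj_and_dst h).1.ne
  have key : (Finset.univ.filter fun a => Anc par a v ∧ a ≠ v) =
      insert u (Finset.univ.filter fun a => Anc par a u ∧ a ≠ u) := by
    ext a
    simp only [Finset.mem_filter, Finset.mem_univ, true_and, Finset.mem_insert]
    constructor
    · rintro ⟨h₁, h₂⟩
      rcases anc_iff.1 h₁ with h₁ | ⟨u', hu', h₁⟩
      · exact absurd h₁ h₂
      · obtain rfl : u = u' := by simpa using h.symm.trans hu'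
        by_cases hau : a = u
        · exact .inl hau
        · exact .inr ⟨h₁, hau⟩
    · rintro (rfl | ⟨h₁, h₂⟩)
      · exact ⟨.single h, huv⟩
      · refine ⟨Anc.trans h₁ (.single h), ?_⟩
        rintro rfl
        exact h₂ (hT.anc_antisymm hpos h₁ (.single h))
  unfold depth
  convert Finset.card_insert_of_notMem (s := Finset.univ.filter fun a => Anc par a u ∧ a ≠ u)
    (a := u) (by simp) using 2

open Classical in
theorem depth_lt_of_anc {a b : V} (h : Anc par a b) (hne : a ≠ b) :
    depth par a < depth par b := by
  refine Finset.card_lt_card (Finset.ssubset_iff_subset_ne.2 ⟨fun c hc => ?_, fun heq => ?_⟩)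
  · simp only [Finset.mem_filter, Finset.mem_univ, true_and] at hc ⊢
    refine ⟨hc.1.trans h, ?_⟩
    rintro rfl
    exact hne (hT.anc_antisymm hpos h hc.1)
  · have : a ∈ Finset.univ.filter fun c => Anc par c b ∧ c ≠ b := by simp [h, hne]
    rw [← heq] at this
    simp at this

end IsShortestPathTree

theorem depth_lt_card (v : V) : depth par v < Fintype.card V := by
  classical
  rw [← Finset.card_univ]
  refine Finset.card_lt_card (Finset.ssubset_iff_subset_ne.2 ⟨Finset.subset_univ _, fun h => ?_⟩)
  have := h ▸ Finset.mem_univ v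
  simp at this

end Depth

/-! Distances as words. -/

theorem encDist_top (w : ℕ) : encDist w ⊤ = 2 ^ w - 1 := if_pos rfl

theorem encDist_coe (w k : ℕ) : encDist w k = k := by simp [encDist]

/-- Only the smaller distance needs a bound: if the larger one is `⊤`, a finite smaller one must not
exceed the all-ones word. -/
theorem encDist_mono {w : ℕ} {a b : ℕ∞} (h : a ≤ b) (ha : a ≠ ⊤ → a ≤ (2 ^ w - 1 : ℕ)) :
    encDist w a ≤ encDist w b := by
  by_cases hb : b = ⊤
  · subst hb
    by_cases ha' : a = ⊤
    · rw [ha']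
    · lift a to ℕ using ha'
      rw [encDist_top, encDist_coe]
      exact_mod_cast ha (by simp)
  · lift b to ℕ using hb
    lift a to ℕ using ne_top_of_le_ne_top (by simp) h
    rw [encDist_coe, encDist_coe]
    exact_mod_cast h

theorem lt_of_encDist_lt {w : ℕ} {a b : ℕ∞} (h : encDist w a < encDist w b)
    (hb : b ≠ ⊤ → b ≤ (2 ^ w - 1 : ℕ)) : a < b := by
  by_contra hba
  exact h.not_ge (encDist_mono (not_lt.1 hba) hb)

/-! ### From a weighted graph to the word-level model. -/

section Bridge

variable {n : ℕ} {G : SimpleGraph (Fin n)} {wt : Sym2 (Fin n) → ℕ} {s : Fin n}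
  {par : Fin n → Option (Fin n)} {S : Fin n → Set (Sym2 (Fin n))}

/-- A function of vertices as a function of numbers. -/
def extend (d : ℕ) (f : Fin n → ℕ) (v : ℕ) : ℕ := if h : v < n then f ⟨v, h⟩ else d

@[simp] theorem extend_coe (d : ℕ) (f : Fin n → ℕ) (v : Fin n) : extend d f v = f v := by
  simp [extend]

/-- The parents as numbers, with `n` for no parent. -/
def parN (par : Fin n → Option (Fin n)) : ℕ → ℕ :=
  extend n fun v => (par v).elim n fun u => (u : ℕ)

/-- The weights of the edges to the parents. -/
def wtsN (wt : Sym2 (Fin n) → ℕ) (par : Fin n → Option (Fin n)) : ℕ → ℕ :=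
  extend 0 fun v => (par v).elim 0 fun u => wt s(u, v)

theorem parN_some {u v : Fin n} (h : par v = some u) : parN par v = u := by simp [parN, h]

theorem parN_none {v : Fin n} (h : par v = none) : parN par v = n := by simp [parN, h]

theorem parN_of_le {v : ℕ} (h : n ≤ v) : parN par v = n := by simp [parN, extend, h]

theorem parN_lt_iff {v : Fin n} : parN par v < n ↔ ∃ u, par v = some u := by
  cases h : par v with
  | none => simp [parN_none h]
  | some u => simp [parN_some h]

theorem parN_le (v : ℕ) : parN par v ≤ n := by
  by_cases h : v < n
  · lift v to Fin n using h
    cases h : par v with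
    | none => exact (parN_none h).le
    | some u => exact (parN_some h).trans_le u.2.le
  · exact (parN_of_le (not_lt.1 h)).le

theorem ancN_iff {a b : Fin n} : AncN (parN par) a b ↔ Anc par a b := by
  constructor
  · rintro ⟨k, hk⟩
    induction k generalizing b with
    | zero => rw [Fin.ext hk.symm]; exact .refl _
    | succ k ih =>
      rw [Function.iterate_succ_apply] at hk
      cases h : par b with
      | none =>
        rw [parN_none h, Function.iterate_fixed (parN_of_le le_rfl)] at hk
        have := a.2
        omega
      | some u =>
        rw [parN_some h] at hk
        exact Anc.trans (ih hk) (.single h)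
  · intro h
    induction h using Relation.ReflTransGen.head_induction_on with
    | refl => exact .refl _
    | head h _ ih =>
      obtain ⟨k, hk⟩ := ih
      exact ⟨k + 1, by rw [Function.iterate_succ_apply, parN_some h, hk]⟩

theorem AncN.lt {v x : ℕ} (hv : v < n) (hvx : AncN (parN par) v x) : x < n := by
  by_contra hx
  obtain ⟨k, rfl⟩ := hvx
  cases k with
  | zero => exact hx hv
  | succ k =>
    rw [Function.iterate_succ_apply, parN_of_le (not_lt.1 hx),
      Function.iterate_fixed (parN_of_le le_rfl)] at hv
    exact hv.false

/-- The words of the distances. -/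
noncomputable def distN (w : ℕ) (G : SimpleGraph (Fin n)) (wt : Sym2 (Fin n) → ℕ) (s : Fin n) :
    ℕ → ℕ :=
  extend 0 fun v => encDist w (wdist G wt s v)

/-- A table of words as a function of numbers. -/
def tabN (table : Fin n → Fin n → ℕ) (t v : ℕ) : ℕ := extend 0 (fun u => extend 0 (table u) v) t

theorem tabN_coe (table : Fin n → Fin n → ℕ) (t v : Fin n) : tabN table t v = table t v := by
  simp [tabN]

theorem wdist_le_mul {M : ℕ} (hM : ∀ e ∈ G.edgeSet, wt e ≤ M) {t : Fin n}
    (h : wdist G wt s t ≠ ⊤) : wdist G wt s t ≤ (M * n : ℕ) := by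
  have e : replDist G wt s t ∅ = wdist G wt s t := by simp [replDist, wdist]
  rw [← e] at h ⊢
  simpa using replDist_le_mul_card hM h

theorem repl_le_mul {M : ℕ} (hM : ∀ e ∈ G.edgeSet, wt e ≤ M) (t v : Fin n)
    (h : replDist G wt s t (S v) ≠ ⊤) : replDist G wt s t (S v) ≤ (M * n : ℕ) := by
  simpa using replDist_le_mul_card hM h

namespace IsShortestPathTree

variable (hT : IsShortestPathTree G wt s par)
include hT

theorem distN_of_par {w : ℕ} {v u : Fin n} (h : par v = some u) :
    distN w G wt s v = dst G wt s v := by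
  rw [distN, extend_coe, ← coe_dst (hT.reachable_of_par h), encDist_coe]

variable {w M : ℕ} (hbig : 100 * n ^ 2 + 4 * (M * n) + 1000 < 2 ^ w)
  {table : Fin n → Fin n → ℕ} (hM : ∀ e ∈ G.edgeSet, 1 ≤ wt e ∧ wt e ≤ M)
  (htable : ∀ t v u, par v = some u → table t v = encDist w (replDist G wt s t (S v)))
include hbig hM htable

theorem via_eq {t x v u : Fin n} (hv : par v = some u) (hvx : Anc par v x) (hxt : Anc par x t) :
    via w (distN w G wt s) (tabN table) t x v =
      encDist w (replDist G wt s x (S v) + (dst G wt s t - dst G wt s x : ℕ)) := by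
  obtain ⟨u₁, hu₁⟩ := hvx.par_some hv
  obtain ⟨u₂, hu₂⟩ := hxt.par_some hu₁
  rw [via, tabN_coe, htable x v u hv, hT.distN_of_par hu₁, hT.distN_of_par hu₂]
  by_cases h : replDist G wt s x (S v) = ⊤
  · rw [h, encDist_top, if_pos rfl, top_add, encDist_top]
  · have hle := repl_le_mul (fun e he => (hM e he).2) x v h
    lift replDist G wt s x (S v) to ℕ using h with k hk
    have hle : k ≤ M * n := by exact_mod_cast hle
    rw [encDist_coe, if_neg (by omega), ← Nat.cast_add, encDist_coe]

/-- A strict inequality between words comes from one between distances because the larger distance,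
if finite, is at most `2 * M * n` and fits into a word. -/
theorem bad_of_badN {t x v u : Fin n} (hv : par v = some u) (hxt : Anc par x t)
    (h : BadN w n (parN par) (distN w G wt s) (tabN table) t x v) : Bad G wt s par S t x v := by
  have hvx := ancN_iff.1 h.anc
  refine ⟨hvx, hxt, ?_⟩
  have hlt := h.lt_via
  rw [hT.via_eq hbig hM htable hv hvx hxt, tabN_coe, htable t v u hv] at hlt
  refine lt_of_encDist_lt hlt fun htop => ?_
  obtain ⟨u₁, hu₁⟩ := hvx.par_some hv
  obtain ⟨u₂, hu₂⟩ := hxt.par_some hu₁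
  have h₁ := wdist_le_mul (s := s) (t := t) (fun e he => (hM e he).2)
    (wdist_ne_top_iff.2 (hT.reachable_of_par hu₂))
  rw [← coe_dst (hT.reachable_of_par hu₂)] at h₁
  have h₁ : dst G wt s t ≤ M * n := by exact_mod_cast h₁
  have hne : replDist G wt s x (S v) ≠ ⊤ := fun h => htop (by rw [h, top_add])
  have h₂ := repl_le_mul (fun e he => (hM e he).2) x v hne
  lift replDist G wt s x (S v) to ℕ using hne with k hk
  have h₂ : k ≤ M * n := by exact_mod_cast h₂
  have : k + (dst G wt s t - dst G wt s x) ≤ 2 ^ w - 1 := by omega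
  exact_mod_cast this

/-- The minimum with `n` in the chain bound keeps all segments together within `n ^ 2` cells when
`M` is large, as the preprocessing time and the addresses require. -/
theorem model (hS : IsFailure par S) (hM1 : 1 ≤ M) :
    Model w n s (min n (Nat.sqrt (16 * M * n))) (M * n) (parN par) (wtsN wt par)
      (extend 0 (depth par)) (distN w G wt s) (tabN table) := by
  have hpos : ∀ e ∈ G.edgeSet, 1 ≤ wt e := fun e he => (hM e he).1
  have hM' : ∀ e ∈ G.edgeSet, wt e ≤ M := fun e he => (hM e he).2
  have hns : ∀ {v u : Fin n}, par v = some u → v ≠ s := by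
    rintro v u h rfl
    simp [hT.root] at h
  have hsmall : ∀ (t v : Fin n), replDist G wt s t (S v) ≠ ⊤ →
      replDist G wt s t (S v) ≤ (2 ^ w - 1 : ℕ) := fun t v h =>
    (repl_le_mul hM' t v h).trans (by exact_mod_cast (by omega))
  refine
    { s_lt := s.2
      K_le := min_le_left _ _
      big := hbig
      pr_n := parN_of_le le_rfl
      pr_le := fun v _ => parN_le v
      dep_root := fun v hv h => ?_
      dep_succ := fun v hv h => ?_
      dep_lt := fun v hv => ?_
      dist_s := ?_
      dist_root := fun v hv h hvs => ?_
      dist_succ := fun v hv h => ?_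
      dist_le := fun v hv h => ?_
      tab_le := fun t ht v hv h => ?_
      tab_of_not_anc := fun t ht v hv h hvt => ?_
      dist_le_tab := fun t ht v hv h => ?_
      tab_le_via := fun t ht x v hv h hvx hxt => ?_
      tab_le_of_bad := fun t ht x hxt v hb v' hv' h' hv'x hd => ?_
      chain := fun t ht x hxt m v hb hd htab => ?_ }
  · lift v to Fin n using hv
    cases hp : par v with
    | none => simpa using depth_root hp
    | some u => rw [parN_some hp] at h; exact absurd h u.2.ne
  · lift v to Fin n using hv
    obtain ⟨u, hu⟩ := parN_lt_iff.1 h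
    rw [parN_some hu, extend_coe, extend_coe, hT.depth_succ hpos hu]
  · lift v to Fin n using hv
    rw [extend_coe]
    simpa using depth_lt_card (par := par) v
  · simp [distN, wdist_self, encDist]
  · lift v to Fin n using hv
    have hp : par v = none := by
      cases hp : par v with
      | none => rfl
      | some u => rw [parN_some hp] at h; exact absurd h u.2.ne
    have hr := (hT.par_eq_none_iff.1 hp).resolve_left fun h => hvs (by rw [h])
    rw [distN, extend_coe, not_not.1 (fun h => hr (wdist_ne_top_iff.1 h)), encDist_top]
  · lift v to Fin n using hv
    obtain ⟨u, hu⟩ := parN_lt_iff.1 h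
    obtain ⟨-, hru, hd⟩ := hT.adj_and_dst hu
    rw [parN_some hu, hT.distN_of_par hu, hd]
    simp [distN, wtsN, hu, ← coe_dst hru, encDist_coe]
  · lift v to Fin n using hv
    obtain ⟨u, hu⟩ := parN_lt_iff.1 h
    have hr := hT.reachable_of_par hu
    have h₁ := wdist_le_mul hM' (wdist_ne_top_iff.2 hr)
    rw [← coe_dst hr] at h₁
    rw [hT.distN_of_par hu]
    exact_mod_cast h₁
  · lift t to Fin n using ht
    lift v to Fin n using hv
    obtain ⟨u, hu⟩ := parN_lt_iff.1 h
    rw [tabN_coe, htable t v u hu]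
    by_cases htop : replDist G wt s t (S v) = ⊤
    · exact .inl (by rw [htop, encDist_top])
    · have h₁ := repl_le_mul hM' t v htop
      lift replDist G wt s t (S v) to ℕ using htop with k hk
      exact .inr (by rw [encDist_coe]; exact_mod_cast h₁)
  · lift t to Fin n using ht
    lift v to Fin n using hv
    obtain ⟨u, hu⟩ := parN_lt_iff.1 h
    rw [tabN_coe, htable t v u hu, distN, extend_coe]
    congr 1
    by_cases hr : G.Reachable s t
    · rw [hT.replDist_eq_of_not_anc hS hr fun h => hvt (ancN_iff.2 h), coe_dst hr]
    · have h₁ : wdist G wt s t = ⊤ := not_not.1 fun h => hr (wdist_ne_top_iff.1 h)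
      rw [h₁]
      exact top_le_iff.1 (h₁ ▸ wdist_le_replDist _)
  · lift t to Fin n using ht
    lift v to Fin n using hv
    obtain ⟨u, hu⟩ := parN_lt_iff.1 h
    rw [tabN_coe, htable t v u hu, distN, extend_coe]
    refine encDist_mono (wdist_le_replDist _) fun h => (wdist_le_mul hM' h).trans ?_
    exact_mod_cast (by omega)
  · have hx := AncN.lt hv hvx
    lift t to Fin n using ht
    lift v to Fin n using hv
    lift x to Fin n using hx
    obtain ⟨u, hu⟩ := parN_lt_iff.1 h
    rw [ancN_iff] at hvx hxt
    rw [hT.via_eq hbig hM htable hu hvx hxt, tabN_coe, htable t v u hu]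
    exact encDist_mono (hT.replDist_le_add hS hpos (hns hu) hvx hxt) (hsmall t v)
  · have hv := hb.lt
    have hx := AncN.lt hv hb.anc
    lift t to Fin n using ht
    lift v to Fin n using hv
    lift v' to Fin n using hv'
    lift x to Fin n using hx
    obtain ⟨u, hu⟩ := parN_lt_iff.1 hb.pr_lt
    obtain ⟨u', hu'⟩ := parN_lt_iff.1 h'
    rw [ancN_iff] at hv'x hxt
    have hbad := hT.bad_of_badN hbig hM htable hu hxt hb
    rw [tabN_coe, tabN_coe, htable t v u hu, htable t v' u' hu']
    refine encDist_mono ?_ (hsmall t v')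
    refine hT.replDist_le_of_bad hS hpos (hns hu) hbad ?_ hv'x
    -- Both failures are ancestors of `x`, hence comparable, and the depths decide which is higher.
    rcases hbad.1.total hv'x with h | h
    · exact h
    · by_cases hne : v' = v
      · rw [hne]; exact .refl _
      · have := hT.depth_lt_of_anc hpos h hne
        simp only [extend_coe] at hd
        omega
  · rcases Nat.eq_zero_or_pos m with rfl | hm
    · exact Nat.zero_le _
    have hx := AncN.lt (hb 0 hm).lt (hb 0 hm).anc
    lift t to Fin n using ht
    lift x to Fin n using hx
    rw [ancN_iff] at hxt
    have hex : ∀ i, ∃ y : Fin n, i < m → v i = y := fun i => by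
      by_cases hi : i < m
      · exact ⟨⟨v i, (hb i hi).lt⟩, fun _ => rfl⟩
      · exact ⟨s, fun h => absurd h hi⟩
    choose y hy using hex
    have hpar : ∀ i < m, ∃ u, par (y i) = some u := fun i hi => by
      have := (hb i hi).pr_lt
      rw [hy i hi] at this
      exact parN_lt_iff.1 this
    have hbad : ∀ i < m, Bad G wt s par S t x (y i) := fun i hi => by
      obtain ⟨u, hu⟩ := hpar i hi
      exact hT.bad_of_badN hbig hM htable hu hxt (hy i hi ▸ hb i hi)
    have hdep : ∀ i j, i < j → j < m → depth par (y j) < depth par (y i) := fun i j hij hj => by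
      have := hd i j hij hj
      rwa [hy i (by omega), hy j hj, extend_coe, extend_coe] at this
    have hr : G.Reachable s t := by
      obtain ⟨u, hu⟩ := hpar 0 hm
      exact hT.reachable_of_anc' ((hbad 0 hm).1.trans hxt) (hT.reachable_of_par hu)
    refine le_min ?_ (Nat.le_sqrt'.2 ?_)
    · have := Fintype.card_le_of_injective (fun i : Fin m => y i) fun i j hij => by
        rcases lt_trichotomy i j with h | h | h
        · have := hdep i j h j.2
          simp only at hij
          rw [hij] at this
          exact absurd this (lt_irrefl _)
        · exact h
        · have := hdep j i h i.2
          simp only at hij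
          rw [hij] at this
          exact absurd this (lt_irrefl _)
      simpa using this
    -- The climb lists failures from below, whereas the counting lemma lists them from above; the
    -- index is reversed.
    · have := hT.sq_le_of_bad_chain hS hM1 hM hr (m := m) (x := x) (fun i => y (m - 1 - i))
        (fun i hi => ?_) (fun i j hij hj => ?_) (fun i j hij hj => ?_)
      · simpa using this
      · obtain ⟨u, hu⟩ := hpar (m - 1 - i) (by omega)
        exact ⟨hns hu, hbad _ (by omega)⟩
      · have h := hdep (m - 1 - j) (m - 1 - i) (by omega) (by omega)
        have hne : y (m - 1 - i) ≠ y (m - 1 - j) := by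
          intro heq
          rw [heq] at h
          exact h.false
        refine ⟨?_, hne⟩
        rcases (hbad (m - 1 - i) (by omega)).1.total (hbad (m - 1 - j) (by omega)).1 with h' | h'
        · exact h'
        · have := hT.depth_lt_of_anc hpos h' hne.symm
          omega
      · obtain ⟨u, hu⟩ := hpar (m - 1 - i) (by omega)
        obtain ⟨u', hu'⟩ := hpar (m - 1 - j) (by omega)
        have h := htab (m - 1 - j) (m - 1 - i) (by omega) (by omega)
        rw [hy _ (by omega), hy _ (by omega), tabN_coe, tabN_coe, htable t _ _ hu,
          htable t _ _ hu'] at h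
        exact lt_of_encDist_lt h (hsmall t _)

end IsShortestPathTree

end Bridge

/-! ### Size estimate, the two kinds of failure and the assembly. -/

section Main

variable {n : ℕ} {G : SimpleGraph (Fin n)} {wt : Sym2 (Fin n) → ℕ} {s : Fin n}
  {par : Fin n → Option (Fin n)} {S : Fin n → Set (Sym2 (Fin n))}

theorem cells_ofFn {m : ℕ} (f : Fin m → ℕ) {i : ℕ} (h : i < m) :
    cells (List.ofFn f) i = f ⟨i, h⟩ := by
  simp [cells, h]

theorem buildInput_tree (table : Fin n → Fin n → ℕ) {v : ℕ} (hv : v < n) :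
    (buildInput wt s par table).arr 0 v = parN par v ∧
      (buildInput wt s par table).arr 1 v = wtsN wt par v := by
  constructor <;> simp only [buildInput, parN, wtsN, extend, hv, dif_pos, cells_ofFn]

theorem buildInput_table (table : Fin n → Fin n → ℕ) {t v : ℕ} (ht : t < n) (hv : v < n) :
    (buildInput wt s par table).arr 2 (t * n + v) = tabN table t v := by
  have h : t * n + v < n * n := by nlinarith
  have h₁ : (t * n + v) / n = t := by
    rw [mul_comm, Nat.mul_add_div (by omega), Nat.div_eq_of_lt hv, add_zero]
  have h₂ : (t * n + v) % n = v := by rw [mul_comm, Nat.mul_add_mod, Nat.mod_eq_of_lt hv]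
  simp only [buildInput, tabN, extend, ht, hv, dif_pos, cells_ofFn _ h]
  congr 1 <;> ext <;> simp [Fin.divNat, Fin.modNat, h₁, h₂]

/-- The word size suffices for all numbers that occur. -/
theorem big_of_pow_le {M w : ℕ} (hn : 1 ≤ n) (hM : 1 ≤ M) (h : (n + M) ^ 20 ≤ 2 ^ w) :
    100 * n ^ 2 + 4 * (M * n) + 1000 < 2 ^ w := by
  refine lt_of_lt_of_le ?_ h
  -- As `n + M ≥ 2`, eighteen of the twenty factors pay for the numerical constants and two for the
  -- quadratic terms.
  have h₁ : 2 ^ 18 ≤ (n + M) ^ 18 := Nat.pow_le_pow_left (by omega) 18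
  have h₂ : (n + M) ^ 20 = (n + M) ^ 18 * (n + M) ^ 2 := by ring
  have h₃ := Nat.mul_le_mul_right ((n + M) ^ 2) h₁
  have h₄ : (n + M) ^ 2 = n ^ 2 + 2 * (M * n) + M ^ 2 := by ring
  have h₅ : 1 ≤ n ^ 2 := Nat.one_le_pow _ _ hn
  omega

theorem length_oracleList (n L R B : ℕ) (par dist dep piv rb lo hi rows nid nval bd bv : ℕ → ℕ) :
    (oracleList n L R B par dist dep piv rb lo hi rows nid nval bd bv).length =
      4 + 7 * n + R + 2 * (n * L) + 2 * B := by
  simp [oracleList]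
  ring

/-- Minimality of `L` gives `L ≤ √n + 1 ≤ 2 * √n`, and `L ≥ √n` with `c * L ≤ n` gives `c ≤ √n`. The
segments contribute `n * K` with `K ≤ 4 * √(M * n)`, the dominant term. -/
theorem size_bound {M L c B K : ℕ} (hn : 1 ≤ n) (hM : 1 ≤ M) (hL : (L - 1) * (L - 1) < n)
    (hL' : n ≤ L * L) (hc : c * L ≤ n) (hB : B ≤ n * K) (hK : K * K ≤ 16 * M * n) :
    ((4 + 7 * n + n * c + 2 * (n * L) + 2 * B : ℕ) : ℝ) ≤
      2000 * (M : ℝ) ^ (1 / 2 : ℝ) * (n : ℝ) ^ (3 / 2 : ℝ) := by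
  have hn' : (1 : ℝ) ≤ n := by exact_mod_cast hn
  have hM' : (1 : ℝ) ≤ M := by exact_mod_cast hM
  have e₁ : (n : ℝ) ^ (3 / 2 : ℝ) = n * √n := by
    rw [Real.sqrt_eq_rpow, show (3 / 2 : ℝ) = 1 + 1 / 2 by norm_num,
      Real.rpow_add (by linarith), Real.rpow_one]
  rw [e₁, ← Real.sqrt_eq_rpow]
  have a1 : (1 : ℝ) ≤ √n := Real.one_le_sqrt.2 hn'
  have b1 : (1 : ℝ) ≤ √M := Real.one_le_sqrt.2 hM'
  have an : √n * √n = n := Real.mul_self_sqrt (by linarith)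
  have bM : √M * √M = M := Real.mul_self_sqrt (by linarith)
  have hL1 : 1 ≤ L := by
    rcases Nat.eq_zero_or_pos L with rfl | h
    · omega
    · exact h
  have kL : (L : ℝ) ≤ 2 * √n := by
    have : ((L : ℝ) - 1) * (L - 1) ≤ n := by
      have := hL.le
      rw [← Nat.cast_le (α := ℝ)] at this
      push_cast [hL1] at this
      exact this
    have := Real.le_sqrt_of_sq_le ((sq _).trans_le this)
    linarith
  have kc : (c : ℝ) ≤ √n := by
    have h₁ : √n ≤ (L : ℝ) := Real.sqrt_le_iff.2 ⟨by positivity, by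
      rw [sq]; exact_mod_cast hL'⟩
    have h₂ : (c : ℝ) * L ≤ n := by exact_mod_cast hc
    by_contra h
    nlinarith
  have kK : (K : ℝ) ≤ 4 * (√M * √n) := by
    have h : (K : ℝ) * K ≤ 16 * M * n := by exact_mod_cast hK
    refine le_of_sq_le_sq ?_ (by positivity)
    nlinarith
  have kB : (B : ℝ) ≤ n * (4 * (√M * √n)) :=
    (show (B : ℝ) ≤ n * K by exact_mod_cast hB).trans (by gcongr)
  have p1 : (1 : ℝ) ≤ √M * √n := by nlinarith
  have p2 : √n ≤ √M * √n := by nlinarith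
  have q1 : (n : ℝ) * 1 ≤ n * (√M * √n) := by gcongr
  have q2 : (n : ℝ) * c ≤ n * (√M * √n) := by gcongr; exact kc.trans p2
  have q3 : (n : ℝ) * L ≤ n * (2 * (√M * √n)) := by gcongr; linarith
  push_cast
  linarith

/-- The failure of the edge to the parent. -/
theorem isFailure_edge (hT : IsShortestPathTree G wt s par)
    (hpos : ∀ e ∈ G.edgeSet, 1 ≤ wt e) :
    IsFailure par fun v => {e | ∃ u, par v = some u ∧ e = s(u, v)} := by
  refine ⟨?_, fun v => .inr ?_⟩
  · rintro v e ⟨u, -, rfl⟩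
    simp
  · rintro y hy ⟨u, hu, h⟩
    rw [Sym2.eq_swap, Sym2.congr_left] at h
    -- Otherwise `v` and `y` would be parents of each other, which the depths exclude.
    subst h
    have := hT.depth_succ hpos hy
    have := hT.depth_succ hpos hu
    omega

/-- The failure of a vertex. -/
theorem isFailure_vertex :
    IsFailure par fun v => {e | v ∈ e} :=
  ⟨fun _ _ h => h, fun _ => .inl fun _ h => h⟩

theorem replDist_edge {t u v : Fin n} (h : par v = some u) :
    replDist G wt s t {e | ∃ u, par v = some u ∧ e = s(u, v)} = edgeReplDist G wt s t s(u, v) := by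
  rw [edgeReplDist_eq_replDist]
  congr 1
  ext e
  simp [h]

namespace IsShortestPathTree

variable (hT : IsShortestPathTree G wt s par)
include hT

/-- The tree path to `t` uses tree edges only, so it survives the failure of any other edge. -/
theorem edgeReplDist_of_not_tree {t u v : Fin n} (h₁ : par v ≠ some u) (h₂ : par u ≠ some v) :
    edgeReplDist G wt s t s(u, v) = wdist G wt s t := by
  rw [edgeReplDist_eq_replDist]
  refine le_antisymm ?_ (wdist_le_replDist _)
  by_cases hr : G.Reachable s t
  · obtain ⟨p, k₁, -, k₃⟩ := hT.exists_walk (hT.anc_of_reachable hr)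
    rw [dst_self, add_zero] at k₁
    rw [← coe_dst hr, ← k₁]
    refine replDist_le p fun e he hev => ?_
    obtain ⟨y, x, hy, rfl, -⟩ := k₃ e he
    rcases Sym2.eq_iff.1 hev with ⟨rfl, rfl⟩ | ⟨rfl, rfl⟩
    · exact h₁ hy
    · exact h₂ hy
  · rw [not_not.1 (fun h => hr (wdist_ne_top_iff.1 h))]
    exact le_top

/-- Such a `v` is not reachable from `s`, so no walk from `s` visits it. -/
theorem vertexReplDist_of_par_none {t v : Fin n} (h : par v = none) (hv : v ≠ s) :
    vertexReplDist G wt s t v = wdist G wt s t := by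
  refine le_antisymm (le_iInf fun p => iInf₂_le p fun hvp => ?_)
    (le_iInf₂ fun p _ => wdist_le p)
  obtain ⟨q, -⟩ := Walk.mem_support_iff_exists_append.1 hvp
  rcases hT.par_eq_none_iff.1 h with h | h
  · exact hv h
  · exact h ⟨q⟩

/-- The preprocessing builds a small data structure from which the query programs answer. -/
theorem exists_oracle {w M : ℕ} {table : Fin n → Fin n → ℕ} (hM1 : 1 ≤ M)
    (hM : ∀ e ∈ G.edgeSet, 1 ≤ wt e ∧ wt e ≤ M) (hw : (n + M) ^ 20 ≤ 2 ^ w)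
    (hS : IsFailure par S)
    (htable : ∀ t v u, par v = some u → table t v = encDist w (replDist G wt s t (S v))) :
    ∃ D : List ℕ, BuildsWithin w buildProg (buildInput wt s par table) (2000 * n ^ 2) D ∧
      (D.length : ℝ) ≤ (2000 : ℕ) * (M : ℝ) ^ (1 / 2 : ℝ) * (n : ℝ) ^ (3 / 2 : ℝ) ∧
      (∀ t u v : Fin n, AnswersWithin w edgeQuery D [t, u, v] (2000 * (Nat.log 2 n + 1) ^ 1)
        (if par v = some u then table t v else if par u = some v then table t u
          else encDist w (wdist G wt s t))) ∧
      ∀ t v : Fin n, AnswersWithin w vertexQuery D [t, v] (2000 * (Nat.log 2 n + 1) ^ 1)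
        (if par v = none then if v = s then 2 ^ w - 1 else encDist w (wdist G wt s t)
          else table t v) := by
  have hn : 1 ≤ n := s.pos
  have hm := hT.model (big_of_pow_le hn hM1 hw) hM htable hS hM1
  obtain ⟨σ', c, hrun, hc, L, r, R, B, par', dist', dep', piv, rb, lo, hi, rows, nid, nval, bd, bv,
    ho, hout⟩ := hm.buildProg_spec (σ := buildInput wt s par table) rfl rfl
    (fun v hv => (buildInput_tree table hv).1) (fun v hv _ => (buildInput_tree table hv).2)
    (fun t ht v hv => buildInput_table table ht hv) (fun i => rfl)
  have hp : Prepared .. := ⟨hm, ho, isStored_oracleList ..⟩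
  refine ⟨_, ⟨σ', c, hrun, hc, hout⟩, ?_, fun t u v => ?_, fun t v => ?_⟩
  · rw [length_oracleList, ho.R_eq]
    refine (size_bound hn hM1 ho.L_sq ho.le_sq ho.count_le ho.B_le ?_).trans_eq (by norm_num)
    exact (Nat.mul_self_le_mul_self (min_le_right _ _)).trans (Nat.sqrt_le _)
  · obtain ⟨σ₂, c₂, hrun₂, hc₂, h⟩ := hp.edgeQuery_spec (σ := queryInput _ [(t : ℕ), u, v]) rfl
      t.2 u.2 v.2 rfl rfl rfl
    refine ⟨σ₂, c₂, hrun₂, hc₂.trans (by rw [pow_one]; omega), h.trans ?_⟩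
    have key : ∀ a b : Fin n, parN par a = b ↔ par a = some b := fun a b => by
      cases ha : par a with
      | none => simpa [parN_none ha] using b.2.ne'
      | some c => simp [parN_some ha, Fin.ext_iff]
    simp only [key, tabN_coe, distN, extend_coe]
  · obtain ⟨σ₂, c₂, hrun₂, hc₂, h⟩ := hp.vertexQuery_spec (σ := queryInput _ [(t : ℕ), v]) rfl
      t.2 v.2 rfl rfl
    refine ⟨σ₂, c₂, hrun₂, hc₂.trans (by rw [pow_one]; omega), h.trans ?_⟩
    cases hv : par v with
    | none => simp [parN_none hv, distN, Fin.ext_iff]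
    | some u => simp [parN_some hv, tabN_coe]

end IsShortestPathTree

theorem vertexReplDist_self (t : Fin n) : vertexReplDist G wt s t s = ⊤ :=
  iInf₂_eq_top.2 fun p hp => absurd p.start_mem_support hp

end Main

end SSDSO

theorem mainTheorem1 :
    -- edge failures
    (∃ (build query : Prog) (C k κ : ℕ),
      ∀ (n M w : ℕ) (G : SimpleGraph (Fin n)) (wt : Sym2 (Fin n) → ℕ) (s : Fin n)
        (par : Fin n → Option (Fin n)),
        1 ≤ M → (∀ e ∈ G.edgeSet, 1 ≤ wt e ∧ wt e ≤ M) →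
        IsShortestPathTree G wt s par → (n + M) ^ κ ≤ 2 ^ w →
        ∃ D : List ℕ,
          BuildsWithin w build (buildInput wt s par (edgeTable w G wt s par)) (C * n ^ 2) D ∧
          (D.length : ℝ) ≤ C * (M : ℝ) ^ (1 / 2 : ℝ) * (n : ℝ) ^ (3 / 2 : ℝ) ∧
          ∀ t u v : Fin n, G.Adj u v →
            AnswersWithin w query D [t, u, v] (C * (Nat.log 2 n + 1) ^ k)
              (encDist w (edgeReplDist G wt s t s(u, v)))) ∧
    -- vertex failures
    (∃ (build query : Prog) (C k κ : ℕ),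
      ∀ (n M w : ℕ) (G : SimpleGraph (Fin n)) (wt : Sym2 (Fin n) → ℕ) (s : Fin n)
        (par : Fin n → Option (Fin n)),
        1 ≤ M → (∀ e ∈ G.edgeSet, 1 ≤ wt e ∧ wt e ≤ M) →
        IsShortestPathTree G wt s par → (n + M) ^ κ ≤ 2 ^ w →
        ∃ D : List ℕ,
          BuildsWithin w build (buildInput wt s par (vertexTable w G wt s)) (C * n ^ 2) D ∧
          (D.length : ℝ) ≤ C * (M : ℝ) ^ (1 / 2 : ℝ) * (n : ℝ) ^ (3 / 2 : ℝ) ∧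
          ∀ t v : Fin n,
            AnswersWithin w query D [t, v] (C * (Nat.log 2 n + 1) ^ k)
              (encDist w (vertexReplDist G wt s t v))) := by
  refine ⟨⟨buildProg, edgeQuery, 2000, 1, 20, fun n M w G wt s par hM1 hM hT hw => ?_⟩,
    ⟨buildProg, vertexQuery, 2000, 1, 20, fun n M w G wt s par hM1 hM hT hw => ?_⟩⟩
  · obtain ⟨D, h₁, h₂, h₃, -⟩ := hT.exists_oracle (table := edgeTable w G wt s par) hM1 hM hw
      (isFailure_edge hT fun e he => (hM e he).1)
      (fun t v u h => by rw [replDist_edge h, edgeTable, h]; rfl)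
    refine ⟨D, h₁, h₂, fun t u v _ => ?_⟩
    convert h₃ t u v using 1
    split_ifs with k₁ k₂
    · simp [edgeTable, k₁]
    · simp [edgeTable, k₂, Sym2.eq_swap]
    · rw [hT.edgeReplDist_of_not_tree k₁ k₂]
  · obtain ⟨D, h₁, h₂, -, h₃⟩ := hT.exists_oracle (table := vertexTable w G wt s) hM1 hM hw
      isFailure_vertex (fun t v u h => by
        rw [vertexTable, vertexReplDist_eq_replDist t fun hv => by simp [hv, hT.root] at h])
    refine ⟨D, h₁, h₂, fun t v => ?_⟩
    convert h₃ t v using 1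
    split_ifs with k₁ k₂
    · rw [k₂, vertexReplDist_self, encDist_top]
    · rw [hT.vertexReplDist_of_par_none k₁ k₂]
    · rfl
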